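/- Let $\Sigma$ be a finite, non-empty, totally ordered alphabet and let $w\ge 1$. **Layers and ODDs.** A $(\Sigma,w)$-layer is a tuple $B=(\ell,r,T,I,J,\iota,\phi)$ with $\ell,r\subseteq\{0,\dots,w-1\}$ (left and right states), $T\subseteq \ell\times\Sigma\times r$, $I\subseteq \ell$, $J\subseteq r$ and Boolean flags $\iota,\phi$ such that $I=\emptyset$ if $\iota=0$, and $J=\emptyset$ if $\phi=0$. The finite set of these layers is denoted $\mathcal B(\Sigma,w)$. It is ordered by comparing $\iota,\phi,\ell,r,I,J,T$ lexicographically in this order, where two finite sets are compared by the largest element of their symmetric difference (the set containing it is the larger one) and triples in $T$ are ordered lexicographically. A $(\Sigma,w)$-ODD of length $k\ge1$ is a string $D=B_1\cdots B_k$ over $\mathcal B(\Sigma,w)$ with $\ell(B_{i+1})=r(B_i)$ for $i<k$, in which exactly $B_1$ has $\iota=1$ and exactly $B_k$ has $\phi=1$. It accepts a string $s_1\cdots s_k\in\Sigma^k$ if there are states $q_0\in I(B_1),q_1,\dots,q_k\in J(B_k)$ with $(q_{i-1},s_i,q_i)\in T(B_i)$ for all $i$. Its language $\mathcal L(D)$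 is the pair consisting of $k$ and the set of accepted strings. $D$ is deterministic (complete) if in each layer every left state has at most (at least) one transition for each symbol and, if $\iota=1$, then $I=\ell$ and $|\ell|=1$ (respectively $I\neq\emptyset$). The number of states of $D$ is $|\ell(B_1)|+\sum_i|r(B_i)|$. The canonical form $\mathcal C(D)$ of an ODD $D$ is the unique deterministic, complete ODD $E$ with $\mathcal L(E)=\mathcal L(D)$ that has the minimum number of states among all deterministic, complete ODDs, of any width, with this language, and that is normalized: in every layer, $\ell=\{0,\dots,a-1\}$ and $r=\{0,\dots,b-1\}$ for some $a,b\ge1$, every right state has an incoming transition, and the right states are numbered in the order of the lexicographically least pairs (left state, symbol) leading to them. **Second-order automata.** A $(\Sigma,w)$-SOFA is a (nondeterministic) finite automaton $F$ over the alphabet $\mathcal B(\Sigma,w)$ such that every string in its language $\mathcal L(F)$ is a $(\Sigma,w)$-ODD. Its second language is $\mathcal L_2(F)=\{\mathcal L(D): D\in\mathcal L(F)\}$. The second canonical form of $F$ over $\mathcal B(\Sigma,v)$ is the deterministic, complete automaton over $\mathcal B(\Sigma,v)$ with the minimum number of states that accepts $\{\mathcal C(D): D\in\mathcal L(F)\}$,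 with states $0,\dots,m-1$ numbered in the order of the first strings reaching them (strings being ordered first by length, then lexicographically). $\mathcal C_2(F)$ denotes the second canonical form over $\mathcal B(\Sigma,2^w)$. **Claim.** Let $F$ be a $(\Sigma,w)$-SOFA with $n$ states all of whose accepted ODDs are deterministic and complete. Then $\mathcal C_2(F)$ exists, is unique, and is in fact a $(\Sigma,w)$-SOFA, in the following sense. Removing from $\mathcal C_2(F)$ the transitions labelled by layers outside $\mathcal B(\Sigma,w)$ does not change its language $\{\mathcal C(D):D\in\mathcal L(F)\}$, and yields a $(\Sigma,w)$-SOFA that is the second canonical form of $F$ over $\mathcal B(\Sigma,w)$ (again deterministic, complete, normalized and with the minimum number of states) and has second language $\mathcal L_2(F)$. Moreover, there are one algorithm and one constant $c$, independent of $\Sigma$, $w$ and $F$, such that the algorithm, given $\Sigma$, $w$ and $F$ (automata are given by their states and an explicit list of transitions), constructs this $(\Sigma,w)$-SOFA in at most $$2^{\max(1,n)\cdot 2^{\,c\,|\Sigma|\,w\log_2(w+1)}}$$ steps. Steps are counted on a random access machine with unit-cost addition, truncated subtraction, indirect load and store, and zero tests. -/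

import Mathlib

universe u

namespace SecondOrder

/-! ## Layers and ordered decision diagrams -/

/-- A layer over the alphabet `α`: left and right states (natural numbers), transitions from left
to right states labelled by symbols, initial states, final states, and the two Boolean flags. -/
@[ext] structure Layer (α : Type u) where
  left : Finset ℕ
  right : Finset ℕ
  trans : Finset (ℕ × α × ℕ)
  init : Finset ℕ
  final : Finset ℕ
  initFlag : Bool
  finalFlag : Bool
  trans_mem : ∀ t ∈ trans, t.1 ∈ left ∧ t.2.2 ∈ right
  init_subset : init ⊆ left
  final_subset : final ⊆ right
  init_eq_empty : initFlag = false → init = ∅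
  final_eq_empty : finalFlag = false → final = ∅

namespace Layer

variable {α : Type u}

/-- All states of the layer belong to `{0, …, w - 1}`. -/
def WidthLE (w : ℕ) (l : Layer α) : Prop :=
  l.left ⊆ Finset.range w ∧ l.right ⊆ Finset.range w

theorem WidthLE.mono {v w : ℕ} (h : v ≤ w) {l : Layer α} (hl : l.WidthLE v) : l.WidthLE w :=
  ⟨hl.1.trans (Finset.range_mono h), hl.2.trans (Finset.range_mono h)⟩

def Deterministic (l : Layer α) : Prop :=
  (l.initFlag = true → l.init = l.left ∧ l.left.card = 1) ∧
    ∀ p ∈ l.left, ∀ a : α, ∀ q ∈ l.right, ∀ q' ∈ l.right,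
      (p, a, q) ∈ l.trans → (p, a, q') ∈ l.trans → q = q'

def Complete (l : Layer α) : Prop :=
  (l.initFlag = true → l.init ≠ ∅) ∧
    ∀ p ∈ l.left, ∀ a : α, ∃ q ∈ l.right, (p, a, q) ∈ l.trans

def Reachable (l : Layer α) : Prop :=
  ∀ q ∈ l.right, ∃ a : α, ∃ p ∈ l.left, (p, a, q) ∈ l.trans

/-- The right states are numbered in the order of the lexicographically least pairs
`(left state, symbol)` leading to them; `ν q` is that pair for the right state `q`. -/
def WellOrdered [LinearOrder α] (l : Layer α) : Prop :=
  l.Reachable ∧ l.Deterministic ∧ ∃ ν : ℕ → ℕ ×ₗ α,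
    (∀ q ∈ l.right, IsLeast {x : ℕ ×ₗ α | ((ofLex x).1, (ofLex x).2, q) ∈ l.trans} (ν q)) ∧
      ∀ q ∈ l.right, ∀ q' ∈ l.right, (q < q' ↔ ν q < ν q')

def Contiguous (l : Layer α) : Prop :=
  ∃ a b : ℕ, 0 < a ∧ 0 < b ∧ l.left = Finset.range a ∧ l.right = Finset.range b

def Normalized [LinearOrder α] (l : Layer α) : Prop :=
  l.WellOrdered ∧ l.Contiguous

/-- A transition triple, with triples ordered lexicographically. -/
def lexTriple : ℕ × α × ℕ ↪ ℕ ×ₗ (α ×ₗ ℕ) :=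
  ⟨fun t => toLex (t.1, toLex (t.2.1, t.2.2)), fun s t h => by
    have h1 : s.1 = t.1 := congrArg (fun x => (ofLex x).1) h
    have h2 : s.2.1 = t.2.1 := congrArg (fun x => (ofLex (ofLex x).2).1) h
    have h3 : s.2.2 = t.2.2 := congrArg (fun x => (ofLex (ofLex x).2).2) h
    exact Prod.ext h1 (Prod.ext h2 h3)⟩

/-- The components of a layer, each finite set being compared as the binary number with that set
of one-bits. -/
def key [LinearOrder α] (l : Layer α) :
    Bool ×ₗ (Bool ×ₗ (Colex (Finset ℕ) ×ₗ (Colex (Finset ℕ) ×ₗ (Colex (Finset ℕ) ×ₗ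
      (Colex (Finset ℕ) ×ₗ Colex (Finset (ℕ ×ₗ (α ×ₗ ℕ)))))))) :=
  toLex (l.initFlag, toLex (l.finalFlag, toLex (toColex l.left, toLex (toColex l.right,
    toLex (toColex l.init, toLex (toColex l.final, toColex (l.trans.map lexTriple)))))))

theorem key_injective [LinearOrder α] : Function.Injective (key (α := α)) := by
  intro l m h
  simp only [key, toLex_inj, Prod.mk.injEq, toColex_inj, Finset.map_inj] at h
  obtain ⟨h1, h2, h3, h4, h5, h6, h7⟩ := h
  exact Layer.ext h3 h4 h7 h5 h6 h1 h2

/-- The fixed total order on layers: lexicographic comparison of the components. -/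
noncomputable instance [LinearOrder α] : LinearOrder (Layer α) :=
  LinearOrder.lift' key key_injective

end Layer

/-- The finite alphabet of all `(α, w)`-layers, with the order inherited from `Layer α`. -/
abbrev LayerAlphabet (α : Type u) (w : ℕ) : Type u := {l : Layer α // l.WidthLE w}

section ODD

variable {α : Type u}

/-- `D` is an `(α, w)`-ordered decision diagram of length `D.length`. -/
def IsODD (w : ℕ) (D : List (Layer α)) : Prop :=
  D ≠ [] ∧ (∀ l ∈ D, l.WidthLE w) ∧ D.IsChain (fun l m => m.left = l.right) ∧
    ∀ (i : ℕ) (h : i < D.length),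
      (D[i].initFlag = true ↔ i = 0) ∧ (D[i].finalFlag = true ↔ i + 1 = D.length)

/-- `D` accepts `s`: there is an accepting sequence `(q 0, s₀, q 1), (q 1, s₁, q 2), …`. -/
def ODDAccepts (D : List (Layer α)) (s : List α) : Prop :=
  s.length = D.length ∧ ∃ (hD : D ≠ []) (q : ℕ → ℕ),
    q 0 ∈ (D.head hD).init ∧ q D.length ∈ (D.getLast hD).final ∧
      ∀ (i : ℕ) (h : i < D.length) (h' : i < s.length), (q i, s[i], q (i + 1)) ∈ D[i].trans

/-- The length-typed language of `D`. -/
def oddLang (D : List (Layer α)) : ℕ × Set (List α) :=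
  (D.length, {s | ODDAccepts D s})

/-- `D` is a deterministic, complete `(α, w)`-ODD. -/
def IsCDODD (w : ℕ) (D : List (Layer α)) : Prop :=
  IsODD w D ∧ ∀ l ∈ D, l.Deterministic ∧ l.Complete

def oddNumStates : List (Layer α) → ℕ
  | [] => 0
  | l :: D => l.left.card + ((l :: D).map fun m => m.right.card).sum

/-- No deterministic, complete ODD (of any width) with the language of `D` has fewer states. -/
def ODDMinimized (D : List (Layer α)) : Prop :=
  ∀ w : ℕ, 0 < w → ∀ D' : List (Layer α), IsCDODD w D' → oddLang D' = oddLang D →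
    oddNumStates D ≤ oddNumStates D'

/-- `E` is the canonical form of the ODD `D`: the minimized, deterministic, complete, normalized
ODD with the language of `D`. -/
def IsCanonicalODD [LinearOrder α] (D E : List (Layer α)) : Prop :=
  (∃ w : ℕ, 0 < w ∧ IsCDODD w E) ∧ ODDMinimized E ∧ (∀ l ∈ E, l.Normalized) ∧
    oddLang E = oddLang D

end ODD

/-! ## Finite automata and second-order finite automata -/

/-- A (nondeterministic) finite automaton over `Γ`, with its states numbered `0, …, n - 1`. -/
structure FA (Γ : Type u) where
  n : ℕ
  nfa : NFA Γ (Fin n)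

namespace FA

variable {Γ : Type u}

def Deterministic (F : FA Γ) : Prop :=
  (∃! q, q ∈ F.nfa.start) ∧ ∀ q a, (F.nfa.step q a).Subsingleton

def Complete (F : FA Γ) : Prop :=
  F.nfa.start.Nonempty ∧ ∀ q a, (F.nfa.step q a).Nonempty

/-- Every state `q` is reached by some string, and the states are numbered in the
(length-)lexicographic order of the first strings `lex q` reaching them. -/
def Normalized [LT Γ] (F : FA Γ) : Prop :=
  ∃ lex : Fin F.n → List Γ,
    (∀ q, q ∈ F.nfa.eval (lex q) ∧
      ∀ s, q ∈ F.nfa.eval s → s = lex q ∨ List.Shortlex (· < ·) (lex q) s) ∧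
    ∀ q q', q < q' ↔ List.Shortlex (· < ·) (lex q) (lex q')

/-- No deterministic, complete automaton over `Γ` with the same language has fewer states. -/
def Minimal (F : FA Γ) : Prop :=
  ∀ G : FA Γ, G.Deterministic → G.Complete → G.nfa.accepts = F.nfa.accepts → F.n ≤ G.n

variable {α : Type u}

/-- The language of an automaton over the alphabet of `(α, w)`-layers, as a set of strings of
layers. -/
def firstLang {w : ℕ} (F : FA (LayerAlphabet α w)) : Set (List (Layer α)) :=
  (List.map Subtype.val) '' {x | x ∈ F.nfa.accepts}

/-- `F` is an `(α, w)`-second-order finite automaton. -/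
def IsSOFA {w : ℕ} (F : FA (LayerAlphabet α w)) : Prop :=
  ∀ D ∈ F.firstLang, IsODD w D

def secondLang {w : ℕ} (F : FA (LayerAlphabet α w)) : Set (ℕ × Set (List α)) :=
  oddLang '' F.firstLang

/-- `C`, an automaton over the alphabet of `(α, v)`-layers, is the second canonical form of `F`
over that alphabet: the deterministic, complete, normalized automaton with the minimum number of
states whose language is the set of the canonical forms of the ODDs in the language of `F`. -/
def IsSecondCanonicalForm [LinearOrder α] {w v : ℕ} (F : FA (LayerAlphabet α w))
    (C : FA (LayerAlphabet α v)) : Prop :=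
  C.Deterministic ∧ C.Complete ∧ C.Normalized ∧ C.Minimal ∧
    C.firstLang = {E | ∃ D ∈ F.firstLang, IsCanonicalODD D E}

/-- Keep only those transitions whose label is an `(α, w)`-layer. -/
def restrict {w v : ℕ} (h : w ≤ v) (F : FA (LayerAlphabet α v)) : FA (LayerAlphabet α w) where
  n := F.n
  nfa :=
    { step := fun q l => F.nfa.step q ⟨l.1, l.2.mono h⟩
      start := F.nfa.start
      accept := F.nfa.accept }

end FA

/-! ## Encodings as lists of natural numbers -/

section Encoding

variable {α : Type u}

/-- The characteristic vector of a property along a list. -/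
noncomputable def bits {β : Type*} (xs : List β) (P : β → Prop) : List ℕ :=
  open Classical in xs.map fun x => if P x then 1 else 0

/-- An `(α, w)`-layer as a bit vector: the flags, the characteristic vectors of the four sets of
states, and that of the set of transitions `(p, a, q)`, listed in lexicographic order. -/
noncomputable def layerCode [Fintype α] [LinearOrder α] (w : ℕ) (l : Layer α) : List ℕ :=
  [l.initFlag.toNat, l.finalFlag.toNat] ++
    bits (List.range w) (· ∈ l.left) ++ bits (List.range w) (· ∈ l.right) ++
    bits (List.range w) (· ∈ l.init) ++ bits (List.range w) (· ∈ l.final) ++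
    (List.range w).flatMap fun p => ((Finset.univ : Finset α).sort (· ≤ ·)).flatMap fun a =>
      bits (List.range w) fun q => (p, a, q) ∈ l.trans

/-- `x` describes the automaton `F`: the alphabet size, the width, the number of states, the
initial and the final states, and a list of all transitions, each occurring once, in any order. -/
def FA.IsCode [Fintype α] [LinearOrder α] {w : ℕ} (F : FA (LayerAlphabet α w)) (x : List ℕ) :
    Prop :=
  ∃ ts : List (Fin F.n × LayerAlphabet α w × Fin F.n),
    ts.Nodup ∧ (∀ p l q, (p, l, q) ∈ ts ↔ q ∈ F.nfa.step p l) ∧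
    x = [Fintype.card α, w, F.n] ++ bits (List.finRange F.n) (· ∈ F.nfa.start) ++
      bits (List.finRange F.n) (· ∈ F.nfa.accept) ++ [ts.length] ++
      ts.flatMap fun t => (t.1 : ℕ) :: (t.2.2 : ℕ) :: layerCode w t.2.1.1

end Encoding

/-! ## The machine model: a random access machine, programmed with while-programs

Registers and memory cells hold natural numbers; the memory consists of banks, each of them
indexed by the natural numbers. Every elementary instruction and every test takes one step; the
only arithmetic is addition and truncated subtraction. -/

/-- Programs. Registers and banks are named by fixed numbers; cells are addressed through
registers. -/
inductive Prog : Type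
  | skip : Prog
  /-- `r := k` -/
  | const (r k : ℕ) : Prog
  /-- `r := s + t` -/
  | add (r s t : ℕ) : Prog
  /-- `r := s - t`, truncated at zero -/
  | sub (r s t : ℕ) : Prog
  /-- `r := b[s]` -/
  | load (r b s : ℕ) : Prog
  /-- `b[s] := r` -/
  | store (b s r : ℕ) : Prog
  | seq (P Q : Prog) : Prog
  /-- `if r ≠ 0 then P else Q` -/
  | ite (r : ℕ) (P Q : Prog) : Prog
  /-- `while r ≠ 0 do P` -/
  | loop (r : ℕ) (P : Prog) : Prog

/-- The contents of the registers and of the memory banks. -/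
structure Mem where
  reg : ℕ → ℕ
  bank : ℕ → ℕ → ℕ

namespace Mem

def setReg (s : Mem) (r v : ℕ) : Mem :=
  { s with reg := Function.update s.reg r v }

def setCell (s : Mem) (b i v : ℕ) : Mem :=
  { s with bank := Function.update s.bank b (Function.update (s.bank b) i v) }

/-- The start configuration on input `x`: the length of `x` is in register `0` and its entries are
in the first cells of bank `0`; everything else is `0`. -/
def start (x : List ℕ) : Mem where
  reg r := if r = 0 then x.length else 0
  bank b i := if b = 0 then x.getD i 0 else 0

/-- The output `y` stands in the same place as an input. -/
def Outputs (s : Mem) (y : List ℕ) : Prop :=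
  s.reg 0 = y.length ∧ ∀ (i : ℕ) (h : i < y.length), s.bank 0 i = y[i]

end Mem

/-- `Exec P s t s'`: started in `s`, the program `P` halts after exactly `t` steps, in `s'`. -/
inductive Exec : Prog → Mem → ℕ → Mem → Prop
  | skip (s : Mem) : Exec .skip s 1 s
  | const (r k : ℕ) (s : Mem) : Exec (.const r k) s 1 (s.setReg r k)
  | add (r a b : ℕ) (s : Mem) : Exec (.add r a b) s 1 (s.setReg r (s.reg a + s.reg b))
  | sub (r a b : ℕ) (s : Mem) : Exec (.sub r a b) s 1 (s.setReg r (s.reg a - s.reg b))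
  | load (r b a : ℕ) (s : Mem) : Exec (.load r b a) s 1 (s.setReg r (s.bank b (s.reg a)))
  | store (b a r : ℕ) (s : Mem) : Exec (.store b a r) s 1 (s.setCell b (s.reg a) (s.reg r))
  | seq {P Q : Prog} {s s' s'' : Mem} {t t' : ℕ} :
      Exec P s t s' → Exec Q s' t' s'' → Exec (.seq P Q) s (t + t') s''
  | ite_true {r : ℕ} {P Q : Prog} {s s' : Mem} {t : ℕ} :
      s.reg r ≠ 0 → Exec P s t s' → Exec (.ite r P Q) s (t + 1) s'
  | ite_false {r : ℕ} {P Q : Prog} {s s' : Mem} {t : ℕ} :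
      s.reg r = 0 → Exec Q s t s' → Exec (.ite r P Q) s (t + 1) s'
  | loop_true {r : ℕ} {P : Prog} {s s' s'' : Mem} {t t' : ℕ} :
      s.reg r ≠ 0 → Exec P s t s' → Exec (.loop r P) s' t' s'' →
        Exec (.loop r P) s (t + t' + 1) s''
  | loop_false {r : ℕ} {P : Prog} {s : Mem} : s.reg r = 0 → Exec (.loop r P) s 1 s

end SecondOrder

/-! A deterministic, complete diagram is minimized as in Myhill–Nerode: level by level, reachable
states with equal residual languages are merged. The canonical form is this quotient, its states
numbered by least incoming pairs. The decisive point is that being the canonical form can be checked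
locally. `E` is the canonical form of `D` exactly when there are partial maps of `{0, …, w - 1}` to
itself, one per level, forming a homomorphism from a part of `D` containing its initial state onto
`E` (`Compat`, `HomRun`), where each layer of `E` satisfies conditions that mention no other layer
(`Layer.Good`). Distinct rows within a layer, and distinct finality in the last one, are enough: by
induction from the end they force distinct residuals (`allDist_of_good`). The equivalence is
`isCanonicalODD_iff`; it rests on the construction of the quotient (`exists_homRun`) and on the
layerwise lower bound for numbers of states together with its equality case (`sum_card_le`,
`allDist_of_sum_card_le`).

Consequently the canonical forms of the diagrams in the language of `F` are recognized by a
nondeterministic automaton with `n * (w + 1) ^ w` states, the pairs of a state of `F` and a partial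
map: it reads `E` and guesses `D` and the maps (`meets_start_iff`). The subset construction, Nerode
equivalence and a breadth-first search that meets strings in shortlex order produce the minimal
normalized automaton (`BfsInv.step`, `IsNumbering.nice`), and there is only one (`FA.Nice.unique`).
Equivalence of two subsets is decided by testing which backward images of the accepting set they
meet; these images are found by saturation (`mark_spec`).

A quotient has at most as many states on a level as `D`, so no canonical form uses a layer wider
than `w`. Over a wider alphabet the additional letters therefore lead to the dead state. That state
is already reached by the empty layer, the least letter of both alphabets, so the numbering by first
strings is unaffected (`FA.Nice.extend`, `FA.exists_secondCanonicalForm`).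

For the running time, layers, subsets and partial maps become natural numbers, layers in such a way
that the order of numbers is the prescribed order (`number_strictMono`). The algorithm is written in
a language of loops bounded by sixteen parameters. Compiled programs run in time polynomial in the
largest parameter (`Stage.exists_cost_le`), and with `Y = (w + 1) ^ (|Σ| * w)` the parameters are at
most `2 ^ (8 * (max 1 n * Y ^ 6))` (`param_bounds`). -/

namespace SecondOrder

/-! ## A structured language of bounded loops, compiled to the machine -/

/-- Bounded iteration: `iter n f x = f (n-1) (… (f 0 x))`. -/
def iter {β : Type*} : ℕ → (ℕ → β → β) → β → β
  | 0, _, x => x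
  | n + 1, f, x => f n (iter n f x)

/-- Pure expressions over an environment of variables (de Bruijn indices), sixteen parameters
and the memory banks. The body of a `fold` sees the accumulator and the index as its first two
variables; `weak k e` evaluates `e` without the first `k` variables. -/
inductive Ex : Type
  | var (i : ℕ)
  | par (j : Fin 16)
  | num (k : ℕ)
  | add (a b : Ex)
  | sub (a b : Ex)
  | rd (b : ℕ) (a : Ex)
  | ite (c a b : Ex)
  | fold (j : Fin 16) (a b : Ex)
  | weak (k : ℕ) (a : Ex)

namespace Ex

def eval (π : Fin 16 → ℕ) (bk : ℕ → ℕ → ℕ) : Ex → List ℕ → ℕ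
  | var i, ρ => ρ.getD i 0
  | par j, _ => π j
  | num k, _ => k
  | add a b, ρ => eval π bk a ρ + eval π bk b ρ
  | sub a b, ρ => eval π bk a ρ - eval π bk b ρ
  | rd b a, ρ => bk b (eval π bk a ρ)
  | ite c a b, ρ => if eval π bk c ρ ≠ 0 then eval π bk a ρ else eval π bk b ρ
  | fold j a b, ρ => iter (π j) (fun i x => eval π bk b (x :: i :: ρ)) (eval π bk a ρ)
  | weak k a, ρ => eval π bk a (ρ.drop k)

/-- `r := s`, with `z` as scratch register. -/
def move (r s z : ℕ) : Prog := .seq (.const z 0) (.add r s z)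

/-- Code leaving the value of the expression in register `k`, given the registers `ρ` of the
variables; only registers from `k` on are changed. -/
def comp : Ex → List ℕ → ℕ → Prog
  | var i, ρ, k => match ρ[i]? with
    | some r => move k r (k + 1)
    | none => .const k 0
  | par j, _, k => move k j (k + 1)
  | num v, _, k => .const k v
  | add a b, ρ, k => .seq (comp a ρ (k + 1)) (.seq (comp b ρ (k + 2)) (.add k (k + 1) (k + 2)))
  | sub a b, ρ, k => .seq (comp a ρ (k + 1)) (.seq (comp b ρ (k + 2)) (.sub k (k + 1) (k + 2)))
  | rd b a, ρ, k => .seq (comp a ρ (k + 1)) (.load k b (k + 1))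
  | ite c a b, ρ, k => .seq (comp c ρ k) (.ite k (comp a ρ k) (comp b ρ k))
  | fold j a b, ρ, k => .seq (comp a ρ k) (.seq (.const (k + 1) 0) (.seq (move (k + 2) j (k + 3))
      (.loop (k + 2) (.seq (comp b (k :: (k + 1) :: ρ) (k + 3)) (.seq (move k (k + 3) (k + 4))
        (.seq (.const (k + 4) 1) (.seq (.add (k + 1) (k + 1) (k + 4))
          (.sub (k + 2) (k + 2) (k + 4)))))))))
  | weak i a, ρ, k => comp a (ρ.drop i) k

/-- A bound for the running time if all parameters are at most `M`. -/
def cost (M : ℕ) : Ex → ℕ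
  | var _ => 2
  | par _ => 2
  | num _ => 1
  | add a b => cost M a + cost M b + 1
  | sub a b => cost M a + cost M b + 1
  | rd _ a => cost M a + 1
  | ite c a b => cost M c + (cost M a + cost M b) + 1
  | fold _ a b => cost M a + 4 + M * (cost M b + 6)
  | weak _ a => cost M a

end Ex

/-- `P`, started in `s`, halts within `T` steps in a state satisfying `Q`. -/
def Runs (P : Prog) (s : Mem) (T : ℕ) (Q : Mem → Prop) : Prop :=
  ∃ t s', Exec P s t s' ∧ t ≤ T ∧ Q s'

theorem Runs.seq {P P' : Prog} {s : Mem} {T T' : ℕ} {Q Q' : Mem → Prop} (h : Runs P s T Q)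
    (h' : ∀ s', Q s' → Runs P' s' T' Q') : Runs (.seq P P') s (T + T') Q' := by
  obtain ⟨t, s', he, ht, hq⟩ := h
  obtain ⟨t', s'', he', ht', hq'⟩ := h' s' hq
  exact ⟨_, _, .seq he he', by omega, hq'⟩

theorem Runs.mono {P : Prog} {s : Mem} {T T' : ℕ} {Q Q' : Mem → Prop} (h : Runs P s T Q)
    (hT : T ≤ T') (hQ : ∀ s', Q s' → Q' s') : Runs P s T' Q' := by
  obtain ⟨t, s', he, ht, hq⟩ := h
  exact ⟨t, s', he, by omega, hQ _ hq⟩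

theorem Runs.const {r k : ℕ} {s : Mem} {Q : Mem → Prop} (h : Q (s.setReg r k)) :
    Runs (.const r k) s 1 Q := ⟨_, _, .const .., le_rfl, h⟩

theorem Runs.add {r a b : ℕ} {s : Mem} {Q : Mem → Prop}
    (h : Q (s.setReg r (s.reg a + s.reg b))) : Runs (.add r a b) s 1 Q :=
  ⟨_, _, .add .., le_rfl, h⟩

theorem Runs.sub {r a b : ℕ} {s : Mem} {Q : Mem → Prop}
    (h : Q (s.setReg r (s.reg a - s.reg b))) : Runs (.sub r a b) s 1 Q :=
  ⟨_, _, .sub .., le_rfl, h⟩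

theorem Runs.load {r a b : ℕ} {s : Mem} {Q : Mem → Prop}
    (h : Q (s.setReg r (s.bank b (s.reg a)))) : Runs (.load r b a) s 1 Q :=
  ⟨_, _, .load .., le_rfl, h⟩

theorem Runs.store {r a b : ℕ} {s : Mem} {Q : Mem → Prop}
    (h : Q (s.setCell b (s.reg a) (s.reg r))) : Runs (.store b a r) s 1 Q :=
  ⟨_, _, .store .., le_rfl, h⟩

theorem Runs.ite {r : ℕ} {P P' : Prog} {s : Mem} {T T' : ℕ} {Q : Mem → Prop}
    (h : s.reg r ≠ 0 → Runs P s T Q) (h' : s.reg r = 0 → Runs P' s T' Q) :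
    Runs (.ite r P P') s (T + T' + 1) Q := by
  by_cases hr : s.reg r = 0
  · obtain ⟨t, s', he, ht, hq⟩ := h' hr
    exact ⟨_, _, .ite_false hr he, by omega, hq⟩
  · obtain ⟨t, s', he, ht, hq⟩ := h hr
    exact ⟨_, _, .ite_true hr he, by omega, hq⟩

/-- A counting loop: `Inv i` holds after `i` rounds. -/
theorem Runs.loop {r n : ℕ} {P : Prog} {T : ℕ} (Inv : ℕ → Mem → Prop)
    (hstep : ∀ i s, i < n → Inv i s → s.reg r = n - i →
      Runs P s T fun s' => Inv (i + 1) s' ∧ s'.reg r = n - (i + 1)) :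
    ∀ (m i : ℕ) (s : Mem), i + m = n → Inv i s → s.reg r = n - i →
      Runs (.loop r P) s (m * (T + 1) + 1) (Inv n)
  | 0, i, s, hi, hs, hr =>
    ⟨1, s, .loop_false (by omega), by omega, by rwa [show n = i by omega]⟩
  | m + 1, i, s, hi, hs, hr => by
    obtain ⟨t, s', he, ht, hq, hr'⟩ := hstep i s (by omega) hs hr
    obtain ⟨t', s'', he', ht', hq'⟩ := Runs.loop Inv hstep m (i + 1) s' (by omega) hq hr'
    refine ⟨_, s'', .loop_true (by omega) he he', ?_, hq'⟩
    have : (m + 1) * (T + 1) = m * (T + 1) + (T + 1) := by ring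
    omega

@[simp] theorem Mem.setReg_reg (s : Mem) (r v x : ℕ) :
    (s.setReg r v).reg x = if x = r then v else s.reg x := by
  simp [Mem.setReg, Function.update_apply]

@[simp] theorem Mem.setReg_bank (s : Mem) (r v : ℕ) : (s.setReg r v).bank = s.bank := rfl

@[simp] theorem Mem.setCell_reg (s : Mem) (b i v : ℕ) : (s.setCell b i v).reg = s.reg := rfl

/-- The state `s'` agrees with `s` on the registers below `k`. -/
def Keeps (k : ℕ) (s s' : Mem) : Prop := ∀ r < k, s'.reg r = s.reg r

/-- The parameters held by a state. -/
def Mem.pars (s : Mem) : Fin 16 → ℕ := fun j => s.reg j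

theorem Keeps.pars {k : ℕ} {s s' : Mem} (h : Keeps k s s') (hk : 16 ≤ k) : s'.pars = s.pars :=
  funext fun j => h _ (by omega)

theorem Keeps.map {k : ℕ} {s s' : Mem} (h : Keeps k s s') {ρ : List ℕ} (hρ : ∀ r ∈ ρ, r < k) :
    ρ.map s'.reg = ρ.map s.reg :=
  List.map_congr_left fun r hr => h _ (hρ r hr)

theorem Keeps.trans {k k' : ℕ} {s s' s'' : Mem} (h : Keeps k s s') (h' : Keeps k' s' s'')
    (hk : k ≤ k') : Keeps k s s'' := fun r hr => (h' r (by omega)).trans (h r hr)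

theorem Keeps.mono {k k' : ℕ} {s s' : Mem} (h : Keeps k' s s') (hk : k ≤ k') : Keeps k s s' :=
  fun r hr => h r (by omega)

theorem Runs.move {r a z : ℕ} {s : Mem} (hz : z ≠ a) {Q : Mem → Prop}
    (h : Q ((s.setReg z 0).setReg r (s.reg a))) : Runs (Ex.move r a z) s 2 Q :=
  Runs.seq (T := 1) (T' := 1) (Runs.const (Q := fun s' => s' = s.setReg z 0) rfl) fun s' hs' => by
    subst hs'
    refine Runs.add ?_
    simpa [hz.symm] using h

namespace Ex

/-- The induction runs on a stack discipline: code with target register `k` writes only to registers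
from `k` on. Hence the variables listed in `ρ`, the intermediate results stored below the current
target, and (because `16 ≤ k`) the parameters in registers `0` to `15` survive the evaluation of
subexpressions. -/
theorem comp_spec (M : ℕ) (e : Ex) : ∀ (ρ : List ℕ) (k : ℕ) (s : Mem), (∀ r ∈ ρ, r < k) →
    16 ≤ k → (∀ j, s.pars j ≤ M) →
    Runs (e.comp ρ k) s (e.cost M) fun s' => s'.bank = s.bank ∧ Keeps k s s' ∧
      s'.reg k = e.eval s.pars s.bank (ρ.map s.reg) := by
  induction e with
  | var i =>
    intro ρ k s hρ hk hM
    simp only [comp, eval, cost]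
    rcases h : ρ[i]? with _ | r
    · refine (Runs.const ?_).mono (by omega) fun _ h => h
      refine ⟨rfl, fun r hr => ?_, ?_⟩
      · simp [hr.ne]
      · simp [List.getD, h]
    · have hr := hρ r (List.mem_of_getElem? h)
      refine Runs.move (by omega) ⟨rfl, fun x hx => ?_, ?_⟩
      · simp [hx.ne, (show x ≠ k + 1 by omega)]
      · simp [List.getD, h]
  | par j =>
    intro ρ k s hρ hk hM
    refine Runs.move (by omega) ⟨rfl, fun x hx => ?_, ?_⟩
    · simp [hx.ne, (show x ≠ k + 1 by omega)]
    · simp [eval, Mem.pars]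
  | num v =>
    intro ρ k s hρ hk hM
    exact Runs.const ⟨rfl, fun x hx => by simp [hx.ne], by simp [eval]⟩
  | add a b iha ihb =>
    intro ρ k s hρ hk hM
    refine Runs.mono (Runs.seq (iha ρ (k + 1) s (fun r hr => (hρ r hr).trans (by omega))
      (by omega) hM) (T' := b.cost M + 1) ?_) (by simp only [cost]; omega) fun _ h => h
    rintro s1 ⟨hb1, hk1, hv1⟩
    refine Runs.seq (ihb ρ (k + 2) s1 (fun r hr => (hρ r hr).trans (by omega))
      (by omega) (by rwa [hk1.pars (by omega)])) ?_
    rintro s2 ⟨hb2, hk2, hv2⟩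
    refine Runs.add ⟨by simp [hb2, hb1], fun x hx => ?_, ?_⟩
    · simp [hx.ne, hk2 x (by omega), hk1 x (by omega)]
    · simp only [Mem.setReg_reg, if_true, eval]
      rw [hv2, hk2 _ (by omega), hv1, hk1.pars (by omega), hb1,
        (hk1.mono (show k ≤ k + 1 by omega)).map hρ]
  | sub a b iha ihb =>
    intro ρ k s hρ hk hM
    refine Runs.mono (Runs.seq (iha ρ (k + 1) s (fun r hr => (hρ r hr).trans (by omega))
      (by omega) hM) (T' := b.cost M + 1) ?_) (by simp only [cost]; omega) fun _ h => h
    rintro s1 ⟨hb1, hk1, hv1⟩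
    refine Runs.seq (ihb ρ (k + 2) s1 (fun r hr => (hρ r hr).trans (by omega))
      (by omega) (by rwa [hk1.pars (by omega)])) ?_
    rintro s2 ⟨hb2, hk2, hv2⟩
    refine Runs.sub ⟨by simp [hb2, hb1], fun x hx => ?_, ?_⟩
    · simp [hx.ne, hk2 x (by omega), hk1 x (by omega)]
    · simp only [Mem.setReg_reg, if_true, eval]
      rw [hv2, hk2 _ (by omega), hv1, hk1.pars (by omega), hb1,
        (hk1.mono (show k ≤ k + 1 by omega)).map hρ]
  | rd b a iha =>
    intro ρ k s hρ hk hM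
    refine Runs.seq (iha ρ (k + 1) s (fun r hr => (hρ r hr).trans (by omega))
      (by omega) hM) ?_
    rintro s1 ⟨hb1, hk1, hv1⟩
    refine Runs.load ⟨by simp [hb1], fun x hx => ?_, ?_⟩
    · simp [hx.ne, hk1 x (by omega)]
    · simp only [Mem.setReg_reg, if_true, eval]
      rw [hv1, hb1]
  | ite c a b ihc iha ihb =>
    intro ρ k s hρ hk hM
    refine Runs.mono (Runs.seq (ihc ρ k s hρ hk hM) (T' := a.cost M + b.cost M + 1) ?_)
      (by simp only [cost]; omega) fun _ h => h
    rintro s1 ⟨hb1, hk1, hv1⟩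
    refine Runs.ite (fun h => ?_) (fun h => ?_)
    · refine (iha ρ k s1 hρ hk (by rwa [hk1.pars hk])).mono le_rfl ?_
      rintro s2 ⟨hb2, hk2, hv2⟩
      refine ⟨hb2.trans hb1, hk1.trans hk2 le_rfl, ?_⟩
      rw [hv2, eval, if_pos (by rwa [← hv1]), hk1.pars hk, hb1, hk1.map hρ]
    · refine (ihb ρ k s1 hρ hk (by rwa [hk1.pars hk])).mono le_rfl ?_
      rintro s2 ⟨hb2, hk2, hv2⟩
      refine ⟨hb2.trans hb1, hk1.trans hk2 le_rfl, ?_⟩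
      rw [hv2, eval, if_neg (by rw [← hv1]; simpa using h), hk1.pars hk, hb1, hk1.map hρ]
  | weak i a iha =>
    intro ρ k s hρ hk hM
    have := iha (ρ.drop i) k s (fun r hr => hρ r (List.mem_of_mem_drop hr)) hk hM
    simpa only [comp, eval, cost, List.map_drop] using this
  | fold j a b iha ihb =>
    intro ρ k s hρ hk hM
    have hT : (fold j a b).cost M = a.cost M + (1 + (2 + (M * (b.cost M + 6) + 1))) := by
      simp only [cost]; omega
    rw [hT]
    set f : ℕ → ℕ → ℕ := fun i x => b.eval s.pars s.bank (x :: i :: ρ.map s.reg) with hf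
    set n := s.pars j with hn
    refine Runs.seq (iha ρ k s hρ hk hM) ?_
    rintro s1 ⟨hb1, hk1, hv1⟩
    refine Runs.seq (Runs.const (Q := fun s' => s' = s1.setReg (k + 1) 0) rfl) ?_
    rintro s2 rfl
    refine Runs.seq (Runs.move (Q := fun s' => s' = _) (by omega) rfl) ?_
    rintro s3 rfl
    -- Registers `k`, `k + 1` and `k + 2` hold the accumulator, the index and the rounds left; the
    -- body is evaluated from `k + 3` on. The `5` counts the move of the result and the three
    -- instructions updating index and counter; the test of the loop makes it the `6` in `cost`.
    refine Runs.mono (Runs.loop (n := n) (T := b.cost M + 5)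
      (fun i s' => s'.bank = s.bank ∧ Keeps k s s' ∧ s'.reg (k + 1) = i ∧
        s'.reg k = iter i f (a.eval s.pars s.bank (ρ.map s.reg))) ?_ n 0 _ (by omega) ?_ ?_)
      ?_ ?_
    · rintro i t hi ⟨hb, hkp, hidx, hacc⟩ hr
      refine Runs.mono (Runs.seq (ihb (k :: (k + 1) :: ρ) (k + 3) t ?_ (by omega) ?_)
        (T' := 5) ?_) (by omega) fun _ h => h
      · intro r hr
        simp only [List.mem_cons] at hr
        rcases hr with rfl | rfl | hr
        · omega
        · omega
        · exact (hρ r hr).trans (by omega)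
      · rwa [hkp.pars hk]
      rintro t1 ⟨hb1, hk1, hv1⟩
      refine Runs.seq (T := 2) (T' := 3) (Runs.move (Q := fun s' => s' = _) (by omega) rfl) ?_
      rintro t2 rfl
      refine Runs.seq (T := 1) (T' := 2) (Runs.const (Q := fun s' => s' = _) rfl) ?_
      rintro t3 rfl
      refine Runs.seq (T := 1) (T' := 1) (Runs.add (Q := fun s' => s' = _) rfl) ?_
      rintro t4 rfl
      refine Runs.sub ⟨⟨by simp [hb1, hb], fun x hx => ?_, ?_, ?_⟩, ?_⟩
      · simp [hx.ne, (show x ≠ k + 1 by omega), (show x ≠ k + 2 by omega),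
          (show x ≠ k + 4 by omega), hk1 x (by omega), hkp x (by omega)]
      · simp [hk1 (k + 1) (by omega), hidx]
      · simp only [Mem.setReg_reg]
        simp [hv1, iter, hf, hacc, hkp.pars hk, hb, hidx, hkp.map hρ]
      · simp [hk1 (k + 2) (by omega), hr]
        omega
    · refine ⟨hb1, fun x hx => ?_, by simp, by simpa [iter] using hv1⟩
      simp [(show x ≠ k + 1 by omega), (show x ≠ k + 2 by omega),
          (show x ≠ k + 3 by omega), hk1 x (by omega)]
    · have : s1.reg j = s.reg j := hk1 j (by omega)
      simp [hn, Mem.pars, this, (show (j : ℕ) ≠ k + 1 by omega)]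
    · have : n * (b.cost M + 5 + 1) ≤ M * (b.cost M + 6) := Nat.mul_le_mul (hM j) le_rfl
      omega
    · rintro s' ⟨h1, h2, -, h4⟩
      exact ⟨h1, h2, by rw [h4, eval]⟩

/-- Costs grow polynomially. -/
theorem exists_cost_le (e : Ex) : ∃ C d : ℕ, ∀ M, e.cost M ≤ C * (M + 1) ^ d := by
  have aux : ∀ {a b : Ex}, (∃ C d : ℕ, ∀ M, a.cost M ≤ C * (M + 1) ^ d) →
      (∃ C d : ℕ, ∀ M, b.cost M ≤ C * (M + 1) ^ d) → ∀ k,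
      ∃ C d : ℕ, ∀ M, a.cost M + b.cost M + k ≤ C * (M + 1) ^ d := by
    rintro a b ⟨C, d, h⟩ ⟨C', d', h'⟩ k
    refine ⟨C + C' + k, d + d', fun M => ?_⟩
    have h1 : (M + 1) ^ d ≤ (M + 1) ^ (d + d') := Nat.pow_le_pow_right (by omega) (by omega)
    have h2 : (M + 1) ^ d' ≤ (M + 1) ^ (d + d') := Nat.pow_le_pow_right (by omega) (by omega)
    have h3 : 1 ≤ (M + 1) ^ (d + d') := Nat.one_le_pow _ _ (by omega)
    calc _ ≤ C * (M + 1) ^ (d + d') + C' * (M + 1) ^ (d + d') + k * (M + 1) ^ (d + d') :=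
          add_le_add (add_le_add ((h M).trans (Nat.mul_le_mul le_rfl h1))
            ((h' M).trans (Nat.mul_le_mul le_rfl h2))) (by nlinarith)
      _ = _ := by ring
  induction e with
  | var i => exact ⟨2, 0, fun M => by simp [cost]⟩
  | par j => exact ⟨2, 0, fun M => by simp [cost]⟩
  | num v => exact ⟨1, 0, fun M => by simp [cost]⟩
  | add a b iha ihb => exact aux iha ihb 1
  | sub a b iha ihb => exact aux iha ihb 1
  | rd b a iha =>
    obtain ⟨C, d, h⟩ := aux iha iha 1
    exact ⟨C, d, fun M => le_trans (by simp only [cost]; omega) (h M)⟩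
  | ite c a b ihc iha ihb =>
    obtain ⟨C, d, h⟩ := aux (a := c) (b := add a b) ihc (aux iha ihb 1) 1
    exact ⟨C, d, fun M => le_trans (by simp only [cost]; omega) (h M)⟩
  | weak i a iha => exact iha
  | fold j a b iha ihb =>
    -- The summand `10` absorbs the overhead `4 + 6 * M` of a fold, since `4 + 6 * M ≤ 10 * (M +
    -- 1)`.
    obtain ⟨C, d, h⟩ := aux iha ihb 10
    refine ⟨C, d + 1, fun M => ?_⟩
    calc (fold j a b).cost M ≤ (a.cost M + b.cost M + 10) * (M + 1) := by
          simp only [cost]; nlinarith [Nat.zero_le (M * a.cost M), Nat.zero_le (b.cost M)]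
      _ ≤ C * (M + 1) ^ d * (M + 1) := Nat.mul_le_mul (h M) le_rfl
      _ = _ := by ring

end Ex

/-- Commands: assignments to memory cells, composition, and bounded loops whose body sees the
index as its first variable. -/
inductive Cmd : Type
  | skip
  | store (b : ℕ) (i v : Ex)
  | seq (c d : Cmd)
  | ite (e : Ex) (c d : Cmd)
  | rep (j : Fin 16) (c : Cmd)

/-! ### Commands: semantics, compilation and cost. -/

namespace Cmd

def setCell (bk : ℕ → ℕ → ℕ) (b i v : ℕ) : ℕ → ℕ → ℕ :=
  Function.update bk b (Function.update (bk b) i v)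

def run (π : Fin 16 → ℕ) : Cmd → List ℕ → (ℕ → ℕ → ℕ) → ℕ → ℕ → ℕ
  | skip, _, bk => bk
  | store b i v, ρ, bk => setCell bk b (i.eval π bk ρ) (v.eval π bk ρ)
  | seq c d, ρ, bk => run π d ρ (run π c ρ bk)
  | ite e c d, ρ, bk => if e.eval π bk ρ ≠ 0 then run π c ρ bk else run π d ρ bk
  | rep j c, ρ, bk => iter (π j) (fun i bk => run π c (i :: ρ) bk) bk

def comp : Cmd → List ℕ → ℕ → Prog
  | skip, _, _ => .skip
  | store b i v, ρ, k => .seq (i.comp ρ k) (.seq (v.comp ρ (k + 1)) (.store b k (k + 1)))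
  | seq c d, ρ, k => .seq (comp c ρ k) (comp d ρ k)
  | ite e c d, ρ, k => .seq (e.comp ρ k) (.ite k (comp c ρ k) (comp d ρ k))
  | rep j c, ρ, k => .seq (.const k 0) (.seq (Ex.move (k + 1) j (k + 2))
      (.loop (k + 1) (.seq (comp c (k :: ρ) (k + 2)) (.seq (.const (k + 2) 1)
        (.seq (.add k k (k + 2)) (.sub (k + 1) (k + 1) (k + 2)))))))

def cost (M : ℕ) : Cmd → ℕ
  | skip => 1
  | store _ i v => i.cost M + v.cost M + 1
  | seq c d => cost M c + cost M d
  | ite e c d => e.cost M + (cost M c + cost M d) + 1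
  | rep _ c => 4 + M * (cost M c + 4)

theorem comp_spec (M : ℕ) (c : Cmd) : ∀ (ρ : List ℕ) (k : ℕ) (s : Mem), (∀ r ∈ ρ, r < k) →
    16 ≤ k → (∀ j, s.pars j ≤ M) →
    Runs (c.comp ρ k) s (c.cost M) fun s' =>
      s'.bank = c.run s.pars (ρ.map s.reg) s.bank ∧ Keeps k s s' := by
  induction c with
  | skip => exact fun ρ k s _ _ _ => ⟨1, s, .skip s, le_rfl, rfl, fun _ _ => rfl⟩
  | store b i v =>
    intro ρ k s hρ hk hM
    refine Runs.mono (Runs.seq (i.comp_spec M ρ k s hρ hk hM) (T' := v.cost M + 1) ?_)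
      (by simp only [cost]; omega) fun _ h => h
    rintro s1 ⟨hb1, hk1, hv1⟩
    refine Runs.seq (v.comp_spec M ρ (k + 1) s1 (fun r hr => (hρ r hr).trans (by omega))
      (by omega) (by rwa [hk1.pars hk])) ?_
    rintro s2 ⟨hb2, hk2, hv2⟩
    refine Runs.store ⟨?_, fun x hx => ?_⟩
    · rw [hk2 k (by omega), hv1, hv2, hk1.pars hk, hb1, hk1.map hρ]
      simp only [Mem.setCell, run, setCell, hb2, hb1]
    · simp [hk2 x (by omega), hk1 x hx]
  | seq c d ihc ihd =>
    intro ρ k s hρ hk hM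
    refine Runs.seq (ihc ρ k s hρ hk hM) ?_
    rintro s1 ⟨hb1, hk1⟩
    refine (ihd ρ k s1 hρ hk (by rwa [hk1.pars hk])).mono le_rfl ?_
    rintro s2 ⟨hb2, hk2⟩
    exact ⟨by rw [hb2, run, hb1, hk1.pars hk, hk1.map hρ], hk1.trans hk2 le_rfl⟩
  | ite e c d ihc ihd =>
    intro ρ k s hρ hk hM
    refine Runs.mono (Runs.seq (e.comp_spec M ρ k s hρ hk hM)
      (T' := c.cost M + d.cost M + 1) ?_) (by simp only [cost]; omega) fun _ h => h
    rintro s1 ⟨hb1, hk1, hv1⟩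
    refine Runs.ite (fun h => ?_) (fun h => ?_)
    · refine (ihc ρ k s1 hρ hk (by rwa [hk1.pars hk])).mono le_rfl ?_
      rintro s2 ⟨hb2, hk2⟩
      refine ⟨?_, hk1.trans hk2 le_rfl⟩
      rw [hb2, run, if_pos (by rwa [← hv1]), hk1.pars hk, hb1, hk1.map hρ]
    · refine (ihd ρ k s1 hρ hk (by rwa [hk1.pars hk])).mono le_rfl ?_
      rintro s2 ⟨hb2, hk2⟩
      refine ⟨?_, hk1.trans hk2 le_rfl⟩
      rw [hb2, run, if_neg (by rw [← hv1]; simpa using h), hk1.pars hk, hb1, hk1.map hρ]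
  | rep j c ihc =>
    intro ρ k s hρ hk hM
    have hT : (rep j c).cost M = 1 + (2 + (M * (c.cost M + 4) + 1)) := by
      simp only [cost]; omega
    rw [hT]
    set f : ℕ → (ℕ → ℕ → ℕ) → ℕ → ℕ → ℕ :=
      fun i bk => c.run s.pars (i :: ρ.map s.reg) bk with hf
    set n := s.pars j with hn
    refine Runs.seq (Runs.const (Q := fun s' => s' = s.setReg k 0) rfl) ?_
    rintro s2 rfl
    refine Runs.seq (Runs.move (Q := fun s' => s' = _) (by omega) rfl) ?_
    rintro s3 rfl
    refine Runs.mono (Runs.loop (n := n) (T := c.cost M + 3)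
      (fun i s' => s'.bank = iter i f s.bank ∧ Keeps k s s' ∧ s'.reg k = i) ?_ n 0 _ (by omega)
        ?_ ?_) ?_ ?_
    · rintro i t hi ⟨hb, hkp, hidx⟩ hr
      refine Runs.seq (ihc (k :: ρ) (k + 2) t ?_ (by omega) ?_) ?_
      · intro r hr
        simp only [List.mem_cons] at hr
        rcases hr with rfl | hr
        · omega
        · exact (hρ r hr).trans (by omega)
      · rwa [hkp.pars hk]
      rintro t1 ⟨hb1, hk1⟩
      refine Runs.seq (T := 1) (T' := 2) (Runs.const (Q := fun s' => s' = _) rfl) ?_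
      rintro t3 rfl
      refine Runs.seq (T := 1) (T' := 1) (Runs.add (Q := fun s' => s' = _) rfl) ?_
      rintro t4 rfl
      refine Runs.sub ⟨⟨?_, fun x hx => ?_, ?_⟩, ?_⟩
      · simp [hb1, hb, iter, hf, hkp.pars hk, hidx, hkp.map hρ]
      · simp [hx.ne, (show x ≠ k + 1 by omega), (show x ≠ k + 2 by omega), hk1 x (by omega),
          hkp x hx]
      · simp [hk1 k (by omega), hidx]
      · simp [hk1 (k + 1) (by omega), hr]
        omega
    · refine ⟨rfl, fun x hx => ?_, by simp⟩
      simp [hx.ne, (show x ≠ k + 1 by omega), (show x ≠ k + 2 by omega)]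
    · simp [hn, Mem.pars, (show (j : ℕ) ≠ k by omega)]
    · have : n * (c.cost M + 3 + 1) ≤ M * (c.cost M + 4) := Nat.mul_le_mul (hM j) le_rfl
      omega
    · rintro s' ⟨h1, h2, -⟩
      exact ⟨h1, h2⟩

/-- Reduces the polynomial bound for commands to the one for expressions: a loop costs no more than
a fold over an expression dominating its body. -/
theorem exists_cost_le (c : Cmd) : ∃ e : Ex, ∀ M, c.cost M ≤ e.cost M := by
  induction c with
  | skip => exact ⟨.num 0, fun M => le_rfl⟩
  | store b i v => exact ⟨.add i v, fun M => by simp only [cost, Ex.cost]; omega⟩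
  | seq c d ihc ihd =>
    obtain ⟨e, he⟩ := ihc
    obtain ⟨e', he'⟩ := ihd
    exact ⟨.add e e', fun M => by have := he M; have := he' M; simp only [cost, Ex.cost]; omega⟩
  | ite a c d ihc ihd =>
    obtain ⟨e, he⟩ := ihc
    obtain ⟨e', he'⟩ := ihd
    exact ⟨.ite a e e', fun M => by
      have := he M; have := he' M; simp only [cost, Ex.cost]; omega⟩
  | rep j c ihc =>
    obtain ⟨e, he⟩ := ihc
    refine ⟨.fold j (.num 0) e, fun M => ?_⟩
    have : M * (c.cost M + 4) ≤ M * (e.cost M + 6) :=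
      Nat.mul_le_mul le_rfl (by have := he M; omega)
    simp only [cost, Ex.cost]; omega

end Cmd

/-- A program is a sequence of parameter assignments and commands. -/
inductive Stage : Type
  | par (j : Fin 16) (e : Ex)
  | cmd (c : Cmd)

/-! ### Sequences of parameter assignments and commands. -/

namespace Stage

/-- The parameters and the contents of the memory banks. -/
abbrev State : Type := (Fin 16 → ℕ) × (ℕ → ℕ → ℕ)

/-- Parameters change only between commands. Every loop bound inside a command is thus fixed before
the command starts, which is what makes its cost a function of a bound on the parameters alone. -/
def run : Stage → State → State
  | par j e, σ => (Function.update σ.1 j (e.eval σ.1 σ.2 []), σ.2)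
  | cmd c, σ => (σ.1, c.run σ.1 [] σ.2)

def comp : Stage → Prog
  | par j e => .seq (e.comp [] 16) (Ex.move j 16 17)
  | cmd c => c.comp [] 16

def cost (M : ℕ) : Stage → ℕ
  | par _ e => e.cost M + 2
  | cmd c => c.cost M

def runAll (S : List Stage) (σ : State) : State := S.foldl (fun σ c => c.run σ) σ

def compAll : List Stage → Prog
  | [] => .skip
  | c :: S => .seq c.comp (compAll S)

/-- All parameters are at most `M` at the beginning of each stage. -/
def Bounded (M : ℕ) : List Stage → State → Prop
  | [], _ => True
  | c :: S, σ => (∀ j, σ.1 j ≤ M) ∧ Bounded M S (c.run σ)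

theorem comp_spec (M : ℕ) (c : Stage) (s : Mem) (h : ∀ j, s.pars j ≤ M) :
    Runs c.comp s (c.cost M) fun s' => (s'.pars, s'.bank) = c.run (s.pars, s.bank) := by
  cases c with
  | par j e =>
    refine Runs.seq (e.comp_spec M [] 16 s (by simp) le_rfl h) ?_
    rintro s1 ⟨hb1, hk1, hv1⟩
    refine Runs.move (by omega) ?_
    refine Prod.ext (funext fun i => ?_) (by simp [run, hb1])
    by_cases hij : i = j
    · simp [run, Mem.pars, hij, hv1]
    · have hij' : (i : ℕ) ≠ j := fun h => hij (Fin.ext h)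
      have := hk1 i (by omega)
      simp [run, Mem.pars, hij, hij', (show (i : ℕ) ≠ 17 by omega), this]
  | cmd c =>
    refine (c.comp_spec M [] 16 s (by simp) le_rfl h).mono le_rfl ?_
    rintro s1 ⟨hb1, hk1⟩
    exact Prod.ext (hk1.pars le_rfl) (by simp [run, hb1])

theorem compAll_spec (M : ℕ) : ∀ (S : List Stage) (s : Mem), Bounded M S (s.pars, s.bank) →
    Runs (compAll S) s ((S.map (cost M)).sum + 1) fun s' =>
      (s'.pars, s'.bank) = runAll S (s.pars, s.bank)
  | [], s, _ => ⟨1, s, .skip s, by simp, rfl⟩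
  | c :: S, s, h => by
    have h' : ((c :: S).map (cost M)).sum + 1 = c.cost M + ((S.map (cost M)).sum + 1) := by
      simp [add_assoc]
    rw [h']
    refine Runs.seq (comp_spec M c s h.1) fun s1 h1 => ?_
    have h2 := h.2
    rw [← h1] at h2
    refine (compAll_spec M S s1 h2).mono le_rfl fun s2 h3 => ?_
    rw [h3, h1]
    rfl

theorem exists_cost_le (S : List Stage) :
    ∃ C d : ℕ, ∀ M, (S.map (cost M)).sum + 1 ≤ C * (M + 1) ^ d := by
  suffices h : ∃ e : Ex, ∀ M, (S.map (cost M)).sum + 1 ≤ e.cost M by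
    obtain ⟨e, he⟩ := h
    obtain ⟨C, d, h⟩ := e.exists_cost_le
    exact ⟨C, d, fun M => (he M).trans (h M)⟩
  induction S with
  | nil => exact ⟨.num 0, fun M => by simp [Ex.cost]⟩
  | cons c S ih =>
    obtain ⟨e, he⟩ := ih
    have : ∃ e' : Ex, ∀ M, c.cost M ≤ e'.cost M := by
      cases c with
      | par j e => exact ⟨.add e (.var 0), fun M => by simp only [cost, Ex.cost]; omega⟩
      | cmd c => exact c.exists_cost_le
    obtain ⟨e', he'⟩ := this
    refine ⟨.add e' e, fun M => ?_⟩
    have := he M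
    have := he' M
    simp only [List.map_cons, List.sum_cons, Ex.cost]
    omega

end Stage

end SecondOrder


namespace SecondOrder

/-! ## Residuals of ordered decision diagrams -/

section Residual

variable {α : Type u}

/-- `Res f D p s`: the string of layers `D` has a path labelled `s` from `p` into `f`. -/
def Res (f : Finset ℕ) : List (Layer α) → ℕ → List α → Prop
  | [], p, [] => p ∈ f
  | l :: D, p, a :: s => ∃ r, (p, a, r) ∈ l.trans ∧ Res f D r s
  | _, _, _ => False

/-- Equality of residual languages. -/
def ResEq (f : Finset ℕ) (D : List (Layer α)) (p : ℕ) (f' : Finset ℕ) (D' : List (Layer α))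
    (p' : ℕ) : Prop := ∀ s, Res f D p s ↔ Res f' D' p' s

theorem ResEq.refl (f : Finset ℕ) (D : List (Layer α)) (p : ℕ) : ResEq f D p f D p :=
  fun _ => Iff.rfl

theorem ResEq.symm {f f' : Finset ℕ} {D D' : List (Layer α)} {p p' : ℕ}
    (h : ResEq f D p f' D' p') : ResEq f' D' p' f D p := fun s => (h s).symm

theorem ResEq.trans {f f' f'' : Finset ℕ} {D D' D'' : List (Layer α)} {p p' p'' : ℕ}
    (h : ResEq f D p f' D' p') (h' : ResEq f' D' p' f'' D'' p'') : ResEq f D p f'' D'' p'' :=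
  fun s => (h s).trans (h' s)

theorem resEq_nil {f f' : Finset ℕ} {p p' : ℕ} :
    ResEq f ([] : List (Layer α)) p f' [] p' ↔ (p ∈ f ↔ p' ∈ f') := by
  refine ⟨fun h => h [], fun h s => ?_⟩
  cases s with
  | nil => exact h
  | cons a s => exact Iff.rfl

/-- `D` is a segment of a deterministic, complete decision diagram of width `w`, with left states
`X` and final states `f`, whose first layer has the initial flag `b`. -/
def Seg (w : ℕ) (f : Finset ℕ) : Bool → Finset ℕ → List (Layer α) → Prop
  | _, _, [] => True
  | b, X, l :: D => l.WidthLE w ∧ l.Deterministic ∧ l.Complete ∧ l.left = X ∧ l.initFlag = b ∧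
      (l.finalFlag = true ↔ D = []) ∧ (D = [] → l.final = f) ∧ Seg w f false l.right D

theorem Layer.Deterministic.eq {l : Layer α} (h : l.Deterministic) {p q q' : ℕ} {a : α}
    (hq : (p, a, q) ∈ l.trans) (hq' : (p, a, q') ∈ l.trans) : q = q' :=
  h.2 p (l.trans_mem _ hq).1 a q (l.trans_mem _ hq).2 q' (l.trans_mem _ hq').2 hq hq'

theorem Layer.Complete.exists {l : Layer α} (h : l.Complete) {p : ℕ} (hp : p ∈ l.left) (a : α) :
    ∃ q, (p, a, q) ∈ l.trans :=
  let ⟨q, _, hq⟩ := h.2 p hp a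
  ⟨q, hq⟩

theorem res_cons {l : Layer α} (h : l.Deterministic) {f : Finset ℕ} {D : List (Layer α)}
    {p q : ℕ} {a : α} {s : List α} (hq : (p, a, q) ∈ l.trans) :
    Res f (l :: D) p (a :: s) ↔ Res f D q s := by
  constructor
  · rintro ⟨r, hr, hs⟩
    rwa [h.eq hq hr]
  · exact fun hs => ⟨q, hq, hs⟩

theorem ResEq.step {l l' : Layer α} (h : l.Deterministic) (h' : l'.Deterministic)
    {f f' : Finset ℕ} {D D' : List (Layer α)} {p p' q q' : ℕ} {a : α}
    (hq : (p, a, q) ∈ l.trans) (hq' : (p', a, q') ∈ l'.trans)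
    (he : ResEq f (l :: D) p f' (l' :: D') p') : ResEq f D q f' D' q' := fun s => by
  rw [← res_cons h hq, ← res_cons h' hq']
  exact he _

/-- Converse of `ResEq.step`. Completeness supplies successors on each symbol, and the empty string
is rejected on both sides because a layer is still to be crossed. -/
theorem ResEq.of_step {l l' : Layer α} (h : l.Deterministic) (h' : l'.Deterministic)
    (hc : l.Complete) (hc' : l'.Complete)
    {f f' : Finset ℕ} {D D' : List (Layer α)} {p p' : ℕ} (hp : p ∈ l.left) (hp' : p' ∈ l'.left)
    (he : ∀ a q q', (p, a, q) ∈ l.trans → (p', a, q') ∈ l'.trans → ResEq f D q f' D' q') :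
    ResEq f (l :: D) p f' (l' :: D') p' := fun s => by
  cases s with
  | nil => exact Iff.rfl
  | cons a s =>
    obtain ⟨q, hq⟩ := hc.exists hp a
    obtain ⟨q', hq'⟩ := hc'.exists hp' a
    rw [res_cons h hq, res_cons h' hq']
    exact he a q q' hq hq' s

/-- Peels the first layer off the index-based flag condition. The parameter `b` records whether the
initial flag is expected on the first layer; it becomes `false` for the tail, which is what the
induction in `seg_iff` needs. -/
theorem flags_iff (D : List (Layer α)) (b : Bool) :
    (∀ (i : ℕ) (h : i < D.length), (D[i].initFlag = true ↔ i = 0 ∧ b = true) ∧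
      (D[i].finalFlag = true ↔ i + 1 = D.length)) ↔
    ∀ l D', D = l :: D' → l.initFlag = b ∧ (l.finalFlag = true ↔ D' = []) ∧
      ∀ (i : ℕ) (h : i < D'.length), (D'[i].initFlag = true ↔ i = 0 ∧ false = true) ∧
      (D'[i].finalFlag = true ↔ i + 1 = D'.length) := by
  cases D with
  | nil => simp
  | cons l D =>
    constructor
    · rintro h l D' ⟨⟩
      refine ⟨?_, ?_, fun i hi => ?_⟩
      · have := (h 0 (by simp)).1
        rw [Bool.eq_iff_iff]
        simpa using this
      · refine (h 0 (by simp)).2.trans ?_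
        rw [← List.length_eq_zero_iff, List.length_cons]
        omega
      · have := h (i + 1) (by simpa using hi)
        simpa using this
    · intro h i hi
      obtain ⟨h1, h2, h3⟩ := h l D rfl
      cases i with
      | zero =>
        refine ⟨by simp [h1], h2.trans ?_⟩
        rw [← List.length_eq_zero_iff, List.length_cons]
        omega
      | succ i => simpa using h3 i (by simpa using hi)

/-- Trades the index-based definition of a diagram for the recursive `Seg`, on which the later
inductions run. -/
theorem seg_iff (w : ℕ) : ∀ (D : List (Layer α)) (b : Bool),
    ((∃ X f, Seg w f b X D) ↔ (∀ l ∈ D, l.WidthLE w) ∧ D.IsChain (fun l m => m.left = l.right) ∧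
      (∀ (i : ℕ) (h : i < D.length), (D[i].initFlag = true ↔ i = 0 ∧ b = true) ∧
        (D[i].finalFlag = true ↔ i + 1 = D.length)) ∧ ∀ l ∈ D, l.Deterministic ∧ l.Complete)
  | [], b => by simp [Seg]
  | [l], b => by
    rw [flags_iff]
    simp [Seg]
    grind
  | l :: m :: D, b => by
    have ih := seg_iff w (m :: D) false
    rw [flags_iff, List.isChain_cons_cons, List.forall_mem_cons (a := l),
      List.forall_mem_cons (a := l)]
    constructor
    · rintro ⟨X, f, h1, h2, h3, h4, h5, h6, h7, h8⟩
      obtain ⟨i1, i2, i3, i4⟩ := ih.1 ⟨_, f, h8⟩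
      refine ⟨⟨h1, i1⟩, ⟨h8.2.2.2.1, i2⟩, ?_, ⟨h2, h3⟩, i4⟩
      rintro l' D' ⟨⟩
      exact ⟨h5, h6, i3⟩
    · rintro ⟨⟨h1, i1⟩, ⟨h2, i2⟩, h3, ⟨h4, h5⟩, i4⟩
      obtain ⟨h6, h7, i3⟩ := h3 _ _ rfl
      obtain ⟨X, f, hX⟩ := ih.2 ⟨i1, i2, i3, i4⟩
      have hX' := hX
      obtain rfl := hX.2.2.2.1
      rw [h2] at hX'
      exact ⟨_, f, h1, h4, h5, rfl, h6, h7, by simp, hX'⟩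

theorem isCDODD_iff {w : ℕ} {D : List (Layer α)} :
    IsCDODD w D ↔ D ≠ [] ∧ ∃ X f, Seg w f true X D := by
  rw [seg_iff, IsCDODD, IsODD]
  simp only [and_true]
  tauto

theorem res_iff (f : Finset ℕ) : ∀ (D : List (Layer α)) (p : ℕ) (s : List α),
    Res f D p s ↔ s.length = D.length ∧ ∃ q : ℕ → ℕ, q 0 = p ∧ q D.length ∈ f ∧
      ∀ (i : ℕ) (h : i < D.length) (h' : i < s.length), (q i, s[i], q (i + 1)) ∈ D[i].trans
  | [], p, [] => by
    simp only [Res, List.length_nil, true_and]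
    exact ⟨fun h => ⟨fun _ => p, rfl, h, fun i h => by omega⟩,
      fun ⟨q, h1, h2, _⟩ => h1 ▸ h2⟩
  | [], p, a :: s => by simp [Res]
  | l :: D, p, [] => by simp [Res]
  | l :: D, p, a :: s => by
    simp only [Res, res_iff f D]
    constructor
    · rintro ⟨r, hr, hs, q, rfl, hf, hq⟩
      refine ⟨by simp [hs], fun i => if i = 0 then p else q (i - 1), by simp, by simpa using hf,
        fun i h h' => ?_⟩
      cases i with
      | zero => simpa using hr
      | succ i => simpa using hq i (by simpa using h) (by simpa using h')
    · rintro ⟨hs, q, rfl, hf, hq⟩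
      refine ⟨q 1, hq 0 (by simp) (by simp), by simpa using hs,
        fun i => q (i + 1), rfl, by simpa using hf, fun i h h' => ?_⟩
      exact hq (i + 1) (by simpa using h) (by simpa using h')

theorem Seg.final_eq {w : ℕ} {f : Finset ℕ} : ∀ {D : List (Layer α)} {b : Bool} {X : Finset ℕ}
    (_ : Seg w f b X D) (hD : D ≠ []), (D.getLast hD).final = f
  | [l], _, _, h, _ => h.2.2.2.2.2.2.1 rfl
  | l :: m :: D, _, _, h, _ => by
    have := Seg.final_eq h.2.2.2.2.2.2.2 (by simp)
    simpa using this

/-- Determinism makes the initial states equal to the left states of the first layer and leaves just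
one of them, so the language of a diagram is a residual. -/
theorem Seg.accepts_iff {w : ℕ} {f X : Finset ℕ} {D : List (Layer α)} (h : Seg w f true X D)
    (hD : D ≠ []) : ∃ x, X = {x} ∧ ∀ s, ODDAccepts D s ↔ Res f D x s := by
  cases D with
  | nil => exact absurd rfl hD
  | cons l D =>
    have h1 := h.2.1.1 h.2.2.2.2.1
    have hl := h.2.2.2.1
    obtain ⟨x, hx⟩ := Finset.card_eq_one.1 h1.2
    refine ⟨x, by rw [← hx, hl], fun s => ?_⟩
    rw [res_iff, ODDAccepts]
    refine and_congr Iff.rfl ⟨?_, ?_⟩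
    · rintro ⟨_, q, hq0, hq1, hq⟩
      rw [h.final_eq] at hq1
      simp only [List.head_cons, h1.1, hx, Finset.mem_singleton] at hq0
      exact ⟨q, hq0, hq1, hq⟩
    · rintro ⟨q, hq0, hq1, hq⟩
      refine ⟨hD, q, ?_, by rwa [h.final_eq], hq⟩
      simpa [h1.1, hx] using hq0

/-- In every layer of `D`, the right states have different residuals. -/
def AllDist (f : Finset ℕ) : List (Layer α) → Prop
  | [] => True
  | l :: D => (∀ q ∈ l.right, ∀ q' ∈ l.right, ResEq f D q f D q' → q = q') ∧ AllDist f D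

/-- Each state of `X` has the residual of a state of `X'`. -/
def Covers (f : Finset ℕ) (X : Finset ℕ) (D : List (Layer α)) (f' X' : Finset ℕ)
    (D' : List (Layer α)) : Prop := ∀ p ∈ X, ∃ p' ∈ X', ResEq f D p f' D' p'

/-- A right state of `l` has an incoming transition; following its symbol from the partner of the
source leads to a partner of the target. -/
theorem Covers.step {l l' : Layer α} (h : l.Deterministic) (h' : l'.Deterministic)
    (hc' : l'.Complete) (hr : l.Reachable) {f f' : Finset ℕ} {D D' : List (Layer α)}
    (hcov : Covers f l.left (l :: D) f' l'.left (l' :: D')) :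
    Covers f l.right D f' l'.right D' := by
  intro q hq
  obtain ⟨a, p, hp, hpq⟩ := hr q hq
  obtain ⟨p', hp', he⟩ := hcov p hp
  obtain ⟨q', hq'⟩ := hc'.exists hp' a
  exact ⟨q', (l'.trans_mem _ hq').2, he.step h h' hpq hq'⟩

theorem Covers.card_le {f f' X X' : Finset ℕ} {D D' : List (Layer α)}
    (h : Covers f X D f' X' D')
    (hd : ∀ q ∈ X, ∀ q' ∈ X, ResEq f D q f D q' → q = q') : X.card ≤ X'.card := by
  choose g hg hg' using h
  refine Finset.card_le_card_of_injOn (fun p => if hp : p ∈ X then g p hp else 0) ?_ ?_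
  · intro p hp
    have hp : p ∈ X := hp
    simp [hp, hg p hp]
  · intro p hp q hq hpq
    have hp : p ∈ X := hp
    have hq : q ∈ X := hq
    simp only [hp, hq, dite_true] at hpq
    refine hd p hp q hq ((hg' p hp).trans ?_)
    rw [hpq]
    exact (hg' q hq).symm

/-- The Myhill–Nerode lower bound, layer by layer. Covering passes from the left to the right
states, and pairwise distinguishable states have different partners. -/
theorem sum_card_le {w w' : ℕ} {f f' : Finset ℕ} : ∀ {E D : List (Layer α)} {b b' : Bool}
    {X X' : Finset ℕ}, E.length = D.length → Seg w f b X E → Seg w' f' b' X' D →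
    (∀ l ∈ E, l.Reachable) → AllDist f E → Covers f X E f' X' D →
    (E.map fun m => m.right.card).sum ≤ (D.map fun m => m.right.card).sum
  | [], [], _, _, _, _, _, _, _, _, _, _ => le_rfl
  | l :: E, m :: D, _, _, _, _, hlen, hE, hD, hr, hdist, hcov => by
    obtain ⟨-, e1, -, rfl, -, -, -, e2⟩ := hE
    obtain ⟨-, d1, d3, rfl, -, -, -, d2⟩ := hD
    have hstep := hcov.step e1 d1 d3 (hr l (by simp))
    have h1 := hstep.card_le hdist.1
    have h2 := sum_card_le (by simpa using hlen) e2 d2 (fun l hl => hr l (by simp [hl])) hdist.2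
      hstep
    simp only [List.map_cons, List.sum_cons]
    omega

/-- The equality case of `sum_card_le`. If the totals agree, every layer is tight, and then two
states of `D` with a common residual would leave too few states to cover those of `E`. -/
theorem allDist_of_sum_card_le {w w' : ℕ} {f f' : Finset ℕ} : ∀ {E D : List (Layer α)}
    {b b' : Bool} {X X' : Finset ℕ}, E.length = D.length → Seg w f b X E → Seg w' f' b' X' D →
    (∀ l ∈ E, l.Reachable) → (∀ l ∈ D, l.Reachable) → AllDist f E → Covers f X E f' X' D →
    Covers f' X' D f X E →
    (D.map fun m => m.right.card).sum ≤ (E.map fun m => m.right.card).sum → AllDist f' D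
  | [], [], _, _, _, _, _, _, _, _, _, _, _, _, _ => trivial
  | l :: E, m :: D, _, _, _, _, hlen, hE, hD, hr, hr', hdist, hcov, hcov', hle => by
    obtain ⟨-, e1, e3, rfl, -, -, -, e2⟩ := hE
    obtain ⟨-, d1, d3, rfl, -, -, -, d2⟩ := hD
    have hstep := hcov.step e1 d1 d3 (hr l (by simp))
    have hstep' := hcov'.step d1 e1 e3 (hr' m (by simp))
    have h1 := hstep.card_le hdist.1
    have hr2 : ∀ l ∈ E, l.Reachable := fun l hl => hr l (by simp [hl])
    have h2 := sum_card_le (by simpa using hlen) e2 d2 hr2 hdist.2 hstep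
    simp only [List.map_cons, List.sum_cons] at hle
    refine ⟨?_, allDist_of_sum_card_le (by simpa using hlen) e2 d2 hr2
      (fun l hl => hr' l (by simp [hl])) hdist.2 hstep hstep' (by omega)⟩
    choose g hg hg' using hstep'
    -- The map `g` to partners in `E` is onto because `E` is covered and its states are
    -- distinguishable; as `m.right` is not larger than `l.right`, it is injective.
    have hinj := Finset.inj_on_of_surj_on_of_card_le (s := m.right) (t := l.right) g hg
      (fun q hq => by
        obtain ⟨p, hp, he⟩ := hstep q hq
        exact ⟨p, hp, (hdist.1 q hq _ (hg p hp) (he.trans (hg' p hp))).symm⟩) (by omega)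
    intro q hq q' hq' he
    refine hinj hq hq' (hdist.1 _ (hg q hq) _ (hg q' hq') ?_)
    exact (hg' q hq).symm.trans (he.trans (hg' q' hq'))

end Residual

/-! ## Homomorphisms onto canonical diagrams -/

section Hom

variable {α : Type u} [LinearOrder α]

/-- The local properties of the layers of canonical diagrams. -/
structure Layer.Good (l : Layer α) : Prop where
  det : l.Deterministic
  complete : l.Complete
  normalized : l.Normalized
  rows : ∀ p ∈ l.left, ∀ p' ∈ l.left,
    (∀ a q, (p, a, q) ∈ l.trans → (p', a, q) ∈ l.trans) → p = p'
  fin : l.finalFlag = true → ∀ q ∈ l.right, ∀ q' ∈ l.right,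
    (q ∈ l.final ↔ q' ∈ l.final) → q = q'

/-- `h` and `h'` are a homomorphism from (a part of) the layer `B` onto the layer `E`, where `h p`
is undefined if it is at least `w`. -/
structure Compat (w : ℕ) (B E : Layer α) (h h' : ℕ → ℕ) : Prop where
  initFlag : B.initFlag = E.initFlag
  finalFlag : B.finalFlag = E.finalFlag
  good : E.Good
  left : ∀ x, x ∈ E.left ↔ x < w ∧ ∃ p < w, h p = x
  right : ∀ x, x ∈ E.right ↔ x < w ∧ ∃ p < w, h' p = x
  trans : ∀ p < w, ∀ a, ∀ q < w, (p, a, q) ∈ B.trans → h p < w →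
    h' q < w ∧ (h p, a, h' q) ∈ E.trans
  init : B.initFlag = true → ∀ p < w, p ∈ B.init → h p < w
  final : B.finalFlag = true → ∀ q < w, h' q < w → (q ∈ B.final ↔ h' q ∈ E.final)

/-- Only the map at the left end is an argument; the others are guessed one at a time. This is the
form of a run of an automaton that reads both diagrams in parallel and keeps the current map in its
state. -/
def HomRun (w : ℕ) : List (Layer α) → List (Layer α) → (ℕ → ℕ) → Prop
  | [], [], _ => True
  | B :: D, E :: Es, h => ∃ h', Compat w B E h h' ∧ HomRun w D Es h'
  | _, _, _ => False

/-- Backward induction. After the last layer, residuals differ because finality does. Before that,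
states with equal residuals have successors with equal residuals, hence equal successors, hence
equal rows, and `rows` identifies them. -/
theorem allDist_of_good {w : ℕ} {f : Finset ℕ} : ∀ {E : List (Layer α)} {b : Bool}
    {X : Finset ℕ}, E ≠ [] → Seg w f b X E → (∀ l ∈ E, l.Good) →
    (∀ q ∈ X, ∀ q' ∈ X, ResEq f E q f E q' → q = q') ∧ AllDist f E
  | l :: E, _, _, _, hE, hg => by
    obtain ⟨-, e1, e3, rfl, -, e4, e5, e2⟩ := hE
    have hl := hg l (by simp)
    have hr : (∀ q ∈ l.right, ∀ q' ∈ l.right, ResEq f E q f E q' → q = q') ∧ AllDist f E := by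
      rcases eq_or_ne E [] with rfl | hne
      · refine ⟨fun q hq q' hq' he => hl.fin (e4.2 rfl) q hq q' hq' ?_, trivial⟩
        rw [e5 rfl]
        exact resEq_nil.1 he
      · exact allDist_of_good hne e2 fun l hl => hg l (by simp [hl])
    refine ⟨fun p hp p' hp' he => hl.rows p hp p' hp' fun a q hq => ?_, hr⟩
    obtain ⟨q', hq'⟩ := e3.exists hp' a
    rwa [hr.1 q (l.trans_mem _ hq).2 q' (l.trans_mem _ hq').2 (he.step e1 e1 hq hq')]

/-- Converse of `allDist_of_good`: equal rows, or equal finality in the last layer, would produce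
equal residuals. -/
theorem good_of_allDist {w : ℕ} {f : Finset ℕ} : ∀ {E : List (Layer α)} {b : Bool}
    {X : Finset ℕ}, Seg w f b X E → (∀ l ∈ E, l.Normalized) →
    (∀ q ∈ X, ∀ q' ∈ X, ResEq f E q f E q' → q = q') → AllDist f E → ∀ l ∈ E, l.Good
  | [], _, _, _, _, _, _ => by simp
  | l :: E, _, _, hE, hn, hX, hd => by
    obtain ⟨-, e1, e3, rfl, -, e4, e5, e2⟩ := hE
    rw [List.forall_mem_cons] at hn ⊢
    refine ⟨⟨e1, e3, hn.1, fun p hp p' hp' hr => hX p hp p' hp' ?_, fun hf q hq q' hq' he => ?_⟩,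
      good_of_allDist e2 hn.2 hd.1 hd.2⟩
    · refine ResEq.of_step e1 e1 e3 e3 hp hp' fun a q q' hq hq' => ?_
      rw [e1.eq hq' (hr a q hq)]
      exact ResEq.refl f E q
    · obtain rfl := e4.1 hf
      refine hd.1 q hq q' hq' (resEq_nil.2 ?_)
      rwa [← e5 rfl]

theorem HomRun.length_eq {w : ℕ} : ∀ {D E : List (Layer α)} {h : ℕ → ℕ}, HomRun w D E h →
    E.length = D.length
  | [], [], _, _ => rfl
  | _ :: _, _ :: _, _, ⟨_, _, hr⟩ => by simpa using hr.length_eq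

theorem HomRun.good {w : ℕ} : ∀ {D E : List (Layer α)} {h : ℕ → ℕ}, HomRun w D E h →
    ∀ l ∈ E, l.Good
  | [], [], _, _ => by simp
  | _ :: _, _ :: _, _, ⟨_, hc, hr⟩ => by
    rw [List.forall_mem_cons]
    exact ⟨hc.good, hr.good⟩

theorem HomRun.seg {w : ℕ} {f : Finset ℕ} : ∀ {D E : List (Layer α)} {h : ℕ → ℕ} {b : Bool}
    {X Y : Finset ℕ}, HomRun w D E h → Seg w f b X D → (∀ x, x ∈ Y ↔ x < w ∧ ∃ p < w, h p = x) →
    ∃ f', Seg w f' b Y E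
  | [], [], _, _, _, _, _, _, _ => ⟨∅, trivial⟩
  | B :: D, E :: Es, _, _, _, _, ⟨h', hc, hr⟩, hD, hY => by
    obtain ⟨d0, d1, d2, rfl, d3, d4, d5, d6⟩ := hD
    obtain ⟨f', hf'⟩ := hr.seg d6 hc.right
    have hlen := hr.length_eq
    have key : ∀ f', (Es = [] → E.final = f') → Seg w f' false E.right Es →
        Seg w f' _ _ (E :: Es) := fun f' h1 h2 =>
      ⟨⟨fun x hx => Finset.mem_range.2 ((hc.left x).1 hx).1,
        fun x hx => Finset.mem_range.2 ((hc.right x).1 hx).1⟩, hc.good.det, hc.good.complete,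
        Finset.ext fun x => (hc.left x).trans (hY x).symm, hc.initFlag.symm.trans d3, by
          rw [← hc.finalFlag, d4, ← List.length_eq_zero_iff, ← List.length_eq_zero_iff, hlen],
        h1, h2⟩
    -- The set of final states comes from the last layer: it is that of `E` if the tail is empty,
    -- and the one supplied by the induction otherwise.
    rcases Es with _ | ⟨E', Es⟩
    · exact ⟨E.final, key _ (fun _ => rfl) trivial⟩
    · exact ⟨f', key _ (by simp) hf'⟩

/-- Both sides are deterministic and complete, so the path of `D` from `p` and the path of `E` from
`h p` with the same label are unique and correspond under the maps; the clause `final` compares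
their ends. -/
theorem HomRun.resEq {w : ℕ} {f f' : Finset ℕ} : ∀ {D E : List (Layer α)} {h : ℕ → ℕ} {b : Bool}
    {X Y : Finset ℕ}, HomRun w D E h → Seg w f b X D → Seg w f' b Y E →
    (D = [] → ∀ q < w, h q < w → (q ∈ f ↔ h q ∈ f')) →
    ∀ p ∈ X, p < w → h p < w → ResEq f D p f' E (h p)
  | [], [], _, _, _, _, _, _, _, hf, p, _, hpw, hp => resEq_nil.2 (hf rfl p hpw hp)
  | B :: D, E :: Es, _, _, _, _, ⟨h', hc, hr⟩, hD, hE, hf, p, hpX, hpw, hp => by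
    have hlen := hr.length_eq
    obtain ⟨d0, d1, d2, rfl, d3, d4, d5, d6⟩ := hD
    obtain ⟨e0, e1, e2, rfl, e3, e4, e5, e6⟩ := hE
    refine ResEq.of_step d1 e1 d2 e2 hpX ((hc.left _).2 ⟨hp, p, hpw, rfl⟩) fun a q q' hq hq' => ?_
    have hqw := Finset.mem_range.1 (d0.2 (B.trans_mem _ hq).2)
    have ht := hc.trans p hpw a q hqw hq hp
    rw [e1.eq hq' ht.2]
    refine hr.resEq d6 e6 ?_ q (B.trans_mem _ hq).2 hqw ht.1
    rintro rfl
    rw [← d5 rfl, ← e5 (List.length_eq_zero_iff.1 hlen)]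
    exact hc.final (d4.2 rfl)

/-- A canonical numbering of the classes of an equivalence relation on a finite set. -/
theorem exists_numbering {P : Type*} [LinearOrder P] [Nonempty P] (S : Finset P) (r : P → P → Prop)
    (hr : Equivalence r) : ∃ (b : ℕ) (k : P → ℕ) (ν : ℕ → P),
      (∀ x ∈ S, k x < b) ∧ (∀ x ∈ S, ∀ y ∈ S, k x = k y ↔ r x y) ∧
      (∀ i < b, IsLeast {x | x ∈ S ∧ k x = i} (ν i)) ∧
      ∀ i < b, ∀ j < b, (i < j ↔ ν i < ν j) := by
  classical
  rcases S.eq_empty_or_nonempty with rfl | ⟨x0, hx0⟩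
  · exact ⟨0, fun _ => 0, fun _ => Classical.arbitrary P, by simp, by simp, by simp, by simp⟩
  -- `R` consists of the least element of each class. A class is numbered by the position of its
  -- least element in the increasing enumeration of `R`, so both minimality and monotonicity of `ν`
  -- come from that enumeration.
  set R := S.filter fun x => ∀ y ∈ S, r x y → x ≤ y with hR
  have hrep : ∀ x ∈ S, ∃ z ∈ R, r x z := by
    intro x hx
    obtain ⟨z, hz⟩ := (S.filter fun y => r x y).exists_minimal ⟨x, by simp [hx, hr.refl]⟩
    have hz1 := hz.1
    simp only [Finset.mem_filter] at hz1
    refine ⟨z, ?_, hz1.2⟩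
    simp only [hR, Finset.mem_filter]
    refine ⟨hz1.1, fun y hy hzy => ?_⟩
    by_contra hlt
    exact hlt (hz.2 (by simp [hy, hr.trans hz1.2 hzy]) (not_le.1 hlt).le)
  choose! rep hrepR hrep using hrep
  have huniq : ∀ x ∈ R, ∀ y ∈ R, r x y → x = y := by
    intro x hx y hy hxy
    simp only [hR, Finset.mem_filter] at hx hy
    exact le_antisymm (hx.2 y hy.1 hxy) (hy.2 x hx.1 (hr.symm hxy))
  let e := R.orderIsoOfFin rfl
  let k : P → ℕ := fun x => if h : rep x ∈ R then (e.symm ⟨rep x, h⟩ : ℕ) else 0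
  let ν : ℕ → P := fun i => if h : i < R.card then (e ⟨i, h⟩ : P) else x0
  have hk : ∀ x ∈ S, k x < R.card := fun x hx => by simp [k, hrepR x hx]
  have hkk : ∀ x ∈ S, ∀ y ∈ S, k x = k y ↔ r x y := by
    intro x hx y hy
    simp only [k, hrepR x hx, hrepR y hy, dite_true, Fin.val_inj, e.symm.injective.eq_iff,
      Subtype.mk.injEq]
    refine ⟨fun h => hr.trans (hrep x hx) (h ▸ hr.symm (hrep y hy)), fun h => ?_⟩
    exact huniq _ (hrepR x hx) _ (hrepR y hy)
      (hr.trans (hr.symm (hrep x hx)) (hr.trans h (hrep y hy)))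
  have hνR : ∀ i < R.card, ν i ∈ R := fun i hi => by simp [ν, hi]
  have hRS : R ⊆ S := Finset.filter_subset _ _
  have hkν : ∀ i < R.card, k (ν i) = i := by
    intro i hi
    have h1 := hνR i hi
    have h2 : rep (ν i) = ν i := (huniq _ h1 _ (hrepR _ (hRS h1)) (hrep _ (hRS h1))).symm
    have h3 : e ⟨i, hi⟩ = ⟨ν i, h1⟩ := Subtype.ext (by simp [ν, hi])
    simp [k, h2, h1, ← h3]
  refine ⟨R.card, k, ν, hk, hkk, fun i hi => ⟨⟨hRS (hνR i hi), hkν i hi⟩, ?_⟩, ?_⟩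
  · rintro x ⟨hx, rfl⟩
    have h1 := hνR _ hi
    have h2 : r (ν (k x)) x := (hkk _ (hRS h1) x hx).1 (hkν _ hi)
    exact (Finset.mem_filter.1 h1).2 x hx h2
  · intro i hi j hj
    simp only [ν, hi, hj, dite_true]
    rw [Subtype.coe_lt_coe, e.lt_iff_lt, Fin.mk_lt_mk]

end Hom

end SecondOrder


namespace SecondOrder

/-! ### Diagrams with equal languages. -/

section Covers

variable {α : Type u}

theorem Seg.covers {w w' : ℕ} {f f' X X' : Finset ℕ} {D D' : List (Layer α)}
    (hD : Seg w f true X D) (hD' : Seg w' f' true X' D') (hne : D ≠ []) (hne' : D' ≠ [])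
    (he : oddLang D = oddLang D') : Covers f X D f' X' D' := by
  obtain ⟨x, rfl, h1⟩ := hD.accepts_iff hne
  obtain ⟨y, rfl, h2⟩ := hD'.accepts_iff hne'
  intro p hp
  simp only [Finset.mem_singleton] at hp
  subst hp
  refine ⟨y, by simp, fun s => ?_⟩
  have h3 := congrArg Prod.snd he
  simp only [oddLang, Set.ext_iff, Set.mem_ofPred_eq] at h3
  rw [← h1, ← h2, h3]

theorem Seg.oddNumStates_eq {w : ℕ} {f X : Finset ℕ} {D : List (Layer α)}
    (hD : Seg w f true X D) (hne : D ≠ []) :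
    oddNumStates D = 1 + (D.map fun m => m.right.card).sum := by
  obtain ⟨x, rfl, -⟩ := hD.accepts_iff hne
  cases D with
  | nil => exact absurd rfl hne
  | cons l D =>
    have := hD.2.2.2.1
    simp [oddNumStates, this]

end Covers

/-! ### Existence and local characterization of canonical forms. -/

section Canonical

variable {α : Type u} [LinearOrder α] [Fintype α]

/-- The complete deterministic layer with `a` left and `b` right states and transition
function `k`. -/
def Layer.ofFun (a b : ℕ) (k : ℕ ×ₗ α → ℕ) (J : Finset ℕ) (ι φ : Bool)
    (hk : ∀ x < a, ∀ s, k (toLex (x, s)) < b) : Layer α where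
  left := Finset.range a
  right := Finset.range b
  trans := (Finset.range a ×ˢ Finset.univ).image fun y => (y.1, y.2, k (toLex y))
  init := if ι then Finset.range a else ∅
  final := if φ then (Finset.range b).filter (· ∈ J) else ∅
  initFlag := ι
  finalFlag := φ
  trans_mem := by
    intro t ht
    simp only [Finset.mem_image, Finset.mem_product, Finset.mem_range, Finset.mem_univ,
      and_true] at ht
    obtain ⟨y, hy, rfl⟩ := ht
    simp only [Finset.mem_range]
    exact ⟨hy, hk _ hy _⟩
  init_subset := by split <;> simp
  final_subset := by split <;> simp
  init_eq_empty := by rintro rfl; simp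
  final_eq_empty := by rintro rfl; simp

theorem Layer.mem_ofFun_trans {a b : ℕ} {k : ℕ ×ₗ α → ℕ} {J : Finset ℕ} {ι φ : Bool}
    {hk : ∀ x < a, ∀ s, k (toLex (x, s)) < b} {x y : ℕ} {s : α} :
    (x, s, y) ∈ (Layer.ofFun a b k J ι φ hk).trans ↔ x < a ∧ k (toLex (x, s)) = y := by
  simp only [Layer.ofFun, Finset.mem_image, Finset.mem_product, Finset.mem_range,
    Finset.mem_univ, and_true, Prod.exists, Prod.mk.injEq]
  constructor
  · rintro ⟨x, s, h, rfl, rfl, rfl⟩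
    exact ⟨h, rfl⟩
  · rintro ⟨h, rfl⟩
    exact ⟨x, s, h, rfl, rfl, rfl⟩

/-- Builds the quotient from left to right. The hypotheses say that `h` numbers, by `{0, …, a - 1}`,
the residual classes of the states in its domain. Each pair of a class and a symbol determines the
residual of a successor; the classes of these pairs, numbered by their least elements, become the
right states of the new layer, and the numbering `k` becomes its transition function. The induced
map `h'` satisfies the same hypotheses for the remaining layers. -/
theorem exists_homRun [Nonempty α] {w : ℕ} {f : Finset ℕ} : ∀ {D : List (Layer α)} {b : Bool}
    {X : Finset ℕ} {a : ℕ} {h : ℕ → ℕ}, Seg w f b X D → 0 < a →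
    (∀ p < w, h p < w → p ∈ X) → (∀ x, x < a ↔ x < w ∧ ∃ p < w, h p = x) →
    (∀ p < w, ∀ p' < w, h p < w → h p' < w → (h p = h p' ↔ ResEq f D p f D p')) →
    (b = true → a = 1 ∧ ∀ p ∈ X, h p < w) → ∃ E, HomRun w D E h
  | [], _, _, _, _, _, _, _, _, _, _ => ⟨[], trivial⟩
  | B :: D, b, X, a, h, hD, ha, hX, him, heq, hb => by
    classical
    obtain ⟨d0, d1, d2, rfl, rfl, d4, d5, d6⟩ := hD
    have hp : ∀ x < a, ∃ p < w, h p = x ∧ x < w := fun x hx => by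
      obtain ⟨h1, p, h2, h3⟩ := (him x).1 hx
      exact ⟨p, h2, h3, h1⟩
    -- `P x` is a state of `D` representing the class `x`; below, `g x s` is its successor on the
    -- symbol `s`.
    choose! P hPw hhP hPX using hp
    have hg : ∀ x < a, ∀ s, ∃ q, (P x, s, q) ∈ B.trans := fun x hx s =>
      d2.exists (hX _ (hPw x hx) (by rw [hhP x hx]; exact hPX x hx)) s
    choose! g hg using hg
    let G : ℕ ×ₗ α → ℕ := fun y => g (ofLex y).1 (ofLex y).2
    let S : Finset (ℕ ×ₗ α) := (Finset.range a ×ˢ (Finset.univ : Finset α)).map toLex.toEmbedding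
    have hS : ∀ y, y ∈ S ↔ (ofLex y).1 < a := by
      intro y
      simp only [S, Finset.mem_map_equiv, Finset.mem_product, Finset.mem_range, Finset.mem_univ,
        and_true]
      rfl
    have hG : ∀ y ∈ S, (P (ofLex y).1, (ofLex y).2, G y) ∈ B.trans := fun y hy =>
      hg _ ((hS y).1 hy) _
    have hPh : ∀ y ∈ S, h (P (ofLex y).1) < w := fun y hy => by
      rw [hhP _ ((hS y).1 hy)]
      exact hPX _ ((hS y).1 hy)
    have : Nonempty (ℕ ×ₗ α) := ⟨toLex (0, Classical.arbitrary α)⟩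
    obtain ⟨b', k, ν, hkb, hk, hν, hνlt⟩ := exists_numbering S
      (fun y y' => ResEq f D (G y) f D (G y'))
      ⟨fun _ _ => Iff.rfl, fun h => h.symm, fun h h' => h.trans h'⟩
    have hright : ∀ p s q, (p, s, q) ∈ B.trans → q < w := fun p s q hq =>
      Finset.mem_range.1 (d0.2 (B.trans_mem _ hq).2)
    -- Different classes have representatives `ν i` whose successors are different states of `B`,
    -- and all of these are below `w`.
    have hb'w : b' ≤ w := by
      have h1 : (Finset.range b').card ≤ (Finset.range w).card := by
        refine Finset.card_le_card_of_injOn (fun i => G (ν i)) ?_ ?_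
        · intro i hi
          have hi : i < b' := by simpa using hi
          simpa using hright _ _ _ (hG _ (hν i hi).1.1)
        · intro i hi j hj hij
          have hi : i < b' := by simpa using hi
          have hj : j < b' := by simpa using hj
          have h1 := (hν i hi).1
          have h2 := (hν j hj).1
          have h3 := (hk _ h1.1 _ h2.1).2 (by simp only at hij; rw [hij]; exact fun _ => Iff.rfl)
          rw [← h1.2, ← h2.2, h3]
      simpa using h1
    -- Only states entered from the domain of `h` receive a class; elsewhere `h'` takes the value
    -- `w`, meaning undefined. By `hstep` the class does not depend on the pair chosen as witness.
    let reach : ℕ → Prop := fun q => ∃ y ∈ S, ∃ p < w, h p = (ofLex y).1 ∧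
      (p, (ofLex y).2, q) ∈ B.trans
    let h' : ℕ → ℕ := fun q => if hq : reach q then k hq.choose else w
    have hstep : ∀ y ∈ S, ∀ p < w, h p = (ofLex y).1 → ∀ q, (p, (ofLex y).2, q) ∈ B.trans →
        ResEq f D (G y) f D q := by
      intro y hy p hpw hpy q hq
      refine ResEq.step d1 d1 (hG y hy) hq ((heq _ (hPw _ ((hS y).1 hy)) p hpw (hPh y hy) ?_).1 ?_)
      · rw [hpy]; exact hPX _ ((hS y).1 hy)
      · rw [hpy, hhP _ ((hS y).1 hy)]
    have hh' : ∀ y ∈ S, ∀ p < w, h p = (ofLex y).1 → ∀ q, (p, (ofLex y).2, q) ∈ B.trans →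
        h' q = k y := by
      intro y hy p hpw hpy q hq
      have hr : reach q := ⟨y, hy, p, hpw, hpy, hq⟩
      simp only [h', hr, dite_true]
      obtain ⟨hyS, p', hp'w, hp'y, hq'⟩ := hr.choose_spec
      exact (hk _ hyS _ hy).2 ((hstep _ hyS p' hp'w hp'y q hq').trans
        (hstep y hy p hpw hpy q hq).symm)
    have hhr : ∀ q, h' q < w → reach q := by
      intro q hq
      by_contra hr
      simp [h', hr] at hq
    have hh'G : ∀ y ∈ S, h' (G y) = k y := fun y hy =>
      hh' y hy _ (hPw _ ((hS y).1 hy)) (hhP _ ((hS y).1 hy)) _ (hG y hy)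
    have hmemS : ∀ x < a, ∀ s : α, (toLex (x, s) : ℕ ×ₗ α) ∈ S := fun x hx s => (hS _).2 hx
    have him' : ∀ x, x < b' ↔ x < w ∧ ∃ q < w, h' q = x := by
      intro x
      constructor
      · intro hx
        have h1 := (hν x hx).1
        exact ⟨by omega, G (ν x), hright _ _ _ (hG _ h1.1), by rw [hh'G _ h1.1, h1.2]⟩
      · rintro ⟨hx, q, hq, rfl⟩
        obtain ⟨y, hy, p, hpw, hpy, ht⟩ := hhr q hx
        rw [hh' y hy p hpw hpy q ht]
        exact hkb y hy
    have heq' : ∀ q < w, ∀ q' < w, h' q < w → h' q' < w →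
        (h' q = h' q' ↔ ResEq f D q f D q') := by
      intro q _ q' _ hqw hq'w
      obtain ⟨y, hy, p, hpw, hpy, ht⟩ := hhr q hqw
      obtain ⟨y', hy', p', hp'w, hp'y', ht'⟩ := hhr q' hq'w
      rw [hh' y hy p hpw hpy q ht, hh' y' hy' p' hp'w hp'y' q' ht', hk y hy y' hy']
      have h1 := hstep y hy p hpw hpy q ht
      have h2 := hstep y' hy' p' hp'w hp'y' q' ht'
      exact ⟨fun h => h1.symm.trans (h.trans h2), fun h => h1.trans (h.trans h2.symm)⟩
    have hb'0 : 0 < b' := lt_of_le_of_lt (Nat.zero_le _) (hkb _ (hmemS 0 ha (Classical.arbitrary α)))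
    obtain ⟨E, hE⟩ := exists_homRun (h := h') d6 hb'0 (fun q hqw hq => by
      obtain ⟨y, hy, p, hpw, hpy, ht⟩ := hhr q hq
      exact (B.trans_mem _ ht).2) him' heq' (by simp)
    let L : Layer α := Layer.ofFun a b' k (B.final.image h') B.initFlag B.finalFlag
      fun x hx s => hkb _ (hmemS x hx s)
    have hLt : ∀ {x y : ℕ} {s : α}, (x, s, y) ∈ L.trans ↔ x < a ∧ k (toLex (x, s)) = y :=
      Layer.mem_ofFun_trans
    -- States with a common image have equal residuals, so in the last layer they agree on finality;
    -- taking the image of the final states therefore adds no wrong ones.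
    have hLf : B.finalFlag = true → ∀ q < w, h' q < w → (q ∈ B.final ↔ h' q ∈ L.final) := by
      intro hf q hq hqw
      have hD := d4.1 hf
      subst hD
      simp only [L, Layer.ofFun, hf, if_true, Finset.mem_filter, Finset.mem_range,
        Finset.mem_image]
      refine ⟨fun h => ⟨(him' _).2 ⟨hqw, q, hq, rfl⟩, q, h, rfl⟩, ?_⟩
      rintro ⟨-, q', hq', he⟩
      have hq'w := Finset.mem_range.1 (d0.2 (B.final_subset hq'))
      have := resEq_nil.1 ((heq' q' hq'w q hq (he ▸ hqw) hqw).1 he)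
      rw [← d5 rfl] at this
      exact this.1 hq'
    have hLc : L.Complete := by
      refine ⟨fun hi => ?_, fun p hp s => ?_⟩
      · have hi : B.initFlag = true := hi
        simp only [L, Layer.ofFun, hi, if_true]
        simpa using ha.ne'
      · have hp : p < a := Finset.mem_range.1 hp
        exact ⟨_, Finset.mem_range.2 (hkb _ (hmemS p hp s)), hLt.2 ⟨hp, rfl⟩⟩
    have hLd : L.Deterministic := by
      refine ⟨fun hi => ?_, fun p _ s q _ q' _ hq hq' => ?_⟩
      · have hi : B.initFlag = true := hi
        simp only [L, Layer.ofFun, hi, if_true, Finset.card_range, true_and]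
        exact (hb hi).1
      · rw [← (hLt.1 hq).2, ← (hLt.1 hq').2]
    have hνset : ∀ q < b', {x : ℕ ×ₗ α | ((ofLex x).1, (ofLex x).2, q) ∈ L.trans} =
        {x | x ∈ S ∧ k x = q} := fun q hq => by
      ext x
      rw [Set.mem_ofPred_eq, hLt, Set.mem_ofPred_eq, hS]
      rfl
    have hLn : L.Normalized := by
      refine ⟨⟨fun q hq => ?_, hLd, ν, fun q hq => ?_, fun q hq q' hq' => ?_⟩,
        a, b', ha, hb'0, rfl, rfl⟩
      · have hq : q < b' := Finset.mem_range.1 hq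
        have h1 := (hν q hq).1
        have h2 : (ofLex (ν q)).1 < a := (hS _).1 h1.1
        exact ⟨_, _, Finset.mem_range.2 h2, hLt.2 ⟨h2, h1.2⟩⟩
      · have hq : q < b' := Finset.mem_range.1 hq
        rw [hνset q hq]
        exact hν q hq
      · exact hνlt q (Finset.mem_range.1 hq) q' (Finset.mem_range.1 hq')
    refine ⟨L :: E, h', ⟨rfl, rfl, ⟨hLd, hLc, hLn, ?_, ?_⟩, fun x => ?_, fun x => ?_, ?_, ?_, hLf⟩,
      hE⟩
    · intro x hx x' hx' hrow
      have hx : x < a := Finset.mem_range.1 hx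
      have hx' : x' < a := Finset.mem_range.1 hx'
      have h1 := hPX x hx
      have h2 := hPX x' hx'
      rw [← hhP x hx, ← hhP x' hx']
      have h3 : h (P x) < w := by rwa [hhP x hx]
      have h4 : h (P x') < w := by rwa [hhP x' hx']
      refine (heq _ (hPw x hx) _ (hPw x' hx') h3 h4).2 ?_
      refine ResEq.of_step d1 d1 d2 d2 (hX _ (hPw x hx) h3) (hX _ (hPw x' hx') h4) ?_
      intro s q q' hq hq'
      rw [d1.eq hq (hg x hx s), d1.eq hq' (hg x' hx' s)]
      refine (hk _ (hmemS x hx s) _ (hmemS x' hx' s)).1 ?_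
      exact (hLt.1 (hrow s _ (hLt.2 ⟨hx, rfl⟩))).2.symm
    · intro hf q hq q' hq' he
      have hf : B.finalFlag = true := hf
      obtain ⟨hqw, r, hr, rfl⟩ := (him' q).1 (Finset.mem_range.1 hq)
      obtain ⟨hqw', r', hr', rfl⟩ := (him' q').1 (Finset.mem_range.1 hq')
      refine (heq' r hr r' hr' hqw hqw').2 ?_
      have hD := d4.1 hf
      subst hD
      rw [resEq_nil, ← d5 rfl, hLf hf r hr hqw, hLf hf r' hr' hqw']
      exact he
    · exact (Finset.mem_range).trans (him x)
    · exact (Finset.mem_range).trans (him' x)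
    · intro p hpw s q hqw hq hhp
      have hpa : h p < a := (him _).2 ⟨hhp, p, hpw, rfl⟩
      have h1 := hh' _ (hmemS _ hpa s) p hpw rfl q hq
      have h2 := hkb _ (hmemS _ hpa s)
      exact ⟨by omega, hLt.2 ⟨hpa, h1.symm⟩⟩
    · exact fun hi p _ hp => (hb hi).2 p (B.init_subset hp)

theorem Seg.exists_homRun [Nonempty α] {w : ℕ} {f X : Finset ℕ} {D : List (Layer α)}
    (hD : Seg w f true X D) (hne : D ≠ []) : ∃ E h, HomRun w D E h := by
  obtain ⟨x, rfl, -⟩ := hD.accepts_iff hne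
  have hx : x < w := by
    cases D with
    | nil => exact absurd rfl hne
    | cons l D =>
      refine Finset.mem_range.1 (hD.1.1 ?_)
      rw [hD.2.2.2.1]
      simp
  have hp : ∀ p, (if p = x then 0 else w) < w ↔ p = x := by
    intro p
    split_ifs with h
    · simp [h]; omega
    · simp [h]
  -- The initial map sends the only left state to `0` and is undefined elsewhere.
  suffices h : ∃ E, HomRun w D E fun p => if p = x then 0 else w from
    let ⟨E, hE⟩ := h
    ⟨E, _, hE⟩
  refine SecondOrder.exists_homRun (h := fun p => if p = x then 0 else w) hD one_pos
    (fun p _ h => by simpa [hp] using h) (fun y => ?_) (fun p _ p' _ h h' => ?_)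
    (fun _ => ⟨rfl, fun p h => by simpa [hp] using h⟩)
  · constructor
    · intro hy
      exact ⟨by omega, x, hx, by simp; omega⟩
    · rintro ⟨h1, p, h2, rfl⟩
      rw [hp] at h1
      simp [h1]
  · rw [hp] at h h'
    subst h h'
    exact ⟨fun _ _ => Iff.rfl, fun _ => rfl⟩

omit [Fintype α] in
-- The clause `init` of `Compat` forces the map to be defined at the initial state; without it, a
-- homomorphism could ignore the language of `D`.
theorem HomRun.head_spec {w : ℕ} {f X : Finset ℕ} {D E : List (Layer α)} {h : ℕ → ℕ}
    (hr : HomRun w D E h) (hD : Seg w f true X D) (hne : D ≠ []) :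
    ∃ f' Y, Seg w f' true Y E ∧ E ≠ [] ∧ ∃ x ∈ X, x < w ∧ h x < w ∧ h x ∈ Y := by
  cases D with
  | nil => exact absurd rfl hne
  | cons B D =>
    cases E with
    | nil => exact absurd hr id
    | cons E Es =>
      obtain ⟨x, hx, -⟩ := hD.accepts_iff hne
      have hc := hr.choose_spec.1
      obtain ⟨f', hf'⟩ := hr.seg hD hc.left
      have hd := hD.2.1.1 hD.2.2.2.2.1
      have hx' : x ∈ B.left := by rw [hD.2.2.2.1, hx]; simp
      have hxw : x < w := Finset.mem_range.1 (hD.1.1 hx')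
      have := hc.init hD.2.2.2.2.1 x hxw (by rwa [hd.1])
      exact ⟨f', _, hf', by simp, x, by simp [hx], hxw, this, (hc.left _).2 ⟨this, x, hxw, rfl⟩⟩

omit [Fintype α] in
theorem HomRun.oddLang_eq {w : ℕ} {f X : Finset ℕ} {D E : List (Layer α)} {h : ℕ → ℕ}
    (hr : HomRun w D E h) (hD : Seg w f true X D) (hne : D ≠ []) : oddLang E = oddLang D := by
  obtain ⟨f', Y, hE, hEne, x, hx, hxw, hhx, hxY⟩ := hr.head_spec hD hne
  obtain ⟨x', rfl, h1⟩ := hD.accepts_iff hne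
  obtain ⟨y, rfl, h2⟩ := hE.accepts_iff hEne
  simp only [Finset.mem_singleton] at hx hxY
  subst hx
  refine Prod.ext hr.length_eq (Set.ext fun s => ?_)
  simp only [oddLang, Set.mem_ofPred_eq, h1, h2, ← hxY]
  exact (hr.resEq hD hE (fun h => absurd h hne) x (by simp) hxw hhx s).symm

omit [Fintype α] in
theorem HomRun.minimized {w : ℕ} {f X : Finset ℕ} {D E : List (Layer α)} {h : ℕ → ℕ}
    (hr : HomRun w D E h) (hD : Seg w f true X D) (hne : D ≠ []) : ODDMinimized E := by
  obtain ⟨f', Y, hE, hEne, -⟩ := hr.head_spec hD hne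
  intro w' _ D' hD' hl
  obtain ⟨hne', X', f'', hD'⟩ := isCDODD_iff.1 hD'
  rw [hE.oddNumStates_eq hEne, hD'.oddNumStates_eq hne']
  have hlen : D'.length = E.length := congrArg Prod.fst hl
  have := sum_card_le hlen.symm hE hD' (fun l hl => (hr.good l hl).normalized.1.1)
    (allDist_of_good hEne hE hr.good).2 (hE.covers hD' hEne hne' hl.symm)
  omega

omit [Fintype α] in
/-- Every diagram has the states of its homomorphic canonical image as residuals. -/
theorem homRun_of_covers {w w' : ℕ} {f f' : Finset ℕ} : ∀ {D E : List (Layer α)} {b : Bool}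
    {X Y : Finset ℕ}, D.length = E.length → Seg w f b X D → Seg w' f' b Y E →
    (∀ l ∈ E, l.Good) → (∀ q ∈ Y, ∀ q' ∈ Y, ResEq f' E q f' E q' → q = q') → AllDist f' E →
    Covers f' Y E f X D → (b = true → Covers f X D f' Y E) → (D ≠ [] → ∀ y ∈ Y, y < w) →
    ∀ h : ℕ → ℕ,
    (∀ p < w, h p < w → p ∈ X ∧ h p ∈ Y ∧ ResEq f D p f' E (h p)) →
    (∀ p ∈ X, ∀ y ∈ Y, ResEq f D p f' E y → h p = y) → HomRun w D E h
  | [], [], _, _, _, _, _, _, _, _, _, _, _, _, _, _, _ => trivial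
  | B :: D, E :: Es, b, X, Y, hlen, hD, hE, hg, hY, hdist, hcov, hb, hYw, h, h1, h2 => by
    classical
    obtain ⟨d0, d1, d2, rfl, rfl, d4, d5, d6⟩ := hD
    obtain ⟨e0, e1, e2, rfl, e3, e4, e5, e6⟩ := hE
    have hlen : D.length = Es.length := by simpa using hlen
    have hDE : D = [] ↔ Es = [] := by
      rw [← List.length_eq_zero_iff, ← List.length_eq_zero_iff, hlen]
    rw [List.forall_mem_cons] at hg
    have hcov' := hcov.step e1 d1 d2 hg.1.normalized.1.1
    -- Normalization makes `E.right` an initial segment, and distinguishability bounds its length by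
    -- the number of right states of `B`, which is at most `w`. Thus `E` may be given with any width
    -- `w'`.
    have hrw : ∀ y ∈ E.right, y < w := by
      obtain ⟨-, a, c, -, -, -, hc⟩ := hg.1.normalized
      intro y hy
      have h3 := hcov'.card_le hdist.1
      have h4 := Finset.card_le_card d0.2
      rw [hc, Finset.card_range] at h3
      rw [Finset.card_range] at h4
      rw [hc, Finset.mem_range] at hy
      omega
    -- The next map sends a state to the state of `E` with the same residual, unique because
    -- residuals in `E` are distinct, and is undefined if there is none.
    let C : ℕ → ℕ → Prop := fun q y => q ∈ B.right ∧ y ∈ E.right ∧ ResEq f D q f' Es y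
    let h' : ℕ → ℕ := fun q => if hq : ∃ y, C q y then hq.choose else w
    have h'1 : ∀ q, h' q < w → C q (h' q) := by
      intro q hq
      by_cases hc : ∃ y, C q y
      · simp only [h', hc, dite_true]
        exact hc.choose_spec
      · simp [h', hc] at hq
    have h'2 : ∀ q ∈ B.right, ∀ y ∈ E.right, ResEq f D q f' Es y → h' q = y := by
      intro q hq y hy he
      have hc : ∃ y, C q y := ⟨y, hq, hy, he⟩
      simp only [h', hc, dite_true]
      obtain ⟨i1, i2, i3⟩ := hc.choose_spec
      exact hdist.1 _ i2 _ hy (i3.symm.trans he)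
    have hBw : ∀ p s q, (p, s, q) ∈ B.trans → p ∈ B.left ∧ q ∈ B.right := fun p s q hq =>
      B.trans_mem _ hq
    refine ⟨h', ⟨e3.symm, ?_, hg.1, fun x => ?_, fun x => ?_, ?_, ?_, ?_⟩,
      homRun_of_covers hlen d6 e6 hg.2 hdist.1 hdist.2 hcov' (by simp) (fun _ => hrw) h'
        (fun q _ hq => h'1 q hq) h'2⟩
    · rw [Bool.eq_iff_iff, d4, e4, hDE]
    · constructor
      · intro hx
        obtain ⟨p, hp, he⟩ := hcov x hx
        exact ⟨hYw (by simp) x hx, p, Finset.mem_range.1 (d0.1 hp), h2 p hp x hx he.symm⟩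
      · rintro ⟨hx, p, hp, rfl⟩
        exact (h1 p hp hx).2.1
    · constructor
      · intro hx
        obtain ⟨p, hp, he⟩ := hcov' x hx
        exact ⟨hrw x hx, p, Finset.mem_range.1 (d0.2 hp), h'2 p hp x hx he.symm⟩
      · rintro ⟨hx, p, hp, rfl⟩
        exact (h'1 p hx).2.1
    · intro p hp s q hq ht hhp
      obtain ⟨i1, i2, i3⟩ := h1 p hp hhp
      obtain ⟨y, hy⟩ := e2.exists i2 s
      have h3 := h'2 q (hBw _ _ _ ht).2 y (E.trans_mem _ hy).2 (i3.step d1 e1 ht hy)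
      rw [h3]
      exact ⟨hrw y (E.trans_mem _ hy).2, hy⟩
    · intro hi p hp hpi
      obtain ⟨y, hy, he⟩ := hb hi p (B.init_subset hpi)
      rw [h2 p (B.init_subset hpi) y hy he]
      exact hYw (by simp) y hy
    · intro hf q hq hqw
      have hD := d4.1 hf
      have hE := hDE.1 hD
      subst hD hE
      rw [d5 rfl, e5 rfl]
      exact resEq_nil.1 (h'1 q hqw).2.2

/-- The canonical form is the image under a homomorphism onto layers with the local properties. -/
theorem isCanonicalODD_iff [Nonempty α] {w : ℕ} (hw : 0 < w) {D E : List (Layer α)}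
    (hD : IsCDODD w D) : IsCanonicalODD D E ↔ ∃ h, HomRun w D E h := by
  obtain ⟨hne, X, f, hS⟩ := isCDODD_iff.1 hD
  constructor
  · rintro ⟨⟨w', hw', hE⟩, hmin, hn, hl⟩
    obtain ⟨hEne, Y, f', hE⟩ := isCDODD_iff.1 hE
    obtain ⟨E0, h0, hr⟩ := hS.exists_homRun hne
    obtain ⟨f0, Y0, hE0, hE0ne, -⟩ := hr.head_spec hS hne
    have hl0 := hr.oddLang_eq hS hne
    -- The minimal diagram `E` is compared with the quotient `E0` of `D`. Minimality puts it in the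
    -- equality case of the lower bound, so its states are pairwise distinguishable as well.
    have hle := hmin w hw E0 (isCDODD_iff.2 ⟨hE0ne, _, _, hE0⟩) (hl0.trans hl.symm)
    rw [hE0.oddNumStates_eq hE0ne, hE.oddNumStates_eq hEne] at hle
    have hlen : E0.length = E.length := congrArg Prod.fst (hl0.trans hl.symm)
    have hdist : AllDist f' E := allDist_of_sum_card_le hlen hE0 hE
      (fun l hl => (hr.good l hl).normalized.1.1) (fun l hl => (hn l hl).1.1)
      (allDist_of_good hE0ne hE0 hr.good).2 (hE0.covers hE hE0ne hEne (hl0.trans hl.symm))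
      (hE.covers hE0 hEne hE0ne (hl.trans hl0.symm)) (by omega)
    obtain ⟨x, rfl, -⟩ := hS.accepts_iff hne
    obtain ⟨y, rfl, -⟩ := hE.accepts_iff hEne
    have hY : ∀ q ∈ ({y} : Finset ℕ), ∀ q' ∈ ({y} : Finset ℕ), ResEq f' E q f' E q' → q = q' := by
      simp
    -- By normalization the one-element left set is some `Finset.range a`; so `a = 1` and `y = 0`.
    have hyw : y < w := by
      cases E with
      | nil => exact absurd rfl hEne
      | cons l E =>
        obtain ⟨-, a, b, -, -, ha, -⟩ := hn l (by simp)
        have h1 := hE.2.2.2.1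
        rw [ha] at h1
        have h2 := congrArg Finset.card h1
        rw [Finset.card_range, Finset.card_singleton] at h2
        have h3 : y ∈ Finset.range a := by rw [h1]; simp
        rw [Finset.mem_range] at h3
        omega
    have hc1 := hE.covers hS hEne hne hl
    have hc2 := hS.covers hE hne hEne hl.symm
    have hxy : ResEq f D x f' E y := by
      obtain ⟨y', hy', h⟩ := hc2 x (by simp)
      simp only [Finset.mem_singleton] at hy'
      rwa [hy'] at h
    refine ⟨fun p => if p = x then y else w, homRun_of_covers (congrArg Prod.fst hl).symm hS hE
      (good_of_allDist hE hn hY hdist) hY hdist hc1 (fun _ => hc2) (by simpa using fun _ => hyw)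
      _ ?_ ?_⟩
    · intro p _ hp
      by_cases hpx : p = x
      · subst hpx
        simpa using hxy
      · simp [hpx] at hp
    · intro p hp q hq _
      simp only [Finset.mem_singleton] at hp hq
      simp [hp, hq]
  · rintro ⟨h, hr⟩
    obtain ⟨f', Y, hE, hEne, -⟩ := hr.head_spec hS hne
    exact ⟨⟨w, hw, isCDODD_iff.2 ⟨hEne, _, _, hE⟩⟩, hr.minimized hS hne,
      fun l hl => (hr.good l hl).normalized, hr.oddLang_eq hS hne⟩

end Canonical

end SecondOrder


namespace SecondOrder

/-! ## Deterministic automata with shortlex-ordered states -/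

section Shortlex

variable {Γ : Type u} [LinearOrder Γ]

/-- The shortlex order on strings. -/
def SL (u v : List Γ) : Prop := List.Shortlex (· < ·) u v

theorem lex_trans {u v x : List Γ} (h : List.Lex (· < ·) u v) (h' : List.Lex (· < ·) v x) :
    List.Lex (· < ·) u x := by
  induction h generalizing x with
  | nil => cases h' <;> exact .nil
  | cons _ ih =>
    cases h' with
    | cons h' => exact .cons (ih h')
    | rel h' => exact .rel h'
  | rel h =>
    cases h' with
    | cons h' => exact .rel h
    | rel h' => exact .rel (h.trans h')

theorem SL.trans {u v x : List Γ} (h : SL u v) (h' : SL v x) : SL u x := by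
  rw [SL, List.shortlex_def] at *
  rcases h with h | ⟨h1, h2⟩ <;> rcases h' with h' | ⟨h1', h2'⟩
  · left; omega
  · left; omega
  · left; omega
  · exact .inr ⟨by omega, lex_trans h2 h2'⟩

theorem SL.asymm {u v : List Γ} (h : SL u v) (h' : SL v u) : False :=
  Std.Asymm.asymm (r := List.Shortlex (· < ·)) _ _ h h'

theorem lex_append {u v : List Γ} (h : List.Lex (· < ·) u v) (hl : u.length = v.length)
    (x y : List Γ) : List.Lex (· < ·) (u ++ x) (v ++ y) := by
  induction h with
  | nil => simp at hl
  | cons _ ih => exact .cons (ih (by simpa using hl))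
  | rel h => exact .rel h

theorem SL.append {u v : List Γ} (h : SL u v) (a b : Γ) : SL (u ++ [a]) (v ++ [b]) := by
  rw [SL, List.shortlex_def] at *
  rcases h with h | ⟨h1, h2⟩
  · left; simpa using h
  · exact .inr ⟨by simpa using h1, lex_append h2 h1 _ _⟩

theorem SL.append_letter (u : List Γ) {a b : Γ} (h : a < b) : SL (u ++ [a]) (u ++ [b]) :=
  List.Shortlex.append_left ((List.shortlex_singleton_iff a b).2 h) u

theorem SL.nil_append (u : List Γ) (a : Γ) : SL [] (u ++ [a]) :=
  List.Shortlex.of_length_lt (by simp)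

theorem SL.singleton_or {a : Γ} (h : ∀ b, a ≤ b) {u : List Γ} (hu : u ≠ []) :
    u = [a] ∨ SL [a] u := by
  match u with
  | [b] =>
    rcases (h b).eq_or_lt with rfl | h
    · exact .inl rfl
    · exact .inr ((List.shortlex_singleton_iff a b).2 h)
  | b :: c :: u => exact .inr (List.Shortlex.of_length_lt (by simp))

end Shortlex

/-! ### Minimality and uniqueness of normalized automata. -/

namespace FA

variable {Γ : Type u}

/-- Different states have different residual languages. -/
def Dist (F : FA Γ) : Prop :=
  ∀ q q', (∀ v, v ∈ F.nfa.acceptsFrom {q} ↔ v ∈ F.nfa.acceptsFrom {q'}) → q = q'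

theorem eval_eq_singleton {F : FA Γ} (hd : F.Deterministic) (hc : F.Complete) :
    ∀ u, ∃ q, F.nfa.eval u = {q} := by
  intro u
  induction u using List.reverseRecOn with
  | nil =>
    obtain ⟨q, hq, hq'⟩ := hd.1
    exact ⟨q, Set.eq_singleton_iff_unique_mem.2 ⟨hq, hq'⟩⟩
  | append_singleton u a ih =>
    obtain ⟨q, hq⟩ := ih
    obtain ⟨q', hq'⟩ := hc.2 q a
    refine ⟨q', ?_⟩
    rw [NFA.eval_append_singleton, hq, NFA.stepSet_singleton]
    exact (hd.2 q a).eq_singleton_of_mem hq'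

theorem mem_accepts_append {F : FA Γ} {u v : List Γ} {q : Fin F.n} (h : F.nfa.eval u = {q}) :
    v ∈ F.nfa.acceptsFrom {q} ↔ u ++ v ∈ F.nfa.accepts := by
  rw [← h]
  exact (F.nfa.append_mem_acceptsFrom).symm

theorem step_eq {F : FA Γ} {u : List Γ} {q : Fin F.n} (h : F.nfa.eval u = {q}) (a : Γ) :
    F.nfa.step q a = F.nfa.eval (u ++ [a]) := by
  rw [NFA.eval_append_singleton, h, NFA.stepSet_singleton]

/-- Automata with the properties that determine the canonical automaton of a language. -/
structure Nice [LT Γ] (F : FA Γ) : Prop where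
  det : F.Deterministic
  complete : F.Complete
  normalized : F.Normalized
  dist : F.Dist

theorem Nice.eval_lex [LT Γ] {A : FA Γ} (hA : A.Nice) (q : Fin A.n) :
    ∃ u, A.nfa.eval u = {q} := by
  obtain ⟨lex, h, -⟩ := hA.normalized
  obtain ⟨q', hq'⟩ := eval_eq_singleton hA.det hA.complete (lex q)
  have := (h q).1
  rw [hq', Set.mem_singleton_iff] at this
  exact ⟨lex q, this ▸ hq'⟩

/-- Myhill–Nerode: choose a string reaching each state of `A` and run it in `B`. Two strings ending
in the same state of `B` have the same continuations into the language, so they come from the same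
state of `A`. -/
theorem Nice.minimal [LT Γ] {A : FA Γ} (hA : A.Nice) : A.Minimal := by
  intro B hd hc hL
  choose u hu using hA.eval_lex
  choose g hg using eval_eq_singleton hd hc
  suffices h : Function.Injective fun q => g (u q) by
    simpa using Fintype.card_le_of_injective _ h
  intro q q' h
  have h : g (u q) = g (u q') := h
  refine hA.dist q q' fun v => ?_
  rw [mem_accepts_append (hu q), mem_accepts_append (hu q'), ← hL, ← mem_accepts_append (hg _),
    ← mem_accepts_append (hg _), h]

/-- Sending the state of `B` reached by `u` to the state of `A` reached by `u` is well defined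
because residuals in `A` differ, and onto because every state of `A` is reached. Minimality of `B`
makes it a bijection. It preserves first strings, by which both sides are numbered, so it is
increasing and hence the identity. -/
theorem Nice.unique [LinearOrder Γ] {A B : FA Γ} (hA : A.Nice) (hd : B.Deterministic)
    (hc : B.Complete) (hn : B.Normalized) (hm : B.Minimal)
    (hL : B.nfa.accepts = A.nfa.accepts) : B = A := by
  obtain ⟨lexA, hlA, hltA⟩ := hA.normalized
  obtain ⟨lexB, hlB, hltB⟩ := hn
  choose sA hsA using eval_eq_singleton hA.det hA.complete
  choose sB hsB using eval_eq_singleton hd hc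
  have hAl : ∀ q, sA (lexA q) = q := fun q => by
    have := (hlA q).1
    rw [hsA, Set.mem_singleton_iff] at this
    exact this.symm
  have hBl : ∀ q, sB (lexB q) = q := fun q => by
    have := (hlB q).1
    rw [hsB, Set.mem_singleton_iff] at this
    exact this.symm
  let f : Fin B.n → Fin A.n := fun q => sA (lexB q)
  have hf : ∀ u, f (sB u) = sA u := by
    intro u
    refine hA.dist _ _ fun v => ?_
    rw [mem_accepts_append (hsA _), mem_accepts_append (hsA _), ← hL,
      ← mem_accepts_append (hsB _), ← mem_accepts_append (hsB _), hBl]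
  have hsurj : Function.Surjective f := fun q => ⟨sB (lexA q), by rw [hf, hAl]⟩
  have hle : B.n ≤ A.n := hm A hA.det hA.complete hL.symm
  have hinj : Function.Injective f :=
    (Fintype.bijective_iff_surjective_and_card f).2 ⟨hsurj, by
      have := Fintype.card_le_of_surjective f hsurj
      simp only [Fintype.card_fin] at this ⊢
      omega⟩ |>.1
  have hlex : ∀ q, lexA (f q) = lexB q := by
    intro q
    have h1 := (hlA (f q)).2 (lexB q) (by rw [hsA]; rfl)
    have h2 := (hlB q).2 (lexA (f q)) (by
      rw [hsB, Set.mem_singleton_iff]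
      apply hinj
      rw [hf, hAl])
    rcases h1 with h1 | h1
    · exact h1.symm
    rcases h2 with h2 | h2
    · exact h2
    exact (SL.asymm h1 h2).elim
  have hmono : StrictMono f := fun q q' h => by
    rw [hltA, hlex, hlex, ← hltB]
    exact h
  have hn : B.n = A.n := by
    have := Fintype.card_of_bijective ⟨hinj, hsurj⟩
    simpa using this
  obtain ⟨n, MA⟩ := A
  obtain ⟨m, MB⟩ := B
  dsimp only at hn
  subst hn
  -- A strictly increasing map of `Fin m` is determined by its range, which here is everything.
  have hid : f = id := by
    have h1 : StrictMono (id : Fin m → Fin m) := strictMono_id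
    refine hmono.range_inj h1 |>.1 ?_
    rw [hsurj.range_eq]
    simp
  have hs : ∀ u, sB u = sA u := fun u => by rw [← hf u, hid]; rfl
  congr 1
  have hev : ∀ u, MB.eval u = MA.eval u := fun u => by
    have h1 := hsB u
    have h2 := hsA u
    dsimp only at h1 h2
    rw [h1, h2, hs]
  have hstart : MB.start = MA.start := hev []
  have hstep : MB.step = MA.step := by
    funext q a
    have h1 : MB.step q a = MB.eval (lexB q ++ [a]) :=
      step_eq (F := ⟨m, MB⟩) (by rw [hsB, hBl]) a
    have h2 : MA.step q a = MA.eval (lexB q ++ [a]) :=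
      step_eq (F := ⟨m, MA⟩) (by rw [hsA, ← hs, hBl]) a
    rw [h1, h2, hev]
  have hacc : MB.accept = MA.accept := by
    ext q
    have h1 := mem_accepts_append (F := ⟨m, MB⟩) (v := []) (hsB (lexB q))
    have h2 := mem_accepts_append (F := ⟨m, MA⟩) (v := []) (hsA (lexB q))
    rw [hBl, NFA.nil_mem_acceptsFrom] at h1
    rw [← hs, hBl, NFA.nil_mem_acceptsFrom, ← hL] at h2
    have := h1.trans h2.symm
    simpa using this
  cases MA
  cases MB
  simp only at hstart hstep hacc
  rw [hstart, hstep, hacc]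

end FA

/-! ## Breadth-first numbering of the states of a numerical automaton -/

section BFS

variable {Γ : Type u} [LinearOrder Γ]

/-- The state reached from `s` by a string, for a transition function on numbers. -/
def runFrom (δ : ℕ → Γ → ℕ) (s : ℕ) (u : List Γ) : ℕ := u.foldl δ s

/-- Nerode equivalence. -/
def Ner (δ : ℕ → Γ → ℕ) (acc : ℕ → Prop) (s t : ℕ) : Prop :=
  ∀ u, acc (runFrom δ s u) ↔ acc (runFrom δ t u)

omit [LinearOrder Γ] in
theorem Ner.symm {δ : ℕ → Γ → ℕ} {acc : ℕ → Prop} {s t : ℕ} (h : Ner δ acc s t) :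
    Ner δ acc t s := fun u => (h u).symm

omit [LinearOrder Γ] in
theorem Ner.trans {δ : ℕ → Γ → ℕ} {acc : ℕ → Prop} {s t r : ℕ} (h : Ner δ acc s t)
    (h' : Ner δ acc t r) : Ner δ acc s r := fun u => (h u).trans (h' u)

omit [LinearOrder Γ] in
theorem Ner.step {δ : ℕ → Γ → ℕ} {acc : ℕ → Prop} {s t : ℕ} (h : Ner δ acc s t) (a : Γ) :
    Ner δ acc (δ s a) (δ t a) := fun u => h (a :: u)

/-- The states `Q 0, …, Q (m - 1)` represent the classes of the reachable states, and are numbered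
in the order of the first strings `W i` reaching them. -/
structure IsNumbering (δ : ℕ → Γ → ℕ) (acc : ℕ → Prop) (s₀ : ℕ) (Q : ℕ → ℕ) (m : ℕ)
    (W : ℕ → List Γ) : Prop where
  pos : 0 < m
  zero : W 0 = []
  run : ∀ j < m, Q j = runFrom δ s₀ (W j)
  sorted : ∀ j' < m, ∀ j < j', SL (W j) (W j')
  dist : ∀ j' < m, ∀ j < j', ¬ Ner δ acc (Q j) (Q j')

/-- Each transition out of a processed state leads to a known class. -/
def IsClosed (δ : ℕ → Γ → ℕ) (acc : ℕ → Prop) (Q : ℕ → ℕ) (m : ℕ) (W : ℕ → List Γ)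
    (done : ℕ → Γ → Prop) : Prop :=
  ∀ i < m, ∀ a, done i a → ∃ k < m, Ner δ acc (Q k) (δ (Q i) a) ∧
    (W k = W i ++ [a] ∨ SL (W k) (W i ++ [a]))

/-- The automaton on a numbering. -/
def FA.ofNumbering (δ : ℕ → Γ → ℕ) (acc : ℕ → Prop) (Q : ℕ → ℕ) (m : ℕ) : FA Γ where
  n := m
  nfa :=
    { step := fun i a => {k | Ner δ acc (Q k) (δ (Q i) a)}
      start := {i | (i : ℕ) = 0}
      accept := {i | acc (Q i)} }

variable {δ : ℕ → Γ → ℕ} {acc : ℕ → Prop} {s₀ : ℕ} {Q : ℕ → ℕ} {m : ℕ} {W : ℕ → List Γ}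

theorem IsNumbering.inj (h : IsNumbering δ acc s₀ Q m W) {i j : ℕ} (hi : i < m) (hj : j < m)
    (he : Ner δ acc (Q i) (Q j)) : i = j := by
  rcases lt_trichotomy i j with hlt | rfl | hlt
  · exact (h.dist j hj i hlt he).elim
  · rfl
  · exact (h.dist i hi j hlt he.symm).elim

/-- Induction on `u`, carrying along that the representative string of the state reached is not
later than `u`. Appending a letter preserves shortlex order, and the last clause of `IsClosed`
handles the move from `W i ++ [a]` to the representative of its class. -/
theorem IsNumbering.mem_eval (h : IsNumbering δ acc s₀ Q m W)
    (hc : IsClosed δ acc Q m W fun _ _ => True) (u : List Γ) :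
    (∃ k : Fin (FA.ofNumbering δ acc Q m).n, Ner δ acc (Q k) (runFrom δ s₀ u) ∧ (u = W k ∨ SL (W k) u)) ∧
      ∀ k : Fin (FA.ofNumbering δ acc Q m).n, k ∈ (FA.ofNumbering δ acc Q m).nfa.eval u ↔
        Ner δ acc (Q k) (runFrom δ s₀ u) := by
  induction u using List.reverseRecOn with
  | nil =>
    have h0 : Q 0 = s₀ := by rw [h.run 0 h.pos, h.zero]; rfl
    refine ⟨⟨⟨0, h.pos⟩, by rw [h0]; exact fun _ => Iff.rfl, .inl h.zero.symm⟩, fun k => ?_⟩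
    change (k : ℕ) = 0 ↔ _
    constructor
    · intro hk
      rw [hk, h0]
      exact fun _ => Iff.rfl
    · intro hk
      exact h.inj k.2 h.pos (by rw [h0]; exact hk)
  | append_singleton u a ih =>
    obtain ⟨⟨i, hi, hle⟩, hev⟩ := ih
    have hrun : runFrom δ s₀ (u ++ [a]) = δ (runFrom δ s₀ u) a := by simp [runFrom]
    obtain ⟨k, hk, he, hw⟩ := hc i i.2 a trivial
    rw [hrun]
    have hk' := he.trans (hi.step a)
    refine ⟨⟨⟨k, hk⟩, hk', ?_⟩, fun k' => ?_⟩
    · have h2 : W i ++ [a] = u ++ [a] ∨ SL (W i ++ [a]) (u ++ [a]) := by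
        rcases hle with hle | hle
        · exact .inl (by rw [hle])
        · exact .inr (hle.append a a)
      rcases hw with hw | hw <;> rcases h2 with h2 | h2
      · exact .inl (h2.symm.trans hw.symm)
      · right; dsimp only; rwa [hw]
      · right; dsimp only; rwa [← h2]
      · exact .inr (hw.trans h2)
    · rw [NFA.eval_append_singleton, NFA.mem_stepSet]
      constructor
      · rintro ⟨j, hj, hk⟩
        have hk : Ner δ acc (Q k') (δ (Q j) a) := hk
        exact hk.trans (((hev j).1 hj).step a)
      · intro hk'
        exact ⟨i, (hev i).2 hi, hk'.trans (hi.step a).symm⟩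

/-- The strings `W k` serve as first strings, by the comparison in `IsNumbering.mem_eval`; the
residual of state `k` is that of `Q k`, so inequivalence of the `Q k` gives `FA.Dist`. -/
theorem IsNumbering.nice (h : IsNumbering δ acc s₀ Q m W)
    (hc : IsClosed δ acc Q m W fun _ _ => True) : (FA.ofNumbering δ acc Q m).Nice := by
  have hev := h.mem_eval hc
  have hW : ∀ k : Fin (FA.ofNumbering δ acc Q m).n, k ∈ (FA.ofNumbering δ acc Q m).nfa.eval (W k) := fun k => by
    rw [(hev _).2, ← h.run k k.2]
    exact fun _ => Iff.rfl
  have hinj : ∀ k k' : Fin (FA.ofNumbering δ acc Q m).n, Ner δ acc (Q k) (Q k') → k = k' := fun k k' he =>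
    Fin.ext (h.inj k.2 k'.2 he)
  have hlt : ∀ q q' : Fin (FA.ofNumbering δ acc Q m).n, q < q' → SL (W q) (W q') := fun q q' hq => h.sorted q' q'.2 q hq
  have hdet : (FA.ofNumbering δ acc Q m).Deterministic :=
    ⟨⟨(⟨0, h.pos⟩ : Fin (FA.ofNumbering δ acc Q m).n), rfl, fun k (hk : (k : ℕ) = 0) => Fin.ext hk⟩,
      fun q a k hk k' hk' => hinj k k' (Ner.trans hk (Ner.symm hk'))⟩
  have hcom : (FA.ofNumbering δ acc Q m).Complete := by
    refine ⟨⟨(⟨0, h.pos⟩ : Fin (FA.ofNumbering δ acc Q m).n), rfl⟩, fun q a => ?_⟩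
    obtain ⟨k, hk, he, -⟩ := hc q q.2 a trivial
    exact ⟨(⟨k, hk⟩ : Fin (FA.ofNumbering δ acc Q m).n), he⟩
  refine ⟨hdet, hcom, ⟨fun k => W k, fun q => ⟨hW q, fun s hs => ?_⟩, fun q q' => ?_⟩,
    fun q q' he => ?_⟩
  · obtain ⟨⟨k, hk, hle⟩, hmem⟩ := hev s
    rw [hmem] at hs
    rwa [← hinj k q (hk.trans hs.symm)]
  · refine ⟨hlt q q', fun hlt' => ?_⟩
    rcases lt_trichotomy q q' with h1 | rfl | h1
    · exact h1
    · exact (SL.asymm hlt' hlt').elim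
    · exact (SL.asymm hlt' (hlt _ _ h1)).elim
  · obtain ⟨p, hp⟩ := FA.eval_eq_singleton hdet hcom (W q)
    obtain ⟨p', hp'⟩ := FA.eval_eq_singleton hdet hcom (W q')
    have h1 := hW q
    have h2 := hW q'
    rw [hp, Set.mem_singleton_iff] at h1
    rw [hp', Set.mem_singleton_iff] at h2
    subst h1 h2
    refine hinj q q' fun v => ?_
    have key : ∀ k : Fin (FA.ofNumbering δ acc Q m).n, (FA.ofNumbering δ acc Q m).nfa.eval (W k) = {k} →
        (v ∈ (FA.ofNumbering δ acc Q m).nfa.acceptsFrom {k} ↔ acc (runFrom δ (Q k) v)) := by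
      intro k hk
      rw [FA.mem_accepts_append hk, NFA.mem_accepts]
      obtain ⟨⟨k', hk', -⟩, hm⟩ := hev (W k ++ v)
      have hrun : runFrom δ s₀ (W k ++ v) = runFrom δ (Q k) v := by
        rw [h.run k k.2]; simp [runFrom]
      rw [hrun] at hk' hm
      constructor
      · rintro ⟨r, hr, hr'⟩
        exact ((hm r).1 hr' []).1 hr
      · intro ha
        exact ⟨k', (hk' []).2 ha, (hm k').2 hk'⟩
    rw [← key q hp, ← key q' hp']
    exact he v

theorem IsNumbering.accepts (h : IsNumbering δ acc s₀ Q m W)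
    (hc : IsClosed δ acc Q m W fun _ _ => True) (u : List Γ) :
    u ∈ (FA.ofNumbering δ acc Q m).nfa.accepts ↔ acc (runFrom δ s₀ u) := by
  obtain ⟨⟨k, hk, -⟩, hm⟩ := h.mem_eval hc u
  rw [NFA.mem_accepts]
  constructor
  · rintro ⟨r, hr, hr'⟩
    exact ((hm r).1 hr' []).1 hr
  · intro ha
    exact ⟨k, (hk []).2 ha, (hm k).2 hk⟩

/-- One step of the breadth-first search. -/
noncomputable def bfsStep (δ : ℕ → ℕ → ℕ) (valid : ℕ → Prop) (eqv : ℕ → ℕ → Prop) (i ℓ : ℕ)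
    (σ : (ℕ → ℕ) × ℕ) : (ℕ → ℕ) × ℕ :=
  open Classical in
  if i < σ.2 ∧ valid ℓ ∧ ∀ j < σ.2, ¬ eqv (σ.1 j) (δ (σ.1 i) ℓ)
  then (Function.update σ.1 σ.2 (δ (σ.1 i) ℓ), σ.2 + 1) else σ

/-- The invariant of the breadth-first search. -/
def BfsInv (δ : ℕ → ℕ → ℕ) (num : Γ → ℕ) (acc : ℕ → Prop) (s₀ S i ℓ : ℕ) (σ : (ℕ → ℕ) × ℕ) :
    Prop :=
  ∃ W : ℕ → List Γ, IsNumbering (fun s a => δ s (num a)) acc s₀ σ.1 σ.2 W ∧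
    IsClosed (fun s a => δ s (num a)) acc σ.1 σ.2 W (fun i' a => i' < i ∨ i' = i ∧ num a < ℓ) ∧
    (∀ j < σ.2, σ.1 j < S) ∧
    ∀ j < σ.2, j = 0 ∨ ∃ i' a, W j = W i' ++ [a] ∧ (i' < i ∨ i' = i ∧ num a < ℓ)

theorem BfsInv.init (δ : ℕ → ℕ → ℕ) (num : Γ → ℕ) (acc : ℕ → Prop) {s₀ S : ℕ} (h : s₀ < S)
    (Q : ℕ → ℕ) (hQ : Q 0 = s₀) : BfsInv δ num acc s₀ S 0 0 (Q, 1) := by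
  have h0 : ∀ j < 1, j = 0 := by omega
  refine ⟨fun _ => [], ⟨one_pos, rfl, fun j hj => ?_, fun j hj i hi => by omega,
    fun j hj i hi => by omega⟩, fun i hi a ha => by omega, fun j hj => ?_, fun j hj => by omega⟩
  · rw [h0 j hj]; exact hQ
  · rw [h0 j hj]; exact hQ.trans_lt h

/-- Pairs of a queue position and a letter are visited in lexicographic order, and the queue is
sorted; so the candidate strings `W i ++ [a]` appear in increasing shortlex order. A new class is
therefore appended with a string later than all earlier ones, and a known class already has an
earlier string. -/
theorem BfsInv.step {δ : ℕ → ℕ → ℕ} {num : Γ → ℕ} (hnum : StrictMono num) {acc : ℕ → Prop}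
    {s₀ S i ℓ : ℕ} {σ : (ℕ → ℕ) × ℕ} {valid : ℕ → Prop} {eqv : ℕ → ℕ → Prop}
    (hvalid : valid ℓ ↔ ∃ a, num a = ℓ) (hδ : ∀ s < S, δ s ℓ < S)
    (heqv : ∀ s < S, ∀ t < S, eqv s t ↔ Ner (fun s a => δ s (num a)) acc s t)
    (h : BfsInv δ num acc s₀ S i ℓ σ) :
    BfsInv δ num acc s₀ S i (ℓ + 1) (bfsStep δ valid eqv i ℓ σ) := by
  obtain ⟨W, h, hc, hS, ho⟩ := h
  -- The last clause of the invariant says that each listed string other than the first arose from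
  -- an earlier pair; an earlier position is settled by sortedness of the queue, an earlier letter
  -- at the same position by monotonicity of `num`.
  have hlt : i < σ.2 → ∀ a, num a = ℓ → ∀ j < σ.2, SL (W j) (W i ++ [a]) := by
    rintro hi a rfl j hj
    rcases ho j hj with rfl | ⟨i', a', hw, hi' | ⟨rfl, ha'⟩⟩
    · rw [h.zero]; exact .nil_append ..
    · rw [hw]; exact (h.sorted i hi i' hi').append a' a
    · rw [hw]; exact .append_letter _ (hnum.lt_iff_lt.1 ha')
  have ho' : ∀ j < σ.2, j = 0 ∨ ∃ i' a, W j = W i' ++ [a] ∧ (i' < i ∨ i' = i ∧ num a < ℓ + 1) := by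
    intro j hj
    rcases ho j hj with h | ⟨i', a, h1, h2⟩
    · exact .inl h
    · exact .inr ⟨i', a, h1, by omega⟩
  unfold bfsStep
  split_ifs with hcond
  · obtain ⟨hi, hv, hnew⟩ := hcond
    obtain ⟨a, ha⟩ := hvalid.1 hv
    set t := δ (σ.1 i) ℓ with ht
    have htS : t < S := hδ _ (hS i hi)
    have hQ : ∀ j < σ.2, Function.update σ.1 σ.2 t j = σ.1 j := fun j hj =>
      Function.update_of_ne hj.ne _ _
    have hW : ∀ j < σ.2, Function.update W σ.2 (W i ++ [a]) j = W j := fun j hj =>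
      Function.update_of_ne hj.ne _ _
    have hcase : ∀ j < σ.2 + 1, j < σ.2 ∨ j = σ.2 := by omega
    refine ⟨Function.update W σ.2 (W i ++ [a]), ⟨by simp, ?_, ?_, ?_, ?_⟩, ?_, ?_, ?_⟩
    · rw [hW 0 h.pos, h.zero]
    · intro j hj
      rcases hcase j hj with hj | rfl
      · simp only [hQ j hj, hW j hj, h.run j hj]
      · have := h.run i hi
        simp only [Function.update_self, runFrom, List.foldl_append, List.foldl_cons,
          List.foldl_nil, ha] at this ⊢
        rw [ht, this]
    · intro j' hj' j hj
      rcases hcase j' hj' with hj' | rfl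
      · rw [hW j' hj', hW j (hj.trans hj')]
        exact h.sorted j' hj' j hj
      · rw [hW j hj, Function.update_self]
        exact hlt hi a ha j hj
    · intro j' hj' j hj
      rcases hcase j' hj' with hj' | rfl
      · simp only [hQ j' hj', hQ j (hj.trans hj')]
        exact h.dist j' hj' j hj
      · simp only [hQ j hj, Function.update_self]
        rw [← heqv _ (hS j hj) _ htS]
        exact hnew j hj
    · intro i' hi' b hb
      have hi'2 : i' < σ.2 := by omega
      simp only [hQ i' hi'2, hW i' hi'2]
      by_cases hold : i' < i ∨ i' = i ∧ num b < ℓ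
      · obtain ⟨k, hk, h1, h2⟩ := hc i' hi'2 b hold
        exact ⟨k, by omega, by rwa [hQ k hk], by rwa [hW k hk]⟩
      · obtain ⟨rfl, hb'⟩ : i' = i ∧ num b = ℓ := by omega
        obtain rfl : b = a := hnum.injective (hb'.trans ha.symm)
        refine ⟨σ.2, by simp, ?_, .inl (by simp)⟩
        rw [Function.update_self, hb']
        exact fun _ => Iff.rfl
    · intro j hj
      rcases hcase j hj with hj | rfl
      · simpa only [hQ j hj] using hS j hj
      · simpa using htS
    · intro j hj
      rcases hcase j hj with hj | rfl
      · rcases ho' j hj with h0 | ⟨i', b, h1, h2⟩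
        · exact .inl h0
        · refine .inr ⟨i', b, ?_, h2⟩
          rw [hW j hj, hW i' (by omega), h1]
      · refine .inr ⟨i, a, ?_, by omega⟩
        rw [hW i hi, Function.update_self]
  · refine ⟨W, h, fun i' hi' b hb => ?_, hS, ho'⟩
    by_cases hold : i' < i ∨ i' = i ∧ num b < ℓ
    · exact hc i' hi' b hold
    · obtain ⟨rfl, hb'⟩ : i' = i ∧ num b = ℓ := by omega
      have hv : valid ℓ := hvalid.2 ⟨b, hb'⟩
      have : ∃ j < σ.2, eqv (σ.1 j) (δ (σ.1 i') ℓ) := by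
        by_contra hne
        push Not at hne
        exact hcond ⟨hi', hv, hne⟩
      obtain ⟨j, hj, he⟩ := this
      refine ⟨j, hj, ?_, .inr (hlt hi' b hb' j hj)⟩
      dsimp only
      rw [hb']
      exact (heqv _ (hS j hj) _ (hδ _ (hS i' hi'))).1 he

theorem BfsInv.next {δ : ℕ → ℕ → ℕ} {num : Γ → ℕ} {acc : ℕ → Prop} {s₀ S i G : ℕ}
    {σ : (ℕ → ℕ) × ℕ} (hG : ∀ a, num a < G) (h : BfsInv δ num acc s₀ S i G σ) :
    BfsInv δ num acc s₀ S (i + 1) 0 σ := by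
  obtain ⟨W, h, hc, hS, ho⟩ := h
  refine ⟨W, h, fun i' hi' a ha => hc i' hi' a ?_, hS, fun j hj => ?_⟩
  · have := hG a
    omega
  · rcases ho j hj with h | ⟨i', a, h1, h2⟩
    · exact .inl h
    · exact .inr ⟨i', a, h1, by omega⟩

theorem BfsInv.len_le {δ : ℕ → ℕ → ℕ} {num : Γ → ℕ} {acc : ℕ → Prop} {s₀ S i ℓ : ℕ}
    {σ : (ℕ → ℕ) × ℕ} (h : BfsInv δ num acc s₀ S i ℓ σ) : σ.2 ≤ S := by
  obtain ⟨W, h, hc, hS, ho⟩ := h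
  have : (Finset.range σ.2).card ≤ (Finset.range S).card := by
    refine Finset.card_le_card_of_injOn σ.1 (fun j hj => ?_) fun i hi j hj hij => ?_
    · simpa using hS j (by simpa using hj)
    · refine h.inj (by simpa using hi) (by simpa using hj) ?_
      rw [hij]
      exact fun _ => Iff.rfl
  simpa using this

/-- The queue never has more than `S` entries, so `S` rounds process all of them, including those
appended during the search. -/
theorem BfsInv.finish {δ : ℕ → ℕ → ℕ} {num : Γ → ℕ} {acc : ℕ → Prop} {s₀ S : ℕ}
    {σ : (ℕ → ℕ) × ℕ} (h : BfsInv δ num acc s₀ S S 0 σ) :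
    ∃ W, IsNumbering (fun s a => δ s (num a)) acc s₀ σ.1 σ.2 W ∧
      IsClosed (fun s a => δ s (num a)) acc σ.1 σ.2 W (fun _ _ => True) ∧
      (∀ j < σ.2, σ.1 j < S) ∧ σ.2 ≤ S := by
  have hle := h.len_le
  obtain ⟨W, h, hc, hS, ho⟩ := h
  exact ⟨W, h, fun i hi a _ => hc i hi a (.inl (by omega)), hS, hle⟩

end BFS

end SecondOrder


namespace SecondOrder

/-! ## Layers as binary numbers -/

section Num

/-- A finite set as a binary number. -/
def numSet (s : Finset ℕ) : ℕ := ∑ i ∈ s, 2 ^ i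

theorem testBit_numSet (s : Finset ℕ) (i : ℕ) : (numSet s).testBit i = true ↔ i ∈ s := by
  rw [← Nat.mem_bitIndices, ← List.mem_toFinset, numSet, Finset.toFinset_bitIndices_sum_two_pow]

theorem numSet_lt {s : Finset ℕ} {n : ℕ} (h : ∀ i ∈ s, i < n) : numSet s < 2 ^ n :=
  Nat.geomSum_lt le_rfl h

theorem numSet_lt_numSet {s t : Finset ℕ} : numSet s < numSet t ↔ toColex s < toColex t :=
  Finset.geomSum_lt_geomSum_iff_toColex_lt_toColex le_rfl

/-- Monotonicity is required only on a set `S`, because positions of transitions respect the order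
of triples only for right states below `w`. -/
theorem toColex_image_lt {β γ : Type*} [LinearOrder β] [LinearOrder γ] {s t : Finset β}
    {S : Set β} {f : β → γ} (hf : StrictMonoOn f S) (hs : ∀ x ∈ s, x ∈ S) (ht : ∀ x ∈ t, x ∈ S)
    (h : toColex s < toColex t) : toColex (s.image f) < toColex (t.image f) := by
  rw [Finset.Colex.toColex_lt_toColex_iff_exists_forall_lt] at *
  obtain ⟨a, ha, has, h⟩ := h
  refine ⟨f a, Finset.mem_image_of_mem f ha, fun hm => ?_, fun b hb hbt => ?_⟩
  · obtain ⟨x, hx, he⟩ := Finset.mem_image.1 hm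
    exact has (hf.injOn (hs x hx) (ht a ha) he ▸ hx)
  · obtain ⟨x, hx, rfl⟩ := Finset.mem_image.1 hb
    exact hf (hs x hx) (ht a ha) (h x hx fun hxt => hbt (Finset.mem_image_of_mem f hxt))

theorem add_lt_of_lex {K a a' b b' : ℕ} (hb : b < K) (h : a < a' ∨ a = a' ∧ b < b') :
    K * a + b < K * a' + b' := by
  rcases h with h | ⟨rfl, h⟩
  · calc K * a + b < K * a + K := by omega
      _ = K * (a + 1) := by ring
      _ ≤ K * a' := Nat.mul_le_mul le_rfl h
      _ ≤ _ := by omega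
  · omega

variable (α : Type u) [LinearOrder α] [Fintype α]

/-- The symbols in increasing order. -/
noncomputable def sym : Fin (Fintype.card α) ≃o α := Fintype.orderIsoFinOfCardEq α rfl

theorem sort_univ_eq : (Finset.univ : Finset α).sort (· ≤ ·) =
    (List.finRange (Fintype.card α)).map (sym α) := by
  refine List.SortedLT.eq_of_mem_iff (Finset.sortedLT_sort _) ?_ fun a => ?_
  · rw [List.sortedLT_iff_pairwise, List.pairwise_map]
    exact (List.pairwise_lt_finRange _).imp fun h => (sym α).strictMono h
  · simp only [Finset.mem_sort, Finset.mem_univ, List.mem_map, List.mem_finRange, true_and,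
      true_iff]
    exact (sym α).surjective a

variable {α}

/-- The position of a symbol in the alphabet. -/
noncomputable def idx (a : α) : ℕ := (sym α).symm a

theorem idx_lt (a : α) : idx a < Fintype.card α := ((sym α).symm a).2

theorem idx_lt_idx {a b : α} : idx a < idx b ↔ a < b := by
  rw [idx, idx, Fin.val_fin_lt, OrderIso.lt_iff_lt]

theorem idx_inj {a b : α} : idx a = idx b ↔ a = b := by
  rw [idx, idx, Fin.val_inj, (sym α).symm.injective.eq_iff]

theorem idx_sym (i : Fin (Fintype.card α)) : idx (sym α i) = i := by simp [idx]

theorem exists_idx_eq {i : ℕ} (h : i < Fintype.card α) : ∃ a : α, idx a = i :=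
  ⟨sym α ⟨i, h⟩, idx_sym _⟩

/-- The position of a transition. -/
def tpos (n w p a q : ℕ) : ℕ := (p * n + a) * w + q

theorem tpos_lt {n w p a q : ℕ} (hp : p < w) (ha : a < n) (hq : q < w) :
    tpos n w p a q < w * n * w := by
  have h1 : p * n + a < w * n := by nlinarith
  unfold tpos
  nlinarith

theorem tpos_eq {n w p a q p' a' q' : ℕ} (ha : a < n) (ha' : a' < n) (hq : q < w) (hq' : q' < w)
    (h : tpos n w p a q = tpos n w p' a' q') : p = p' ∧ a = a' ∧ q = q' := by
  unfold tpos at h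
  have h0 : ∀ {x y n x' y' : ℕ}, y < n → y' < n → x * n + y = x' * n + y' → x = x' ∧ y = y' := by
    intro x y n x' y' hy hy' h
    have h1 : (x * n + y) / n = x := by
      rw [mul_comm, Nat.mul_add_div (by omega), Nat.div_eq_of_lt hy, add_zero]
    have h2 : (x' * n + y') / n = x' := by
      rw [mul_comm, Nat.mul_add_div (by omega), Nat.div_eq_of_lt hy', add_zero]
    have h3 : x = x' := by rw [← h1, ← h2, h]
    subst h3
    exact ⟨rfl, by omega⟩
  obtain ⟨h1, h2⟩ := h0 hq hq' h
  obtain ⟨h3, h4⟩ := h0 ha ha' h1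
  exact ⟨h3, h4, h2⟩

theorem exists_tpos_eq {n w j : ℕ} (h : j < w * n * w) :
    ∃ p < w, ∃ a < n, ∃ q < w, tpos n w p a q = j := by
  have hw : 0 < w := Nat.pos_of_ne_zero (by rintro rfl; simp at h)
  have hn : 0 < n := Nat.pos_of_ne_zero (by rintro rfl; simp at h)
  refine ⟨j / w / n, ?_, j / w % n, Nat.mod_lt _ hn, j % w, Nat.mod_lt _ hw, ?_⟩
  · rw [Nat.div_lt_iff_lt_mul hn, Nat.div_lt_iff_lt_mul hw]
    exact h
  · rw [tpos, Nat.div_add_mod', Nat.div_add_mod']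

/-- A layer as a number with `w * |α| * w + 4 * w + 2` bits. -/
noncomputable def Layer.number (w : ℕ) (l : Layer α) : ℕ :=
  2 ^ (w * Fintype.card α * w) * (2 ^ w * (2 ^ w * (2 ^ w * (2 ^ w *
    (2 ^ 1 * l.initFlag.toNat + l.finalFlag.toNat) + numSet l.left) + numSet l.right) +
      numSet l.init) + numSet l.final) +
    numSet (l.trans.image fun t => tpos (Fintype.card α) w t.1 (idx t.2.1) t.2.2)

/-- The bits of `ℓ` describe the layer `l`. -/
structure Layer.Codes (w ℓ : ℕ) (l : Layer α) : Prop where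
  trans : ∀ p < w, ∀ a : α, ∀ q < w,
    (ℓ.testBit (tpos (Fintype.card α) w p (idx a) q) = true ↔ (p, a, q) ∈ l.trans)
  final : ∀ q < w, (ℓ.testBit (w * Fintype.card α * w + q) = true ↔ q ∈ l.final)
  init : ∀ q < w, (ℓ.testBit (w * Fintype.card α * w + w + q) = true ↔ q ∈ l.init)
  right : ∀ q < w, (ℓ.testBit (w * Fintype.card α * w + w + w + q) = true ↔ q ∈ l.right)
  left : ∀ q < w, (ℓ.testBit (w * Fintype.card α * w + w + w + w + q) = true ↔ q ∈ l.left)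
  finalFlag : ℓ.testBit (w * Fintype.card α * w + w + w + w + w) = l.finalFlag
  initFlag : ℓ.testBit (w * Fintype.card α * w + w + w + w + w + 1) = l.initFlag

variable {w : ℕ} {l : Layer α}

omit [LinearOrder α] [Fintype α] in
theorem Layer.WidthLE.trans_lt (h : l.WidthLE w) {p q : ℕ} {a : α} (ht : (p, a, q) ∈ l.trans) :
    p < w ∧ q < w :=
  ⟨Finset.mem_range.1 (h.1 (l.trans_mem _ ht).1), Finset.mem_range.1 (h.2 (l.trans_mem _ ht).2)⟩

theorem Layer.WidthLE.bounds (h : l.WidthLE w) :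
    l.initFlag.toNat < 2 ^ 1 ∧ l.finalFlag.toNat < 2 ^ 1 ∧ numSet l.left < 2 ^ w ∧
    numSet l.right < 2 ^ w ∧ numSet l.init < 2 ^ w ∧ numSet l.final < 2 ^ w ∧
    numSet (l.trans.image fun t => tpos (Fintype.card α) w t.1 (idx t.2.1) t.2.2) <
      2 ^ (w * Fintype.card α * w) := by
  refine ⟨?_, ?_, numSet_lt fun i hi => Finset.mem_range.1 (h.1 hi),
    numSet_lt fun i hi => Finset.mem_range.1 (h.2 hi),
    numSet_lt fun i hi => Finset.mem_range.1 (h.1 (l.init_subset hi)),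
    numSet_lt fun i hi => Finset.mem_range.1 (h.2 (l.final_subset hi)), numSet_lt fun i hi => ?_⟩
  · cases l.initFlag <;> simp
  · cases l.finalFlag <;> simp
  · obtain ⟨⟨p, a, q⟩, ht, rfl⟩ := Finset.mem_image.1 hi
    exact tpos_lt (h.trans_lt ht).1 (idx_lt a) (h.trans_lt ht).2

theorem Layer.WidthLE.number_lt (h : l.WidthLE w) :
    l.number w < 2 ^ (w * Fintype.card α * w + w + w + w + w + 2) := by
  obtain ⟨h1, h2, h3, h4, h5, h6, h7⟩ := h.bounds
  have key : ∀ {a b m k : ℕ}, a < 2 ^ m → b < 2 ^ k → 2 ^ k * a + b < 2 ^ (k + m) := by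
    intro a b m k ha hb
    rw [pow_add]
    have := Nat.mul_le_mul (le_refl (2 ^ k)) (Nat.succ_le_of_lt ha)
    rw [Nat.mul_succ] at this
    omega
  have := key (key (key (key (key (key h1 h2) h3) h4) h5) h6) h7
  refine this.trans_le (Nat.pow_le_pow_right (by omega) (by omega))

theorem Layer.WidthLE.codes (h : l.WidthLE w) : l.Codes w (l.number w) := by
  obtain ⟨h1, h2, h3, h4, h5, h6, h7⟩ := h.bounds
  have hlow : ∀ {a b k j : ℕ}, b < 2 ^ k → j < k → (2 ^ k * a + b).testBit j = b.testBit j :=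
    fun hb hj => by rw [Nat.testBit_two_pow_mul_add _ hb, if_pos hj]
  have hhigh : ∀ {a b k j : ℕ}, b < 2 ^ k → (2 ^ k * a + b).testBit (k + j) = a.testBit j :=
    fun hb => by rw [Nat.testBit_two_pow_mul_add _ hb, if_neg (by omega), Nat.add_sub_cancel_left]
  have hb0 : ∀ b : Bool, b.toNat.testBit 0 = b := by decide
  unfold number
  refine ⟨fun p hp a q hq => ?_, fun q hq => ?_, fun q hq => ?_, fun q hq => ?_, fun q hq => ?_,
    ?_, ?_⟩
  · rw [hlow h7 (tpos_lt hp (idx_lt a) hq), testBit_numSet, Finset.mem_image]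
    constructor
    · rintro ⟨⟨p', a', q'⟩, ht, he⟩
      obtain ⟨rfl, ha, rfl⟩ := tpos_eq (idx_lt _) (idx_lt _) (h.trans_lt ht).2 hq he
      rw [idx_inj] at ha
      subst ha
      exact ht
    · exact fun ht => ⟨_, ht, rfl⟩
  · rw [hhigh h7, hlow h6 hq, testBit_numSet]
  · rw [add_assoc, hhigh h7, hhigh h6, hlow h5 hq, testBit_numSet]
  · rw [add_assoc, add_assoc, hhigh h7, hhigh h6, hhigh h5, hlow h4 hq, testBit_numSet]
  · rw [add_assoc, add_assoc, add_assoc, hhigh h7, hhigh h6, hhigh h5, hhigh h4, hlow h3 hq,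
      testBit_numSet]
  · rw [add_assoc, add_assoc, add_assoc, hhigh h7, hhigh h6, hhigh h5,
      show w + w = w + (w + 0) from rfl, hhigh h4, hhigh h3, hlow h2 one_pos, hb0]
  · rw [add_assoc, add_assoc, add_assoc, add_assoc, hhigh h7, hhigh h6, hhigh h5, hhigh h4,
      hhigh h3, show 1 = 1 + 0 from rfl, hhigh h2, hb0]

/-- `Layer.Codes` prescribes every bit below the bound on `ℓ`, and both numbers have no bits beyond
it. -/
theorem Layer.Codes.number_eq (h : l.WidthLE w) {ℓ : ℕ} (hc : l.Codes w ℓ)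
    (hℓ : ℓ < 2 ^ (w * Fintype.card α * w + w + w + w + w + 2)) : l.number w = ℓ := by
  have hn := h.codes
  refine Nat.eq_of_testBit_eq fun j => ?_
  set K := w * Fintype.card α * w with hK
  have hcase : j < K ∨ (∃ q < w, j = K + q) ∨ (∃ q < w, j = K + w + q) ∨
      (∃ q < w, j = K + w + w + q) ∨ (∃ q < w, j = K + w + w + w + q) ∨
      j = K + w + w + w + w ∨ j = K + w + w + w + w + 1 ∨ K + w + w + w + w + 2 ≤ j := by
    by_cases h1 : j < K
    · exact .inl h1
    by_cases h2 : j < K + w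
    · exact .inr (.inl ⟨j - K, by omega, by omega⟩)
    by_cases h3 : j < K + w + w
    · exact .inr (.inr (.inl ⟨j - K - w, by omega, by omega⟩))
    by_cases h4 : j < K + w + w + w
    · exact .inr (.inr (.inr (.inl ⟨j - K - w - w, by omega, by omega⟩)))
    by_cases h5 : j < K + w + w + w + w
    · exact .inr (.inr (.inr (.inr (.inl ⟨j - K - w - w - w, by omega, by omega⟩))))
    omega
  rcases hcase with h1 | ⟨q, hq, rfl⟩ | ⟨q, hq, rfl⟩ | ⟨q, hq, rfl⟩ | ⟨q, hq, rfl⟩ | rfl | rfl | h1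
  · obtain ⟨p, hp, a, ha, q, hq, rfl⟩ := exists_tpos_eq h1
    obtain ⟨a, rfl⟩ := exists_idx_eq ha
    rw [Bool.eq_iff_iff, hn.trans p hp a q hq, hc.trans p hp a q hq]
  · rw [Bool.eq_iff_iff, hn.final q hq, hc.final q hq]
  · rw [Bool.eq_iff_iff, hn.init q hq, hc.init q hq]
  · rw [Bool.eq_iff_iff, hn.right q hq, hc.right q hq]
  · rw [Bool.eq_iff_iff, hn.left q hq, hc.left q hq]
  · rw [hn.finalFlag, hc.finalFlag]
  · rw [hn.initFlag, hc.initFlag]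
  · rw [Nat.testBit_lt_two_pow (h.number_lt.trans_le (Nat.pow_le_pow_right (by omega) h1)),
      Nat.testBit_lt_two_pow (hℓ.trans_le (Nat.pow_le_pow_right (by omega) h1))]

/-- The bits of `ℓ` describe some layer over an alphabet of `n` symbols. -/
structure ValidNum (n w ℓ : ℕ) : Prop where
  trans : ∀ p < w, ∀ a < n, ∀ q < w, ℓ.testBit (tpos n w p a q) = true →
    ℓ.testBit (w * n * w + w + w + w + p) = true ∧ ℓ.testBit (w * n * w + w + w + q) = true
  final : ∀ q < w, ℓ.testBit (w * n * w + q) = true →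
    ℓ.testBit (w * n * w + w + w + q) = true ∧ ℓ.testBit (w * n * w + w + w + w + w) = true
  init : ∀ q < w, ℓ.testBit (w * n * w + w + q) = true →
    ℓ.testBit (w * n * w + w + w + w + q) = true ∧ ℓ.testBit (w * n * w + w + w + w + w + 1) = true

/-- The clauses of `ValidNum` are the proof fields of `Layer`, read off from bits; any other bit
pattern is allowed. -/
theorem validNum_iff {ℓ : ℕ} (hℓ : ℓ < 2 ^ (w * Fintype.card α * w + w + w + w + w + 2)) :
    ValidNum (Fintype.card α) w ℓ ↔ ∃ l : LayerAlphabet α w, l.1.number w = ℓ := by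
  constructor
  · intro h
    let l : Layer α :=
      { left := (Finset.range w).filter fun q =>
          ℓ.testBit (w * Fintype.card α * w + w + w + w + q) = true
        right := (Finset.range w).filter fun q =>
          ℓ.testBit (w * Fintype.card α * w + w + w + q) = true
        trans := (Finset.range w ×ˢ Finset.univ ×ˢ Finset.range w).filter fun t =>
          ℓ.testBit (tpos (Fintype.card α) w t.1 (idx t.2.1) t.2.2) = true
        init := (Finset.range w).filter fun q =>
          ℓ.testBit (w * Fintype.card α * w + w + q) = true
        final := (Finset.range w).filter fun q =>
          ℓ.testBit (w * Fintype.card α * w + q) = true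
        initFlag := ℓ.testBit (w * Fintype.card α * w + w + w + w + w + 1)
        finalFlag := ℓ.testBit (w * Fintype.card α * w + w + w + w + w)
        trans_mem := by
          rintro ⟨p, a, q⟩ ht
          simp only [Finset.mem_filter, Finset.mem_product, Finset.mem_range, Finset.mem_univ,
            true_and] at ht ⊢
          have := h.trans p ht.1.1 _ (idx_lt a) q ht.1.2 ht.2
          exact ⟨⟨ht.1.1, this.1⟩, ht.1.2, this.2⟩
        init_subset := fun q hq => by
          simp only [Finset.mem_filter, Finset.mem_range] at hq ⊢
          exact ⟨hq.1, (h.init q hq.1 hq.2).1⟩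
        final_subset := fun q hq => by
          simp only [Finset.mem_filter, Finset.mem_range] at hq ⊢
          exact ⟨hq.1, (h.final q hq.1 hq.2).1⟩
        init_eq_empty := fun hf => by
          simp only [Finset.filter_eq_empty_iff, Finset.mem_range]
          intro q hq hq'
          have := (h.init q hq hq').2
          simp [hf] at this
        final_eq_empty := fun hf => by
          simp only [Finset.filter_eq_empty_iff, Finset.mem_range]
          intro q hq hq'
          have := (h.final q hq hq').2
          simp [hf] at this }
    have hl : l.WidthLE w := ⟨Finset.filter_subset _ _, Finset.filter_subset _ _⟩
    refine ⟨⟨l, hl⟩, Layer.Codes.number_eq hl ?_ hℓ⟩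
    refine ⟨fun p hp a q hq => ?_, fun q hq => ?_, fun q hq => ?_, fun q hq => ?_,
      fun q hq => ?_, rfl, rfl⟩ <;> simp only [l, Finset.mem_filter, Finset.mem_product,
        Finset.mem_range, Finset.mem_univ, true_and] <;> tauto
  · rintro ⟨l, rfl⟩
    have hc := l.2.codes
    refine ⟨fun p hp a ha q hq => ?_, fun q hq => ?_, fun q hq => ?_⟩
    · obtain ⟨a, rfl⟩ := exists_idx_eq ha
      rw [hc.trans p hp a q hq, hc.left p hp, hc.right q hq]
      exact fun ht => l.1.trans_mem _ ht
    · rw [hc.final q hq, hc.right q hq, hc.finalFlag]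
      refine fun h => ⟨l.1.final_subset h, ?_⟩
      by_contra hf
      rw [l.1.final_eq_empty (by simpa using hf)] at h
      simp at h
    · rw [hc.init q hq, hc.left q hq, hc.initFlag]
      refine fun h => ⟨l.1.init_subset h, ?_⟩
      by_contra hf
      rw [l.1.init_eq_empty (by simpa using hf)] at h
      simp at h

/-- The blocks of the number are the components of `Layer.key` from the most significant down, and
within a block comparing binary numbers is comparing sets by the largest element of the symmetric
difference. A loop over increasing numbers hence visits the letters in the order that the
normalization of automata refers to. -/
theorem number_strictMono (w : ℕ) : StrictMono fun l : LayerAlphabet α w => l.1.number w := by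
  intro l m hlm
  have hlm : l.1.key < m.1.key := hlm
  obtain ⟨h1, h2, h3, h4, h5, h6, h7⟩ := l.2.bounds
  have hT : toColex (l.1.trans.map Layer.lexTriple) < toColex (m.1.trans.map Layer.lexTriple) →
      numSet (l.1.trans.image fun t => tpos (Fintype.card α) w t.1 (idx t.2.1) t.2.2) <
      numSet (m.1.trans.image fun t => tpos (Fintype.card α) w t.1 (idx t.2.1) t.2.2) := by
    intro h
    rw [numSet_lt_numSet]
    let f : ℕ ×ₗ (α ×ₗ ℕ) → ℕ := fun t =>
      tpos (Fintype.card α) w (ofLex t).1 (idx (ofLex (ofLex t).2).1) (ofLex (ofLex t).2).2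
    have hf : StrictMonoOn f {t | (ofLex (ofLex t).2).2 < w} := by
      rintro ⟨p, a, q⟩ hq ⟨p', a', q'⟩ hq' hlt
      have hq : q < w := hq
      have hlt' : p < p' ∨ p = p' ∧ (a < a' ∨ a = a' ∧ q < q') := by
        have h1 := Prod.Lex.toLex_lt_toLex.1 hlt
        rcases h1 with h1 | ⟨h1, h2⟩
        · exact .inl h1
        · exact .inr ⟨h1, Prod.Lex.toLex_lt_toLex.1 h2⟩
      have h1 : p * Fintype.card α + idx a < p' * Fintype.card α + idx a' ∨
          p * Fintype.card α + idx a = p' * Fintype.card α + idx a' ∧ q < q' := by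
        rcases hlt' with h | ⟨rfl, h | ⟨rfl, h⟩⟩
        · left
          rw [mul_comm p, mul_comm p']
          exact add_lt_of_lex (idx_lt a) (.inl h)
        · left
          have := idx_lt_idx.2 h
          omega
        · exact .inr ⟨rfl, h⟩
      change (p * Fintype.card α + idx a) * w + q < (p' * Fintype.card α + idx a') * w + q'
      rw [mul_comm _ w, mul_comm _ w]
      exact add_lt_of_lex hq h1
    have hsub : ∀ k : LayerAlphabet α w, ∀ x ∈ k.1.trans.map Layer.lexTriple,
        x ∈ {t : ℕ ×ₗ (α ×ₗ ℕ) | (ofLex (ofLex t).2).2 < w} := by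
      intro k x hx
      obtain ⟨t, ht, rfl⟩ := Finset.mem_map.1 hx
      exact (k.2.trans_lt ht).2
    have := toColex_image_lt hf (hsub l) (hsub m) h
    rw [Finset.map_eq_image, Finset.map_eq_image, Finset.image_image, Finset.image_image] at this
    exact this
  have hbool : ∀ b c : Bool, b < c → b.toNat < c.toNat := by decide
  simp only [Layer.key, Prod.Lex.toLex_lt_toLex] at hlm
  refine add_lt_of_lex h7 ?_
  rcases hlm with h | ⟨e1, h | ⟨e2, h | ⟨e3, h | ⟨e4, h | ⟨e5, h | ⟨e6, h⟩⟩⟩⟩⟩⟩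
  · exact .inl (add_lt_of_lex h6 (.inl (add_lt_of_lex h5 (.inl (add_lt_of_lex h4 (.inl
      (add_lt_of_lex h3 (.inl (add_lt_of_lex h2 (.inl (hbool _ _ h)))))))))))
  · exact .inl (add_lt_of_lex h6 (.inl (add_lt_of_lex h5 (.inl (add_lt_of_lex h4 (.inl
      (add_lt_of_lex h3 (.inl (add_lt_of_lex h2 (.inr ⟨by rw [e1], hbool _ _ h⟩))))))))))
  · exact .inl (add_lt_of_lex h6 (.inl (add_lt_of_lex h5 (.inl (add_lt_of_lex h4 (.inl
      (add_lt_of_lex h3 (.inr ⟨by rw [e1, e2], numSet_lt_numSet.2 h⟩))))))))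
  · rw [toColex_inj] at e3
    exact .inl (add_lt_of_lex h6 (.inl (add_lt_of_lex h5 (.inl (add_lt_of_lex h4
      (.inr ⟨by rw [e1, e2, e3], numSet_lt_numSet.2 h⟩))))))
  · rw [toColex_inj] at e3 e4
    exact .inl (add_lt_of_lex h6 (.inl (add_lt_of_lex h5
      (.inr ⟨by rw [e1, e2, e3, e4], numSet_lt_numSet.2 h⟩))))
  · rw [toColex_inj] at e3 e4 e5
    exact .inl (add_lt_of_lex h6 (.inr ⟨by rw [e1, e2, e3, e4, e5], numSet_lt_numSet.2 h⟩))
  · rw [toColex_inj] at e3 e4 e5 e6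
    exact .inr ⟨by rw [e1, e2, e3, e4, e5, e6], hT h⟩

end Num

end SecondOrder


namespace SecondOrder

/-! ## Automata over wider layers -/

section Extend

variable {α : Type u}

/-- The layer without states. -/
def Layer.empty : Layer α where
  left := ∅
  right := ∅
  trans := ∅
  init := ∅
  final := ∅
  initFlag := false
  finalFlag := false
  trans_mem := by simp
  init_subset := by simp
  final_subset := by simp
  init_eq_empty := by simp
  final_eq_empty := by simp

/-- The empty layer as a letter. -/
def emptyLetter (w : ℕ) : LayerAlphabet α w := ⟨Layer.empty, by simp [Layer.WidthLE, Layer.empty]⟩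

/-- The number of the empty layer is `0`. -/
theorem emptyLetter_le [LinearOrder α] [Fintype α] (w : ℕ) (l : LayerAlphabet α w) :
    emptyLetter w ≤ l := by
  rw [← (number_strictMono w).le_iff_le]
  simp [emptyLetter, Layer.number, Layer.empty, numSet]

/-- A letter as a letter of a wider alphabet. -/
def widen {w v : ℕ} (h : w ≤ v) (l : LayerAlphabet α w) : LayerAlphabet α v := ⟨l.1, l.2.mono h⟩

theorem SL.map {Γ Γ' : Type*} [LinearOrder Γ] [LinearOrder Γ'] {f : Γ → Γ'} (hf : StrictMono f)
    {u v : List Γ} (h : SL u v) : SL (u.map f) (v.map f) := by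
  rw [SL, List.shortlex_def] at *
  rcases h with h | ⟨h1, h2⟩
  · left; simpa using h
  · refine .inr ⟨by simpa using h1, ?_⟩
    clear h1
    induction h2 with
    | nil => exact .nil
    | cons _ ih => exact .cons ih
    | rel h => exact .rel (hf h)

/-- Transitions labelled by wider layers lead to the state `z`. -/
def extendNFA {σ : Type} {w : ℕ} (M : NFA (LayerAlphabet α w) σ) (z : σ) (v : ℕ) :
    NFA (LayerAlphabet α v) σ where
  step := fun q l => {q' | (∃ h : l.1.WidthLE w, q' ∈ M.step q ⟨l.1, h⟩) ∨
    (¬ l.1.WidthLE w ∧ q' = z)}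
  start := M.start
  accept := M.accept

section

variable {σ : Type} {w v : ℕ} {M : NFA (LayerAlphabet α w) σ} {z : σ}

theorem mem_extendNFA_step {p q : σ} {l : LayerAlphabet α v} :
    q ∈ (extendNFA M z v).step p l ↔ (∃ h : l.1.WidthLE w, q ∈ M.step p ⟨l.1, h⟩) ∨
      (¬ l.1.WidthLE w ∧ q = z) := Iff.rfl

theorem extendNFA_eval_widen (h : w ≤ v) (u : List (LayerAlphabet α w)) :
    (extendNFA M z v).eval (u.map (widen h)) = M.eval u := by
  induction u using List.reverseRecOn with
  | nil => rfl
  | append_singleton u a ih =>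
    rw [List.map_append, List.map_singleton, NFA.eval_append_singleton, NFA.eval_append_singleton,
      ih]
    ext q
    simp only [NFA.mem_stepSet, mem_extendNFA_step]
    simp [widen, a.2]

/-- The first letter that is too wide leads to `z` from wherever the automaton is, and `z` is
absorbing. -/
theorem extendNFA_eval_of_not (h : w ≤ v) (hM : ∀ u, (M.eval u).Nonempty)
    (hz : ∀ a, M.step z a = {z}) (u : List (LayerAlphabet α v)) :
    (∃ u' : List (LayerAlphabet α w), u = u'.map (widen h)) ∨
      (extendNFA M z v).eval u = {z} := by
  induction u using List.reverseRecOn with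
  | nil => exact .inl ⟨[], rfl⟩
  | append_singleton u a ih =>
    rw [NFA.eval_append_singleton]
    by_cases ha : a.1.WidthLE w
    · rcases ih with ⟨u', rfl⟩ | ih
      · exact .inl ⟨u' ++ [⟨a.1, ha⟩], by simp [widen]⟩
      · right
        rw [ih]
        ext q
        rw [NFA.stepSet_singleton, mem_extendNFA_step]
        simp [ha, hz]
    · right
      have hne : ((extendNFA M z v).eval u).Nonempty := by
        rcases ih with ⟨u', rfl⟩ | ih
        · rw [extendNFA_eval_widen]
          exact hM u'
        · rw [ih]
          exact ⟨z, rfl⟩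
      obtain ⟨p, hp⟩ := hne
      ext q
      rw [NFA.mem_stepSet]
      simp only [mem_extendNFA_step, ha, IsEmpty.exists_iff, not_false_eq_true, true_and, false_or]
      exact ⟨fun ⟨_, _, h⟩ => h, fun h => ⟨p, hp, h⟩⟩

theorem extendNFA_accepts (h : w ≤ v) (hM : ∀ u, (M.eval u).Nonempty)
    (hz : ∀ a, M.step z a = {z}) (hz' : z ∉ M.accept) (u : List (LayerAlphabet α v)) :
    u ∈ (extendNFA M z v).accepts ↔ ∃ u' ∈ M.accepts, u = u'.map (widen h) := by
  have hw : ∀ u', u'.map (widen h) ∈ (extendNFA M z v).accepts ↔ u' ∈ M.accepts := by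
    intro u'
    rw [NFA.mem_accepts, NFA.mem_accepts]
    change (∃ S ∈ M.accept, S ∈ (extendNFA M z v).eval _) ↔ _
    rw [extendNFA_eval_widen]
    rfl
  constructor
  · intro hu
    rcases extendNFA_eval_of_not h hM hz u with ⟨u', rfl⟩ | he
    · exact ⟨u', (hw u').1 hu, rfl⟩
    · obtain ⟨q, hq, hq'⟩ := (NFA.mem_accepts).1 hu
      change q ∈ (extendNFA M z v).eval u at hq'
      rw [he] at hq'
      obtain rfl : q = z := hq'
      exact (hz' hq).elim
  · rintro ⟨u', hu', rfl⟩
    exact (hw u').2 hu'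

end

namespace FA

/-- Transitions labelled by wider layers lead to the state `z`. -/
abbrev extend {w : ℕ} (A : FA (LayerAlphabet α w)) (z : Fin A.n) (v : ℕ) :
    FA (LayerAlphabet α v) := ⟨A.n, extendNFA A.nfa z v⟩

variable {w v : ℕ} {A : FA (LayerAlphabet α w)} {z : Fin A.n}

theorem eval_nonempty {Γ : Type u} {F : FA Γ} (hd : F.Deterministic) (hc : F.Complete)
    (u : List Γ) : (F.nfa.eval u).Nonempty :=
  let ⟨q, hq⟩ := eval_eq_singleton hd hc u
  ⟨q, by rw [hq]; rfl⟩

theorem extend_restrict (h : w ≤ v) : (A.extend z v).restrict h = A := by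
  obtain ⟨n, M⟩ := A
  obtain ⟨step, start, accept⟩ := M
  simp only [extend, extendNFA, restrict, mk.injEq, heq_eq_eq, true_and, NFA.mk.injEq, and_true]
  funext q l
  ext q'
  simp [l.2]

theorem extend_firstLang (h : w ≤ v) (hc : A.Complete) (hd : A.Deterministic)
    (hz : ∀ a, A.nfa.step z a = {z}) (hz' : z ∉ A.nfa.accept) :
    (A.extend z v).firstLang = A.firstLang := by
  ext E
  constructor
  · rintro ⟨u, hu, rfl⟩
    obtain ⟨u', hu', rfl⟩ := (extendNFA_accepts h (eval_nonempty hd hc) hz hz' u).1 hu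
    exact ⟨u', hu', by simp [widen]⟩
  · rintro ⟨u', hu', rfl⟩
    exact ⟨u'.map (widen h), (extendNFA_accepts h (eval_nonempty hd hc) hz hz' _).2 ⟨u', hu', rfl⟩, by simp [widen]⟩

/-- Only `z` is reached by new strings. Each of them is nonempty, so it is not earlier than the
string consisting of the empty layer, which reaches `z` already; first strings therefore stay the
same. Narrow strings suffice to keep residuals apart. -/
theorem Nice.extend [LinearOrder α] [Fintype α] (h : w ≤ v) (hA : A.Nice)
    (hz : ∀ a, A.nfa.step z a = {z}) (hz' : z ∉ A.nfa.accept)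
    (hze : z ∈ A.nfa.eval [emptyLetter w]) : (A.extend z v).Nice := by
  classical
  have hmono : StrictMono (widen h : LayerAlphabet α w → _) := fun _ _ h => h
  refine ⟨⟨hA.det.1, fun p a q hq q' hq' => ?_⟩, ⟨hA.complete.1, fun p a => ?_⟩, ?_,
    fun q q' he => ?_⟩
  · rw [mem_extendNFA_step] at hq hq'
    rcases hq with ⟨ha, hq⟩ | ⟨ha, hq⟩ <;> rcases hq' with ⟨ha', hq'⟩ | ⟨ha', hq'⟩
    · exact hA.det.2 p _ hq hq'
    · exact absurd ha ha'
    · exact absurd ha' ha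
    · exact hq.trans hq'.symm
  · by_cases ha : a.1.WidthLE w
    · obtain ⟨q, hq⟩ := hA.complete.2 p ⟨a.1, ha⟩
      exact ⟨q, .inl ⟨ha, hq⟩⟩
    · exact ⟨z, .inr ⟨ha, rfl⟩⟩
  · obtain ⟨lex, h1, h2⟩ := hA.normalized
    refine ⟨fun q => (lex q).map (widen h), fun q => ⟨?_, fun s hs => ?_⟩, fun q q' => ?_⟩
    · rw [extendNFA_eval_widen]
      exact (h1 q).1
    · have hold : ∀ u', q ∈ A.nfa.eval u' → u'.map (widen h) = (lex q).map (widen h) ∨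
          SL ((lex q).map (widen h)) (u'.map (widen h)) := by
        intro u' hu'
        rcases (h1 q).2 u' hu' with he | he
        · exact .inl (by rw [he])
        · exact .inr (SL.map hmono he)
      rcases extendNFA_eval_of_not h (eval_nonempty hA.det hA.complete) hz s with ⟨u', rfl⟩ | he
      · rw [extendNFA_eval_widen] at hs
        exact hold u' hs
      · by_cases hs0 : s = []
        · subst hs0
          exact hold [] hs
        rw [he] at hs
        have hqz : q = z := hs
        have h3 := hold _ (hqz ▸ hze)
        have h4 : s = [emptyLetter v] ∨ SL [emptyLetter v] s :=
          SL.singleton_or (emptyLetter_le v) hs0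
        have h5 : [emptyLetter w].map (widen h) = [(emptyLetter v : LayerAlphabet α v)] := rfl
        rw [h5] at h3
        rcases h3 with h3 | h3 <;> rcases h4 with h4 | h4
        · exact .inl (h4.trans h3)
        · rw [h3] at h4; exact .inr h4
        · rw [← h4] at h3; exact .inr h3
        · exact .inr (h3.trans h4)
    · have hf : ∀ {q q'}, q < q' → SL ((lex q).map (widen h)) ((lex q').map (widen h)) :=
        fun hq => SL.map hmono ((h2 _ _).1 hq)
      refine ⟨hf, fun hlt => ?_⟩
      rcases lt_trichotomy q q' with h3 | rfl | h3
      · exact h3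
      · exact (SL.asymm hlt hlt).elim
      · exact (SL.asymm hlt (hf h3)).elim
  · refine hA.dist q q' fun x => ?_
    have key : ∀ q, x.map (widen h) ∈ (extendNFA A.nfa z v).acceptsFrom {q} ↔
        x ∈ A.nfa.acceptsFrom {q} := by
      intro q
      obtain ⟨u, hu⟩ := hA.eval_lex q
      have hu' : (A.extend z v).nfa.eval (u.map (widen h)) = {q} := by
        exact (extendNFA_eval_widen h u).trans hu
      rw [mem_accepts_append hu, mem_accepts_append (F := A.extend z v) hu', ← List.map_append,
        extendNFA_accepts h (eval_nonempty hA.det hA.complete) hz hz']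
      constructor
      · rintro ⟨u', hu', he⟩
        rwa [List.map_injective_iff.2 hmono.injective he]
      · exact fun hx => ⟨_, hx, rfl⟩
    rw [← key, ← key]
    exact he _

/-- The reason why width `w` suffices for canonical forms: the states of a homomorphic image are
values below `w`. -/
theorem isCanonicalODD_width [LinearOrder α] [Fintype α] [Nonempty α] (hw : 0 < w)
    {D E : List (Layer α)} (hD : IsCDODD w D) (h : IsCanonicalODD D E) : IsCDODD w E := by
  obtain ⟨h', hr⟩ := (isCanonicalODD_iff hw hD).1 h
  obtain ⟨hne, X, f, hS⟩ := isCDODD_iff.1 hD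
  obtain ⟨f', Y, hE, hEne, -⟩ := hr.head_spec hS hne
  exact isCDODD_iff.2 ⟨hEne, _, _, hE⟩

/-- A nice automaton for the canonical forms over the narrow alphabet yields the second canonical
form over a wide one. -/
theorem exists_secondCanonicalForm [LinearOrder α] [Fintype α] [Nonempty α] (hw : 0 < w)
    (hwv : w ≤ v) {F : FA (LayerAlphabet α w)} (hF : ∀ D ∈ F.firstLang, IsCDODD w D)
    (hA : A.Nice)
    (hL : ∀ u, u ∈ A.nfa.accepts ↔ ∃ D ∈ F.firstLang, IsCanonicalODD D (u.map Subtype.val)) :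
    ∃ C : FA (LayerAlphabet α v), (F.IsSecondCanonicalForm C ∧
      ∀ C' : FA (LayerAlphabet α v), F.IsSecondCanonicalForm C' → C' = C) ∧
      (C.restrict hwv).IsSOFA ∧ (C.restrict hwv).firstLang = C.firstLang ∧
      F.IsSecondCanonicalForm (C.restrict hwv) ∧
      (C.restrict hwv).secondLang = F.secondLang ∧ C.restrict hwv = A := by
  have hAL : A.firstLang = {E | ∃ D ∈ F.firstLang, IsCanonicalODD D E} := by
    ext E
    constructor
    · rintro ⟨u, hu, rfl⟩
      exact (hL u).1 hu
    · rintro ⟨D, hD, hE⟩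
      have hEw := isCanonicalODD_width hw (hF D hD) hE
      lift E to List (LayerAlphabet α w) using hEw.1.2.1
      exact ⟨E, (hL E).2 ⟨D, hD, hE⟩, rfl⟩
  have hODD : ∀ E ∈ A.firstLang, IsODD w E := by
    rw [hAL]
    rintro E ⟨D, hD, hE⟩
    exact (isCanonicalODD_width hw (hF D hD) hE).1
  obtain ⟨z, hz⟩ := eval_eq_singleton hA.det hA.complete [emptyLetter w]
  -- A diagram starts with a layer carrying the initial flag, which the empty layer lacks.
  have hdead : ∀ x, emptyLetter w :: x ∉ A.nfa.accepts := by
    intro x hx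
    have := hODD _ ⟨_, hx, rfl⟩
    have := (this.2.2.2 0 (by simp)).1.2 rfl
    simp [emptyLetter, Layer.empty] at this
  have hz' : z ∉ A.nfa.accept := by
    intro h
    apply hdead []
    rw [NFA.mem_accepts]
    refine ⟨z, h, ?_⟩
    change z ∈ A.nfa.eval _
    rw [hz]
    rfl
  -- No string is accepted from `z` or from any of its successors, so their residuals are both empty
  -- and they coincide.
  have hzs : ∀ a, A.nfa.step z a = {z} := by
    intro a
    obtain ⟨z', hz1⟩ := eval_eq_singleton hA.det hA.complete ([emptyLetter w] ++ [a])
    rw [step_eq hz, hz1, Set.singleton_eq_singleton_iff]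
    refine hA.dist _ _ fun x => ?_
    rw [mem_accepts_append hz, mem_accepts_append hz1]
    exact iff_of_false (hdead _) (hdead _)
  have hC : (A.extend z v).Nice := hA.extend hwv hzs hz' (by rw [hz]; rfl)
  have hCL := extend_firstLang hwv hA.complete hA.det hzs hz'
  have hval : Function.Injective (List.map (Subtype.val : LayerAlphabet α v → Layer α)) :=
    List.map_injective_iff.2 Subtype.val_injective
  refine ⟨A.extend z v, ⟨⟨hC.det, hC.complete, hC.normalized, hC.minimal, by rw [hCL, hAL]⟩, ?_⟩, ?_⟩
  · rintro C' ⟨h1, h2, h3, h4, h5⟩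
    refine hC.unique h1 h2 h3 h4 ?_
    have h6 : C'.firstLang = (A.extend z v).firstLang := by rw [h5, hCL, hAL]
    exact hval.image_injective h6
  · rw [extend_restrict]
    refine ⟨hODD, hCL.symm, ⟨hA.det, hA.complete, hA.normalized, hA.minimal, hAL⟩, ?_, rfl⟩
    rw [secondLang, secondLang, hAL]
    ext x
    constructor
    · rintro ⟨E, ⟨D, hD, hE⟩, rfl⟩
      exact ⟨D, hD, hE.2.2.2.symm⟩
    · rintro ⟨D, hD, rfl⟩
      obtain ⟨hne, X, f, hS⟩ := isCDODD_iff.1 (hF D hD)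
      obtain ⟨E, h, hr⟩ := hS.exists_homRun hne
      have hE := (isCanonicalODD_iff hw (hF D hD)).2 ⟨h, hr⟩
      exact ⟨E, ⟨D, hD, hE⟩, hE.2.2.2⟩

end FA

end Extend

end SecondOrder


namespace SecondOrder

/-! ## Derived expressions -/

namespace Ex

def tr (π : Fin 16 → ℕ) (bk : ℕ → ℕ → ℕ) (e : Ex) (ρ : List ℕ) : Prop := e.eval π bk ρ ≠ 0

def and (a b : Ex) : Ex := ite a b (num 0)
def or (a b : Ex) : Ex := ite a (num 1) b
def not (a : Ex) : Ex := ite a (num 0) (num 1)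
def imp (a b : Ex) : Ex := ite a b (num 1)
def iff (a b : Ex) : Ex := ite a b (not b)
def lt (a b : Ex) : Ex := sub b a
def eq (a b : Ex) : Ex := not (add (sub a b) (sub b a))
def all (j : Fin 16) (b : Ex) : Ex := fold j (num 1) (ite (weak 1 b) (var 0) (num 0))
def ex (j : Fin 16) (b : Ex) : Ex := fold j (num 0) (ite (weak 1 b) (num 1) (var 0))
/-- The last index satisfying a condition. -/
def find (j : Fin 16) (b : Ex) : Ex := fold j (num 0) (ite (weak 1 b) (var 1) (var 0))
/-- The number of indices satisfying a condition. -/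
def count (j : Fin 16) (b : Ex) : Ex :=
  fold j (num 0) (ite (weak 1 b) (add (var 0) (num 1)) (var 0))
/-- The product with a parameter. -/
def mulP (a : Ex) (j : Fin 16) : Ex := fold j (num 0) (add (var 0) (weak 2 a))
/-- Division by a parameter. -/
def divP (a : Ex) (j : Fin 16) : Ex :=
  fold 13 (num 0) (ite (lt (weak 2 a) (mulP (add (var 0) (num 1)) j)) (var 0)
    (add (var 0) (num 1)))
def modP (a : Ex) (j : Fin 16) : Ex := sub a (mulP (divP a j) j)
/-- A digit in the base given by a parameter. -/
def digit (j : Fin 16) (s i : Ex) : Ex :=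
  modP (fold 13 s (ite (lt (var 1) (weak 2 i)) (divP (var 0) j) (var 0))) j
def bit (s i : Ex) : Ex := digit 11 s i
/-- Powers of a parameter. -/
def powP (j i : Fin 16) : Ex := fold i (num 1) (mulP (var 0) j)
def pow2 (i : Ex) : Ex :=
  fold 7 (num 1) (ite (lt (var 1) (weak 2 i)) (add (var 0) (var 0)) (var 0))
/-- The set of the indices satisfying a condition, as a binary number. -/
def mkset (b : Ex) : Ex :=
  fold 7 (num 0) (ite (weak 1 b) (add (var 0) (pow2 (var 1))) (var 0))

section

variable {π : Fin 16 → ℕ} {bk : ℕ → ℕ → ℕ} {a b c : Ex} {ρ : List ℕ} {j : Fin 16}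

theorem eval_of_tr : tr π bk c ρ → eval π bk (ite c a b) ρ = eval π bk a ρ := fun h => if_pos h

theorem eval_of_not_tr : ¬ tr π bk c ρ → eval π bk (ite c a b) ρ = eval π bk b ρ :=
  fun h => if_neg h

theorem tr_ite : tr π bk (ite c a b) ρ ↔ (tr π bk c ρ ∧ tr π bk a ρ) ∨
    (¬ tr π bk c ρ ∧ tr π bk b ρ) := by
  by_cases h : tr π bk c ρ
  · rw [tr, eval_of_tr h, ← tr]; simp only [h, true_and, not_true, false_and, or_false]
  · rw [tr, eval_of_not_tr h, ← tr]; simp only [h, false_and, not_false_eq_true, true_and, false_or]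

@[simp] theorem tr_num {k : ℕ} : tr π bk (num k) ρ ↔ k ≠ 0 := Iff.rfl

@[simp] theorem tr_and : tr π bk (and a b) ρ ↔ tr π bk a ρ ∧ tr π bk b ρ := by
  simp [and, tr_ite]

@[simp] theorem tr_or : tr π bk (or a b) ρ ↔ tr π bk a ρ ∨ tr π bk b ρ := by
  simp only [or, tr_ite, tr_num]; tauto

@[simp] theorem tr_not : tr π bk (not a) ρ ↔ ¬ tr π bk a ρ := by
  simp [not, tr_ite]

@[simp] theorem tr_imp : tr π bk (imp a b) ρ ↔ (tr π bk a ρ → tr π bk b ρ) := by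
  simp only [imp, tr_ite, tr_num]; tauto

@[simp] theorem tr_iff : tr π bk (iff a b) ρ ↔ (tr π bk a ρ ↔ tr π bk b ρ) := by
  simp only [iff, tr_ite, tr_not]; tauto

@[simp] theorem tr_lt : tr π bk (lt a b) ρ ↔ eval π bk a ρ < eval π bk b ρ := by
  simp [lt, tr, eval, Nat.sub_ne_zero_iff_lt]

@[simp] theorem tr_eq : tr π bk (eq a b) ρ ↔ eval π bk a ρ = eval π bk b ρ := by
  rw [eq, tr_not]
  simp only [tr, eval]
  omega

@[simp] theorem tr_rd {k : ℕ} : tr π bk (rd k a) ρ ↔ bk k (eval π bk a ρ) ≠ 0 := Iff.rfl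

@[simp] theorem tr_all : tr π bk (all j b) ρ ↔ ∀ i < π j, tr π bk b (i :: ρ) := by
  rw [tr, all, eval]
  induction π j with
  | zero => simp [iter, eval]
  | succ n ih =>
    rw [iter, ← tr, tr_ite, Nat.forall_lt_succ_right, ← ih]
    simp only [List.drop_one, List.tail_cons, tr, eval, List.getD_cons_zero]
    tauto

@[simp] theorem tr_ex : tr π bk (ex j b) ρ ↔ ∃ i < π j, tr π bk b (i :: ρ) := by
  rw [tr, ex, eval]
  induction π j with
  | zero => simp [iter, eval]
  | succ n ih =>
    rw [iter, ← tr, tr_ite, Nat.exists_lt_succ_right, ← ih]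
    simp only [List.drop_one, List.tail_cons, tr, eval, List.getD_cons_zero]
    tauto

@[simp] theorem eval_num {k : ℕ} : eval π bk (num k) ρ = k := rfl
@[simp] theorem eval_par : eval π bk (par j) ρ = π j := rfl
@[simp] theorem eval_add : eval π bk (add a b) ρ = eval π bk a ρ + eval π bk b ρ := rfl
@[simp] theorem eval_rd {k : ℕ} : eval π bk (rd k a) ρ = bk k (eval π bk a ρ) := rfl
@[simp] theorem eval_weak {k : ℕ} : eval π bk (weak k a) ρ = eval π bk a (ρ.drop k) := rfl
@[simp] theorem eval_var {k : ℕ} : eval π bk (var k) ρ = ρ.getD k 0 := rfl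

@[simp] theorem eval_mulP : eval π bk (mulP a j) ρ = eval π bk a ρ * π j := by
  rw [mulP, eval]
  induction π j with
  | zero => simp [iter]
  | succ n ih => rw [iter, ih]; simp [Nat.mul_succ]

/-- The accumulator grows by one as long as the next multiple of the divisor does not exceed the
dividend, so after `n` rounds it is the minimum of `n` and the quotient. Parameter `13` bounds the
dividend, hence the number of rounds needed. -/
theorem eval_divP (hj : 0 < π j) (ha : eval π bk a ρ ≤ π 13) :
    eval π bk (divP a j) ρ = eval π bk a ρ / π j := by
  have key : ∀ n, iter n (fun i x => eval π bk (ite (lt (weak 2 a)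
      (mulP (add (var 0) (num 1)) j)) (var 0) (add (var 0) (num 1))) (x :: i :: ρ)) 0 =
      min n (eval π bk a ρ / π j) := by
    intro n
    induction n with
    | zero => simp [iter]
    | succ n ih =>
      rw [iter, ih]
      set d := eval π bk a ρ / π j with hd
      by_cases h : tr π bk (lt (weak 2 a) (mulP (add (var 0) (num 1)) j)) (min n d :: n :: ρ)
      · rw [eval_of_tr h]
        simp only [tr_lt, eval_weak, eval_mulP, eval_add, eval_var, eval_num, List.drop_succ_cons,
          List.drop_zero, List.getD_cons_zero] at h ⊢
        have h1 := Nat.div_lt_of_lt_mul (mul_comm (π j) _ ▸ h)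
        omega
      · rw [eval_of_not_tr h]
        simp only [tr_lt, eval_weak, eval_mulP, eval_add, eval_var, eval_num, List.drop_succ_cons,
          List.drop_zero, List.getD_cons_zero, not_lt] at h ⊢
        have h1 := (Nat.le_div_iff_mul_le hj).2 h
        omega
  rw [divP, eval, eval_num, key]
  exact min_eq_right ((Nat.div_le_self _ _).trans ha)

theorem eval_modP (hj : 0 < π j) (ha : eval π bk a ρ ≤ π 13) :
    eval π bk (modP a j) ρ = eval π bk a ρ % π j := by
  rw [modP, eval, eval_mulP, eval_divP hj ha]
  have := Nat.div_add_mod' (eval π bk a ρ) (π j)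
  omega

theorem eval_digit (hj : 1 < π j) (ha : eval π bk a ρ ≤ π 13) :
    eval π bk (digit j a b) ρ = eval π bk a ρ / π j ^ (eval π bk b ρ) % π j := by
  set s := eval π bk a ρ with hs
  set i := eval π bk b ρ with hi
  have key : ∀ n, iter n (fun i x => eval π bk (ite (lt (var 1) (weak 2 b)) (divP (var 0) j)
      (var 0)) (x :: i :: ρ)) s = s / π j ^ min n i := by
    intro n
    induction n with
    | zero => simp [iter]
    | succ n ih =>
      rw [iter, ih]
      by_cases h : tr π bk (lt (var 1) (weak 2 b)) (s / π j ^ min n i :: n :: ρ)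
      · rw [eval_of_tr h, eval_divP (by omega)]
        · simp only [tr_lt, eval_var, eval_weak, List.getD_cons_succ, List.getD_cons_zero,
            List.drop_succ_cons, List.drop_zero, ← hi] at h ⊢
          rw [min_eq_left h.le, min_eq_left (by omega), Nat.div_div_eq_div_mul, pow_succ]
        · simp only [eval_var, List.getD_cons_zero]
          exact (Nat.div_le_self _ _).trans ha
      · rw [eval_of_not_tr h]
        simp only [tr_lt, eval_var, eval_weak, List.getD_cons_succ, List.getD_cons_zero,
            List.drop_succ_cons, List.drop_zero, ← hi, not_lt] at h ⊢
        rw [min_eq_right h, min_eq_right (by omega)]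
  have hval : eval π bk (fold 13 a (ite (lt (var 1) (weak 2 b)) (divP (var 0) j) (var 0))) ρ =
      s / π j ^ i := by
    rw [eval, key]
    rcases le_total i (π 13) with h | h
    · rw [min_eq_right h]
    -- The loop makes only `π 13` divisions. For a larger position this is enough: the number is at
    -- most `π 13`, less than `π j ^ π 13`, so both quotients vanish.
    · rw [min_eq_left h]
      have h1 : s < π j ^ π 13 := lt_of_le_of_lt ha (Nat.lt_pow_self hj)
      have h2 : s < π j ^ i := h1.trans_le (Nat.pow_le_pow_right (by omega) h)
      rw [Nat.div_eq_of_lt h1, Nat.div_eq_of_lt h2]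
  rw [digit, eval_modP (by omega), hval]
  rw [hval]
  exact (Nat.div_le_self _ _).trans ha

theorem tr_bit (h2 : π 11 = 2) (ha : eval π bk a ρ ≤ π 13) :
    tr π bk (bit a b) ρ ↔ (eval π bk a ρ).testBit (eval π bk b ρ) = true := by
  rw [tr, bit, eval_digit (by omega) ha, h2, Nat.testBit_eq_decide_div_mod_eq]
  simp

theorem eval_powP {i : Fin 16} : eval π bk (powP j i) ρ = π j ^ π i := by
  rw [powP, eval]
  induction π i with
  | zero => simp [iter]
  | succ n ih => rw [iter, ih, eval_mulP]; simp [pow_succ]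

theorem eval_pow2 (ha : eval π bk a ρ ≤ π 7) : eval π bk (pow2 a) ρ = 2 ^ eval π bk a ρ := by
  have key : ∀ n, iter n (fun i x => eval π bk (ite (lt (var 1) (weak 2 a))
      (add (var 0) (var 0)) (var 0)) (x :: i :: ρ)) 1 = 2 ^ min n (eval π bk a ρ) := by
    intro n
    induction n with
    | zero => simp [iter]
    | succ n ih =>
      rw [iter, ih]
      by_cases h : tr π bk (lt (var 1) (weak 2 a)) (2 ^ min n (eval π bk a ρ) :: n :: ρ)
      · rw [eval_of_tr h]
        simp only [tr_lt, eval_var, eval_weak, List.getD_cons_succ, List.getD_cons_zero,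
            List.drop_succ_cons, List.drop_zero, eval_add] at h ⊢
        rw [min_eq_left h.le, min_eq_left (by omega), pow_succ]
        ring
      · rw [eval_of_not_tr h]
        simp only [tr_lt, eval_var, eval_weak, List.getD_cons_succ, List.getD_cons_zero,
            List.drop_succ_cons, List.drop_zero, not_lt] at h ⊢
        rw [min_eq_right h, min_eq_right (by omega)]
  rw [pow2, eval, eval_num, key, min_eq_right ha]

open Classical in
theorem eval_mkset {P : ℕ → Prop} (hP : ∀ i < π 7, tr π bk b (i :: ρ) ↔ P i) :
    eval π bk (mkset b) ρ = numSet ((Finset.range (π 7)).filter P) := by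
  have key : ∀ n ≤ π 7, iter n (fun i x => eval π bk (ite (weak 1 b)
      (add (var 0) (pow2 (var 1))) (var 0)) (x :: i :: ρ)) 0 =
      numSet ((Finset.range n).filter P) := by
    intro n
    induction n with
    | zero => simp [iter, numSet]
    | succ n ih =>
      intro hn
      rw [iter, ih (by omega), Finset.range_add_one, Finset.filter_insert]
      set x := numSet ((Finset.range n).filter P) with hx
      have hiff : tr π bk (weak 1 b) (x :: n :: ρ) ↔ P n := hP n (by omega)
      by_cases h : P n
      · rw [if_pos h, eval_of_tr (hiff.2 h), eval_add, eval_pow2 (by simp; omega), numSet,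
          Finset.sum_insert (by simp)]
        simp [hx, numSet, add_comm]
      · rw [if_neg h, eval_of_not_tr (hiff.not.2 h)]
        simp [hx]
  rw [mkset, eval, eval_num, key _ le_rfl]

theorem eval_find {P : ℕ → Prop} (hP : ∀ i < π j, tr π bk b (i :: ρ) ↔ P i) {k : ℕ}
    (hk : k < π j) (hPk : P k) (hu : ∀ i < π j, P i → i = k) :
    eval π bk (find j b) ρ = k := by
  have key : ∀ n ≤ π j, iter n (fun i x => eval π bk (ite (weak 1 b) (var 1) (var 0))
      (x :: i :: ρ)) 0 = if k < n then k else 0 := by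
    intro n
    induction n with
    | zero => simp [iter]
    | succ n ih =>
      intro hn
      rw [iter, ih (by omega)]
      set x := if k < n then k else 0 with hx
      have hiff : tr π bk (weak 1 b) (x :: n :: ρ) ↔ P n := hP n (by omega)
      by_cases h : P n
      · rw [eval_of_tr (hiff.2 h)]
        obtain rfl := hu n (by omega) h
        simp
      · rw [eval_of_not_tr (hiff.not.2 h)]
        have : k ≠ n := fun h' => h (h' ▸ hPk)
        simp only [eval_var, List.getD_cons_zero, hx]
        split_ifs <;> omega
  rw [find, eval, eval_num, key _ le_rfl, if_pos hk]

open Classical in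
theorem eval_count {P : ℕ → Prop} (hP : ∀ i < π j, tr π bk b (i :: ρ) ↔ P i) :
    eval π bk (count j b) ρ = ((List.range (π j)).filter P).length := by
  have key : ∀ n ≤ π j, iter n (fun i x => eval π bk (ite (weak 1 b) (add (var 0) (num 1)) (var 0))
      (x :: i :: ρ)) 0 = ((List.range n).filter P).length := by
    intro n
    induction n with
    | zero => simp [iter]
    | succ n ih =>
      intro hn
      rw [iter, ih (by omega), List.range_succ, List.filter_append]
      set x := ((List.range n).filter P).length with hx
      have hiff : tr π bk (weak 1 b) (x :: n :: ρ) ↔ P n := hP n (by omega)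
      by_cases h : P n
      · rw [eval_of_tr (hiff.2 h)]
        simp [h, hx]
      · rw [eval_of_not_tr (hiff.not.2 h)]
        simp [h, hx]
  rw [count, eval, eval_num, key _ le_rfl]

end

end Ex

end SecondOrder


namespace SecondOrder

/-! ## Local conditions on numbers of layers -/

/-- The local properties of the layers of canonical diagrams, in terms of bits. -/
structure GoodNum (n w ℓ : ℕ) : Prop where
  left_init : ℓ.testBit (w * n * w + w + w + w + w + 1) = true → ∀ p < w,
    ℓ.testBit (w * n * w + w + w + w + p) = true → ℓ.testBit (w * n * w + w + p) = true
  left_single : ℓ.testBit (w * n * w + w + w + w + w + 1) = true → ∃ p < w,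
    ℓ.testBit (w * n * w + w + w + w + p) = true ∧
      ∀ p' < w, ℓ.testBit (w * n * w + w + w + w + p') = true → p' = p
  det : ∀ p < w, ∀ a < n, ∀ q < w, ∀ q' < w, ℓ.testBit (tpos n w p a q) = true →
    ℓ.testBit (tpos n w p a q') = true → q = q'
  complete : ∀ p < w, ℓ.testBit (w * n * w + w + w + w + p) = true → ∀ a < n, ∃ q < w,
    ℓ.testBit (tpos n w p a q) = true
  reach : ∀ q < w, ℓ.testBit (w * n * w + w + w + q) = true → ∃ p < w, ∃ a < n,
    ℓ.testBit (tpos n w p a q) = true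
  order : ∀ q < w, ∀ q' < w, q < q' → ℓ.testBit (w * n * w + w + w + q) = true →
    ℓ.testBit (w * n * w + w + w + q') = true →
    ∃ p < w, ∃ a < n, ℓ.testBit (tpos n w p a q) = true ∧ ∀ p' < w, ∀ a' < n,
      ℓ.testBit (tpos n w p' a' q') = true → p < p' ∨ p = p' ∧ a < a'
  left_down : ∀ p < w, ℓ.testBit (w * n * w + w + w + w + p) = true → ∀ p' < w, p' < p →
    ℓ.testBit (w * n * w + w + w + w + p') = true
  left_pos : ∃ p < w, ℓ.testBit (w * n * w + w + w + w + p) = true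
  right_down : ∀ p < w, ℓ.testBit (w * n * w + w + w + p) = true → ∀ p' < w, p' < p →
    ℓ.testBit (w * n * w + w + w + p') = true
  right_pos : ∃ p < w, ℓ.testBit (w * n * w + w + w + p) = true
  rows : ∀ p < w, ∀ p' < w, ℓ.testBit (w * n * w + w + w + w + p) = true →
    ℓ.testBit (w * n * w + w + w + w + p') = true →
    (∀ a < n, ∀ q < w, ℓ.testBit (tpos n w p a q) = true → ℓ.testBit (tpos n w p' a q) = true) →
    p = p'
  fin : ℓ.testBit (w * n * w + w + w + w + w) = true → ∀ q < w, ∀ q' < w,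
    ℓ.testBit (w * n * w + w + w + q) = true → ℓ.testBit (w * n * w + w + w + q') = true →
    (ℓ.testBit (w * n * w + q) = true ↔ ℓ.testBit (w * n * w + q') = true) → q = q'

theorem forall_idx {α : Type u} [LinearOrder α] [Fintype α] {P : ℕ → Prop} :
    (∀ i < Fintype.card α, P i) ↔ ∀ a : α, P (idx a) :=
  ⟨fun h a => h _ (idx_lt a), fun h i hi => by
    obtain ⟨a, rfl⟩ := exists_idx_eq hi
    exact h a⟩

theorem eq_range_of_down {s : Finset ℕ} (hp : s.Nonempty)
    (hd : ∀ p ∈ s, ∀ p' < p, p' ∈ s) : ∃ a, 0 < a ∧ s = Finset.range a := by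
  refine ⟨s.max' hp + 1, by omega, Finset.ext fun x => ?_⟩
  rw [Finset.mem_range]
  constructor
  · intro hx
    have := s.le_max' x hx
    omega
  · intro hx
    rcases (Nat.lt_succ_iff.1 hx).eq_or_lt with rfl | h
    · exact s.max'_mem hp
    · exact hd _ (s.max'_mem hp) _ h

/-- Most clauses are direct translations. Intervals are expressed as nonempty downward closed sets,
and the function `ν` of least incoming pairs is eliminated: for `q < q'`, the clause `order` asks
for a transition into `q` preceding all transitions into `q'`, which compares the two minima. -/
theorem goodNum_iff {α : Type u} [LinearOrder α] [Fintype α] {w ℓ : ℕ} {l : Layer α}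
    (hl : l.WidthLE w) (hc : l.Codes w ℓ) : GoodNum (Fintype.card α) w ℓ ↔ l.Good := by
  have hL : ∀ p ∈ l.left, p < w := fun p hp => Finset.mem_range.1 (hl.1 hp)
  have hR : ∀ p ∈ l.right, p < w := fun p hp => Finset.mem_range.1 (hl.2 hp)
  have bL : ∀ p, p ∈ l.left → _ := fun p hp => (hc.left p (hL p hp)).2 hp
  have bR : ∀ p, p ∈ l.right → _ := fun p hp => (hc.right p (hR p hp)).2 hp
  have bT : ∀ p a q, (p, a, q) ∈ l.trans → _ := fun p a q h =>
    (hc.trans p (hL p (l.trans_mem _ h).1) a q (hR q (l.trans_mem _ h).2)).2 h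
  constructor
  · intro h
    have hdet : ∀ p ∈ l.left, ∀ a : α, ∀ q ∈ l.right, ∀ q' ∈ l.right,
        (p, a, q) ∈ l.trans → (p, a, q') ∈ l.trans → q = q' := fun p hp a q hq q' hq' h1 h2 =>
      h.det p (hL p hp) (idx a) (idx_lt a) q (hR q hq) q' (hR q' hq') (bT _ _ _ h1) (bT _ _ _ h2)
    have hdet' : l.Deterministic := by
      refine ⟨fun hi => ⟨?_, ?_⟩, hdet⟩
      · refine l.init_subset.antisymm fun p hp => ?_
        exact (hc.init p (hL p hp)).1 (h.left_init (hc.initFlag.trans hi) p (hL p hp) (bL p hp))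
      · obtain ⟨p, hp, h1, h2⟩ := h.left_single (hc.initFlag.trans hi)
        rw [Finset.card_eq_one]
        refine ⟨p, Finset.eq_singleton_iff_unique_mem.2 ⟨(hc.left p hp).1 h1, fun x hx => ?_⟩⟩
        exact h2 x (hL x hx) (bL x hx)
    have hreach : ∀ q ∈ l.right, ∃ a : α, ∃ p ∈ l.left, (p, a, q) ∈ l.trans := by
      intro q hq
      obtain ⟨p, hp, a, ha, h1⟩ := h.reach q (hR q hq) (bR q hq)
      obtain ⟨a, rfl⟩ := exists_idx_eq ha
      have := (hc.trans p hp a q (hR q hq)).1 h1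
      exact ⟨a, p, (l.trans_mem _ this).1, this⟩
    have hleast : ∀ q : ℕ, ∃ x : ℕ ×ₗ α, q ∈ l.right →
        IsLeast {x : ℕ ×ₗ α | ((ofLex x).1, (ofLex x).2, q) ∈ l.trans} x := by
      intro q
      by_cases hq : q ∈ l.right
      · obtain ⟨a, p, hp, h1⟩ := hreach q hq
        have hfin : {x : ℕ ×ₗ α | ((ofLex x).1, (ofLex x).2, q) ∈ l.trans}.Finite := by
          refine Set.Finite.subset (Set.Finite.image (fun t : ℕ × α × ℕ => toLex (t.1, t.2.1))
            l.trans.finite_toSet) ?_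
          intro x hx
          exact ⟨_, hx, rfl⟩
        obtain ⟨x, hx⟩ := hfin.exists_minimal ⟨toLex (p, a), h1⟩
        exact ⟨x, fun _ => ⟨hx.1, fun y hy => not_lt.1 fun hlt => hx.not_lt hy hlt⟩⟩
      -- Outside the right states `ν` needs some arbitrary value; the alphabet is not assumed
      -- nonempty here, so a symbol is taken from a transition into an existing right state.
      · obtain ⟨p, hp, h1⟩ := h.right_pos
        obtain ⟨a, -⟩ := hreach p ((hc.right p hp).1 h1)
        exact ⟨toLex (0, a), fun h => (hq h).elim⟩
    choose ν hν using hleast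
    have hlt : ∀ q ∈ l.right, ∀ q' ∈ l.right, q < q' → ν q < ν q' := by
      intro q hq q' hq' hqq
      obtain ⟨p, hp, a, ha, h1, h2⟩ := h.order q (hR q hq) q' (hR q' hq') hqq (bR q hq) (bR q' hq')
      obtain ⟨a, rfl⟩ := exists_idx_eq ha
      have h3 : ν q ≤ toLex (p, a) := (hν q hq).2 ((hc.trans p hp a q (hR q hq)).1 h1)
      refine h3.trans_lt ?_
      have h4 := (hν q' hq').1
      have := h2 _ (hL _ (l.trans_mem _ h4).1) _ (idx_lt _) (bT _ _ _ h4)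
      rw [Prod.Lex.lt_iff]
      simpa [idx_lt_idx] using this
    refine ⟨hdet', ⟨fun hi => ?_, ?_⟩, ⟨⟨hreach, hdet', ν, hν, fun q hq q' hq' => ⟨hlt q hq q' hq',
      fun h1 => ?_⟩⟩, ?_⟩, ?_, ?_⟩
    · obtain ⟨p, hp, h1, -⟩ := h.left_single (hc.initFlag.trans hi)
      have := (hc.init p hp).1 (h.left_init (hc.initFlag.trans hi) p hp h1)
      exact Finset.ne_empty_of_mem this
    · intro p hp a
      obtain ⟨q, hq, h1⟩ := h.complete p (hL p hp) (bL p hp) (idx a) (idx_lt a)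
      have := (hc.trans p (hL p hp) a q hq).1 h1
      exact ⟨q, (l.trans_mem _ this).2, this⟩
    · rcases lt_trichotomy q q' with h2 | rfl | h2
      · exact h2
      · exact (lt_irrefl _ h1).elim
      · exact (lt_asymm h1 (hlt q' hq' q hq h2)).elim
    · obtain ⟨p, hp, h1⟩ := h.left_pos
      obtain ⟨q, hq, h2⟩ := h.right_pos
      obtain ⟨a, ha, ea⟩ := eq_range_of_down ⟨p, (hc.left p hp).1 h1⟩ fun p hp p' hp' =>
        (hc.left p' (by have := hL p hp; omega)).1
          (h.left_down p (hL p hp) (bL p hp) p' (by have := hL p hp; omega) hp')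
      obtain ⟨b, hb, eb⟩ := eq_range_of_down ⟨q, (hc.right q hq).1 h2⟩ fun p hp p' hp' =>
        (hc.right p' (by have := hR p hp; omega)).1
          (h.right_down p (hR p hp) (bR p hp) p' (by have := hR p hp; omega) hp')
      exact ⟨a, b, ha, hb, ea, eb⟩
    · intro p hp p' hp' h1
      refine h.rows p (hL p hp) p' (hL p' hp') (bL p hp) (bL p' hp') ?_
      refine forall_idx.2 fun a q hq h2 => bT _ _ _ (h1 a q ?_)
      exact (hc.trans p (hL p hp) a q hq).1 h2
    · intro hf q hq q' hq' h1
      refine h.fin (hc.finalFlag.trans hf) q (hR q hq) q' (hR q' hq') (bR q hq) (bR q' hq') ?_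
      rw [hc.final q (hR q hq), hc.final q' (hR q' hq'), h1]
  · intro h
    obtain ⟨⟨hreach, -, ν, hν, hlt⟩, a, b, ha, hb, ea, eb⟩ := h.normalized
    refine ⟨fun hi p hp h1 => ?_, fun hi => ?_, fun p hp => ?_, fun p hp h1 => ?_,
      fun q hq h1 => ?_, fun q hq q' hq' hqq h1 h2 => ?_, fun p hp h1 p' hp' hpp => ?_, ?_,
      fun p hp h1 p' hp' hpp => ?_, ?_, fun p hp p' hp' h1 h2 h3 => ?_,
      fun hf q hq q' hq' h1 h2 h3 => ?_⟩
    · rw [hc.init p hp, (h.det.1 (hc.initFlag.symm.trans hi)).1]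
      exact (hc.left p hp).1 h1
    · obtain ⟨p, hp⟩ := Finset.card_eq_one.1 (h.det.1 (hc.initFlag.symm.trans hi)).2
      have hpl : p ∈ l.left := by rw [hp]; simp
      refine ⟨p, hL p hpl, bL p hpl, fun p' hp' h1 => ?_⟩
      have := (hc.left p' hp').1 h1
      rwa [hp, Finset.mem_singleton] at this
    · refine forall_idx.2 fun a q hq q' hq' h1 h2 => ?_
      have h1 := (hc.trans p hp a q hq).1 h1
      have h2 := (hc.trans p hp a q' hq').1 h2
      exact h.det.2 p (l.trans_mem _ h1).1 a q (l.trans_mem _ h1).2 q' (l.trans_mem _ h2).2 h1 h2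
    · refine forall_idx.2 fun a => ?_
      obtain ⟨q, hq, h2⟩ := h.complete.2 p ((hc.left p hp).1 h1) a
      exact ⟨q, hR q hq, bT _ _ _ h2⟩
    · obtain ⟨a, p, hp, h2⟩ := hreach q ((hc.right q hq).1 h1)
      exact ⟨p, hL p hp, idx a, idx_lt a, bT _ _ _ h2⟩
    · have hq1 := (hc.right q hq).1 h1
      have hq2 := (hc.right q' hq').1 h2
      have h3 := (hν q hq1).1
      refine ⟨_, hL _ (l.trans_mem _ h3).1, _, idx_lt (ofLex (ν q)).2, bT _ _ _ h3, ?_⟩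
      intro p' hp'
      refine forall_idx.2 fun a' h4 => ?_
      have h5 := (hν q' hq2).2 (show toLex (p', a') ∈ _ from (hc.trans p' hp' a' q' hq').1 h4)
      have h6 := ((hlt q hq1 q' hq2).1 hqq).trans_le h5
      rw [Prod.Lex.lt_iff] at h6
      simpa [idx_lt_idx] using h6
    · have := (hc.left p hp).1 h1
      rw [ea, Finset.mem_range] at this
      rw [hc.left p' hp', ea, Finset.mem_range]
      omega
    · exact ⟨0, hL 0 (by rw [ea]; simpa using ha), bL 0 (by rw [ea]; simpa using ha)⟩
    · have := (hc.right p hp).1 h1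
      rw [eb, Finset.mem_range] at this
      rw [hc.right p' hp', eb, Finset.mem_range]
      omega
    · exact ⟨0, hR 0 (by rw [eb]; simpa using hb), bR 0 (by rw [eb]; simpa using hb)⟩
    · refine h.rows p ((hc.left p hp).1 h1) p' ((hc.left p' hp').1 h2) fun a q h4 => ?_
      have hq := hR q (l.trans_mem _ h4).2
      exact (hc.trans p' hp' a q hq).1 (h3 _ (idx_lt a) q hq (bT _ _ _ h4))
    · refine h.fin (hc.finalFlag.symm.trans hf) q ((hc.right q hq).1 h1) q' ((hc.right q' hq').1 h2)
        ?_
      rw [← hc.final q hq, ← hc.final q' hq', h3]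

/-- The numbers from `c` on contain the code of a layer. -/
structure InCodes {α : Type u} [LinearOrder α] [Fintype α] (w : ℕ) (X : ℕ → ℕ) (c : ℕ)
    (l : Layer α) : Prop where
  initFlag : X c ≠ 0 ↔ l.initFlag = true
  finalFlag : X (c + 1) ≠ 0 ↔ l.finalFlag = true
  init : ∀ p < w, (X (c + 2 + w + w + p) ≠ 0 ↔ p ∈ l.init)
  final : ∀ p < w, (X (c + 2 + w + w + w + p) ≠ 0 ↔ p ∈ l.final)
  trans : ∀ p < w, ∀ a : α, ∀ q < w,
    (X (c + 2 + w + w + w + w + tpos (Fintype.card α) w p (idx a) q) ≠ 0 ↔ (p, a, q) ∈ l.trans)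

/-- `Compat` for layers given by numbers. -/
structure CompatNum (n w : ℕ) (X : ℕ → ℕ) (c ℓ : ℕ) (h h' : ℕ → ℕ) : Prop where
  initFlag : X c ≠ 0 ↔ ℓ.testBit (w * n * w + w + w + w + w + 1) = true
  finalFlag : X (c + 1) ≠ 0 ↔ ℓ.testBit (w * n * w + w + w + w + w) = true
  good : GoodNum n w ℓ
  left : ∀ x < w, (ℓ.testBit (w * n * w + w + w + w + x) = true ↔ ∃ p < w, h p = x)
  right : ∀ x < w, (ℓ.testBit (w * n * w + w + w + x) = true ↔ ∃ p < w, h' p = x)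
  trans : ∀ p < w, ∀ a < n, ∀ q < w, X (c + 2 + w + w + w + w + tpos n w p a q) ≠ 0 → h p < w →
    h' q < w ∧ ℓ.testBit (tpos n w (h p) a (h' q)) = true
  init : X c ≠ 0 → ∀ p < w, X (c + 2 + w + w + p) ≠ 0 → h p < w
  final : X (c + 1) ≠ 0 → ∀ q < w, h' q < w →
    (X (c + 2 + w + w + w + q) ≠ 0 ↔ ℓ.testBit (w * n * w + h' q) = true)

/-- The left and right states of `B` do not enter `Compat`, which is why `InCodes` skips their part
of the code. -/
theorem compatNum_iff {α : Type u} [LinearOrder α] [Fintype α] {w : ℕ} {X : ℕ → ℕ} {c ℓ : ℕ}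
    {B E : Layer α} (hB : InCodes w X c B) (hE : E.WidthLE w) (hc : E.Codes w ℓ) (h h' : ℕ → ℕ) :
    CompatNum (Fintype.card α) w X c ℓ h h' ↔ Compat w B E h h' := by
  constructor
  · rintro ⟨h1, h2, h3, h4, h5, h6, h7, h8⟩
    refine ⟨?_, ?_, (goodNum_iff hE hc).1 h3, fun x => ?_, fun x => ?_, fun p hp a q hq ht hh => ?_,
      fun hi p hp hp' => h7 (hB.initFlag.2 hi) p hp ((hB.init p hp).2 hp'),
      fun hf q hq hh => ?_⟩
    · rw [Bool.eq_iff_iff, ← hB.initFlag, h1, hc.initFlag]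
    · rw [Bool.eq_iff_iff, ← hB.finalFlag, h2, hc.finalFlag]
    · by_cases hx : x < w
      · rw [← h4 x hx, hc.left x hx]; simp [hx]
      · simp only [hx, false_and, iff_false]
        exact fun hx' => hx (Finset.mem_range.1 (hE.1 hx'))
    · by_cases hx : x < w
      · rw [← h5 x hx, hc.right x hx]; simp [hx]
      · simp only [hx, false_and, iff_false]
        exact fun hx' => hx (Finset.mem_range.1 (hE.2 hx'))
    · obtain ⟨e1, e2⟩ := h6 p hp _ (idx_lt a) q hq ((hB.trans p hp a q hq).2 ht) hh
      exact ⟨e1, (hc.trans _ hh a _ e1).1 e2⟩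
    · rw [← hB.final q hq, h8 (hB.finalFlag.2 hf) q hq hh, hc.final _ hh]
  · rintro ⟨h1, h2, h3, h4, h5, h6, h7, h8⟩
    refine ⟨?_, ?_, (goodNum_iff hE hc).2 h3, fun x hx => ?_, fun x hx => ?_, fun p hp => ?_,
      fun hi p hp hp' => h7 (hB.initFlag.1 hi) p hp ((hB.init p hp).1 hp'),
      fun hf q hq hh => ?_⟩
    · rw [hB.initFlag, hc.initFlag, h1]
    · rw [hB.finalFlag, hc.finalFlag, h2]
    · rw [hc.left x hx, h4]; simp [hx]
    · rw [hc.right x hx, h5]; simp [hx]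
    · refine forall_idx.2 fun a q hq ht hh => ?_
      obtain ⟨e1, e2⟩ := h6 p hp a q hq ((hB.trans p hp a q hq).1 ht) hh
      exact ⟨e1, (hc.trans _ hh a _ e1).2 e2⟩
    · rw [hB.final q hq, h8 (hB.finalFlag.1 hf) q hq hh, hc.final _ hh]

/-! ## Partial functions as numbers -/

/-- The partial function on `{0, …, w - 1}` with code `x`, in base `w + 1`. -/
def dig (w x p : ℕ) : ℕ := x / (w + 1) ^ p % (w + 1)

/-- The digit `w` stands for undefined, so cutting values off at `w` loses nothing that `PEq` can
see. -/
theorem exists_dig (w : ℕ) (h : ℕ → ℕ) : ∃ x < (w + 1) ^ w, ∀ p < w, dig w x p = min (h p) w := by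
  suffices H : ∀ m : ℕ, ∃ x < (w + 1) ^ m, ∀ p < m, dig w x p = min (h p) w from H w
  intro m
  induction m with
  | zero => exact ⟨0, by simp, by simp⟩
  | succ m ih =>
    obtain ⟨x, hx, hp⟩ := ih
    have hb : min (h m) w < w + 1 := by omega
    refine ⟨x + (w + 1) ^ m * min (h m) w, ?_, fun p hpm => ?_⟩
    · rw [pow_succ]
      have : (w + 1) ^ m * min (h m) w + (w + 1) ^ m ≤ (w + 1) ^ m * (w + 1) := by
        rw [← Nat.mul_succ]
        exact Nat.mul_le_mul le_rfl hb
      omega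
    · rcases (Nat.lt_succ_iff.1 hpm).eq_or_lt with rfl | hpm
      · rw [dig, Nat.add_mul_div_left _ _ (by positivity), Nat.div_eq_of_lt hx, zero_add,
          Nat.mod_eq_of_lt hb]
      · rw [← hp p hpm, dig, dig]
        -- This shows the new leading digit to contribute a multiple of `(w + 1) ^ (p + 1)`, which
        -- does not change digit `p`.
        obtain ⟨k, rfl⟩ : ∃ k, m = p + 1 + k := ⟨m - p - 1, by omega⟩
        rw [show (w + 1) ^ (p + 1 + k) * min (h (p + 1 + k)) w =
          (w + 1) ^ p * ((w + 1) * ((w + 1) ^ k * min (h (p + 1 + k)) w)) by ring,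
          Nat.add_mul_div_left _ _ (by positivity), Nat.add_mul_mod_self_left]

/-- Equality of partial functions: values that are at least `w` mean undefined. -/
def PEq (w : ℕ) (h g : ℕ → ℕ) : Prop := ∀ p < w, h p = g p ∨ w ≤ h p ∧ w ≤ g p

theorem PEq.lt_iff {w : ℕ} {h g : ℕ → ℕ} (e : PEq w h g) {p : ℕ} (hp : p < w) :
    h p < w ↔ g p < w := by
  have := e p hp
  omega

theorem PEq.eq {w : ℕ} {h g : ℕ → ℕ} (e : PEq w h g) {p : ℕ} (hp : p < w) (hh : h p < w) :
    g p = h p := by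
  have := e p hp
  omega

theorem PEq.symm {w : ℕ} {h g : ℕ → ℕ} (e : PEq w h g) : PEq w g h := fun p hp => by
  have := e p hp
  omega

theorem peq_dig {w : ℕ} {x : ℕ} {h : ℕ → ℕ} (hx : ∀ p < w, dig w x p = min (h p) w) :
    PEq w h (dig w x) := fun p hp => by
  have := hx p hp
  omega

theorem Compat.congr {α : Type u} [LinearOrder α] {w : ℕ} {B E : Layer α} {h h' g g' : ℕ → ℕ}
    (e : PEq w h g) (e' : PEq w h' g') (hc : Compat w B E h h') : Compat w B E g g' := by
  obtain ⟨h1, h2, h3, h4, h5, h6, h7, h8⟩ := hc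
  have key : ∀ {h g : ℕ → ℕ}, PEq w h g → ∀ x < w, (∃ p < w, h p = x) ↔ ∃ p < w, g p = x := by
    intro h g e x hx
    constructor <;> rintro ⟨p, hp, rfl⟩
    · exact ⟨p, hp, e.eq hp hx⟩
    · exact ⟨p, hp, e.symm.eq hp hx⟩
  refine ⟨h1, h2, h3, fun x => ?_, fun x => ?_, fun p hp a q hq ht hh => ?_, fun hi p hp hp' => ?_,
    fun hf q hq hh => ?_⟩
  · rw [h4]
    exact and_congr_right fun hx => key e x hx
  · rw [h5]
    exact and_congr_right fun hx => key e' x hx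
  · obtain ⟨e1, e2⟩ := h6 p hp a q hq ht ((e.lt_iff hp).2 hh)
    rw [e.eq hp ((e.lt_iff hp).2 hh), e'.eq hq e1]
    exact ⟨e1, e2⟩
  · exact (e.lt_iff hp).1 (h7 hi p hp hp')
  · rw [e'.eq hq ((e'.lt_iff hq).2 hh)]
    exact h8 hf q hq ((e'.lt_iff hq).2 hh)

theorem HomRun.congr {α : Type u} [LinearOrder α] {w : ℕ} {D E : List (Layer α)} {h g : ℕ → ℕ}
    (e : PEq w h g) (hr : HomRun w D E h) : HomRun w D E g := by
  match D, E, hr with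
  | [], [], _ => trivial
  | B :: D, F :: E, ⟨h', hc, hr⟩ => exact ⟨h', hc.congr e fun _ _ => .inl rfl, hr⟩

/-- Makes the guess of the next map finite: there are `(w + 1) ^ w` codes, and `HomRun` depends on a
map only up to `PEq`. -/
theorem homRun_cons {α : Type u} [LinearOrder α] {w : ℕ} {D Es : List (Layer α)} {B E : Layer α}
    {h : ℕ → ℕ} : HomRun w (B :: D) (E :: Es) h ↔
      ∃ x < (w + 1) ^ w, Compat w B E h (dig w x) ∧ HomRun w D Es (dig w x) := by
  constructor
  · rintro ⟨h', hc, hr⟩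
    obtain ⟨x, hx, he⟩ := exists_dig w h'
    exact ⟨x, hx, hc.congr (fun _ _ => .inl rfl) (peq_dig he), hr.congr (peq_dig he)⟩
  · rintro ⟨x, -, hc, hr⟩
    exact ⟨_, hc, hr⟩

theorem exists_homRun_dig {α : Type u} [LinearOrder α] {w : ℕ} {D E : List (Layer α)} :
    (∃ h, HomRun w D E h) ↔ ∃ x < (w + 1) ^ w, HomRun w D E (dig w x) := by
  constructor
  · rintro ⟨h, hr⟩
    obtain ⟨x, hx, he⟩ := exists_dig w h
    exact ⟨x, hx, hr.congr (peq_dig he)⟩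
  · rintro ⟨x, -, hr⟩
    exact ⟨_, hr⟩

end SecondOrder


namespace SecondOrder

/-! ## The power automaton of a relation, with sets of states as binary numbers -/

section Power

open Classical in
/-- The set of the `i < N` satisfying `P`, as a binary number. -/
noncomputable def pset (N : ℕ) (P : ℕ → Prop) : ℕ := numSet ((Finset.range N).filter P)

theorem testBit_pset {N : ℕ} {P : ℕ → Prop} {i : ℕ} :
    (pset N P).testBit i = true ↔ i < N ∧ P i := by
  rw [pset, testBit_numSet]
  simp

theorem pset_lt (N : ℕ) (P : ℕ → Prop) : pset N P < 2 ^ N := numSet_lt (by simp +contextual)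

def Meets (N s X : ℕ) : Prop := ∃ u < N, s.testBit u = true ∧ X.testBit u = true

noncomputable def post (N : ℕ) (Δ : ℕ → ℕ → ℕ → Prop) (s ℓ : ℕ) : ℕ :=
  pset N fun v => ∃ u < N, s.testBit u = true ∧ Δ u ℓ v

noncomputable def preim (N : ℕ) (Δ : ℕ → ℕ → ℕ → Prop) (X ℓ : ℕ) : ℕ :=
  pset N fun u => ∃ v < N, X.testBit v = true ∧ Δ u ℓ v

/-- Forward and backward images along a relation are adjoint with respect to meeting; a step of the
subset automaton can thus be moved to the accepting set. -/
theorem meets_post {N : ℕ} {Δ : ℕ → ℕ → ℕ → Prop} {s X ℓ : ℕ} :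
    Meets N (post N Δ s ℓ) X ↔ Meets N s (preim N Δ X ℓ) := by
  simp only [Meets, post, preim, testBit_pset]
  constructor
  · rintro ⟨v, hv, ⟨-, u, hu, h1, h2⟩, h3⟩
    exact ⟨u, hu, h1, hu, v, hv, h3, h2⟩
  · rintro ⟨u, hu, h1, -, v, hv, h3, h2⟩
    exact ⟨v, hv, ⟨hv, u, hu, h1, h2⟩, h3⟩

variable {Γ : Type u} {N : ℕ} {Δ : ℕ → ℕ → ℕ → Prop} {num : Γ → ℕ}

/-- The set of states from which `u` leads into `A`. -/
noncomputable def pull (N : ℕ) (Δ : ℕ → ℕ → ℕ → Prop) (num : Γ → ℕ) (A : ℕ) (u : List Γ) : ℕ :=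
  u.foldr (fun a X => preim N Δ X (num a)) A

theorem meets_runFrom {A : ℕ} (u : List Γ) (s : ℕ) :
    Meets N (runFrom (fun s a => post N Δ s (num a)) s u) A ↔
      Meets N s (pull N Δ num A u) := by
  induction u generalizing s with
  | nil => rfl
  | cons a u ih =>
    rw [pull, List.foldr_cons, ← meets_post]
    exact ih _

theorem pull_lt {A : ℕ} (hA : A < 2 ^ N) (u : List Γ) : pull N Δ num A u < 2 ^ N := by
  cases u with
  | nil => exact hA
  | cons a u => exact pset_lt _ _

/-- Turns Nerode equivalence into agreement on the family of all backward images of the accepting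
set, which has at most `2 ^ N` members. -/
theorem ner_iff {A : ℕ} {s t : ℕ} :
    Ner (fun s (a : Γ) => post N Δ s (num a)) (fun s => Meets N s A) s t ↔
      ∀ u, (Meets N s (pull N Δ num A u) ↔ Meets N t (pull N Δ num A u)) := by
  simp only [Ner, meets_runFrom]

/-- Pigeonhole on suffixes: in a shortest string with the given backward image, two suffixes with
the same image would allow the factor between them to be cut out. -/
theorem exists_short_pull {A : ℕ} (hA : A < 2 ^ N) (u : List Γ) :
    ∃ v : List Γ, v.length < 2 ^ N ∧ pull N Δ num A v = pull N Δ num A u := by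
  classical
  have hex : ∃ k, ∃ v : List Γ, v.length = k ∧ pull N Δ num A v = pull N Δ num A u :=
    ⟨_, u, rfl, rfl⟩
  obtain ⟨v, hv, he⟩ := Nat.find_spec hex
  refine ⟨v, ?_, he⟩
  by_contra hlen
  have hmaps : ∀ i ∈ Finset.range (v.length + 1), pull N Δ num A (v.drop i) ∈
      Finset.range (2 ^ N) := fun i _ => Finset.mem_range.2 (pull_lt hA _)
  have hlt : ∀ i j, i < j → j ≤ v.length → pull N Δ num A (v.drop i) ≠
      pull N Δ num A (v.drop j) := by
    intro i j hij hj heq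
    refine Nat.find_min hex (m := (v.take i ++ v.drop j).length) ?_ ⟨_, rfl, ?_⟩
    · simp only [List.length_append, List.length_take, List.length_drop]
      omega
    · rw [← he]
      conv_rhs => rw [← List.take_append_drop i v]
      simp only [pull, List.foldr_append] at heq ⊢
      rw [heq]
  obtain ⟨i, hi, j, hj, hij, heq⟩ := Finset.exists_ne_map_eq_of_card_lt_of_maps_to
    (by simp; omega) hmaps
  simp only [Finset.mem_range] at hi hj
  rcases lt_or_gt_of_ne hij with h | h
  · exact hlt i j h (by omega) heq
  · exact hlt j i h (by omega) heq.symm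

/-- One step of the search for all sets `pull u`. -/
noncomputable def markStep (N : ℕ) (Δ : ℕ → ℕ → ℕ → Prop) (valid : ℕ → Prop) (X ℓ : ℕ)
    (μ : ℕ → ℕ) : ℕ → ℕ :=
  open Classical in
  if valid ℓ ∧ μ X ≠ 0 then Function.update μ (preim N Δ X ℓ) 1 else μ

theorem markStep_ne_zero {valid : ℕ → Prop} {X ℓ : ℕ} {μ : ℕ → ℕ} {Y : ℕ} :
    markStep N Δ valid X ℓ μ Y ≠ 0 ↔ μ Y ≠ 0 ∨ valid ℓ ∧ μ X ≠ 0 ∧ Y = preim N Δ X ℓ := by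
  unfold markStep
  split_ifs with h
  · by_cases hY : Y = preim N Δ X ℓ
    · subst hY; simp [h]
    · simp [hY]
  · constructor
    · exact .inl
    · rintro (h1 | ⟨h1, h2, -⟩)
      · exact h1
      · exact (h ⟨h1, h2⟩).elim

theorem iter_mono {β : Type*} {f : ℕ → β → β} {P : β → Prop} (hf : ∀ i x, P x → P (f i x)) (n : ℕ)
    {x : β} (h : P x) : P (iter n f x) := by
  induction n with
  | zero => exact h
  | succ n ih => exact hf _ _ ih

/-- The invariant at index `i` and a property that persists hold at the end. -/
theorem iter_of_index {β : Type*} {f : ℕ → β → β} {P Q : β → Prop} (hP : ∀ i x, P x → P (f i x))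
    (hQ : ∀ i x, Q x → Q (f i x)) {n i : ℕ} (hi : i < n) {x : β} (h : P x)
    (hPQ : ∀ y, P y → Q (f i y)) : Q (iter n f x) := by
  induction n with
  | zero => omega
  | succ n ih =>
    rcases (Nat.lt_succ_iff.1 hi).eq_or_lt with rfl | hi
    · exact hPQ _ (iter_mono hP _ h)
    · exact hQ _ _ (ih hi)

/-- Saturation in `2 ^ N` rounds. After `n` rounds every backward image along a string of length at
most `n` is marked, and by `exists_short_pull` shorter strings than `2 ^ N` give all of them. Marks
set and used within the same round do no harm, since every mark is a genuine backward image. -/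
theorem mark_spec {A G : ℕ} (hA : A < 2 ^ N) {valid : ℕ → Prop}
    (hv : ∀ ℓ < G, valid ℓ ↔ ∃ a, num a = ℓ) (hG : ∀ a, num a < G) {μ : ℕ → ℕ}
    (hμ : ∀ X, μ X ≠ 0 ↔ X = A) (X : ℕ) :
    iter (2 ^ N) (fun _ => iter (2 ^ N) fun X => iter G fun ℓ => markStep N Δ valid X ℓ) μ X ≠ 0 ↔
      ∃ u, X = pull N Δ num A u := by
  have hkeep : ∀ {Y : ℕ}, ∀ (X ℓ : ℕ) (μ : ℕ → ℕ), μ Y ≠ 0 → markStep N Δ valid X ℓ μ Y ≠ 0 :=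
    fun X ℓ μ h => markStep_ne_zero.2 (.inl h)
  have hkeep1 : ∀ {Y : ℕ}, ∀ (X : ℕ) (μ : ℕ → ℕ), μ Y ≠ 0 →
      iter G (fun ℓ => markStep N Δ valid X ℓ) μ Y ≠ 0 :=
    fun X μ h => iter_mono (P := fun μ : ℕ → ℕ => μ _ ≠ 0) (hkeep X) G h
  have hkeep2 : ∀ {Y : ℕ}, ∀ (μ : ℕ → ℕ), μ Y ≠ 0 →
      iter (2 ^ N) (fun X => iter G fun ℓ => markStep N Δ valid X ℓ) μ Y ≠ 0 :=
    fun μ h => iter_mono (P := fun μ : ℕ → ℕ => μ _ ≠ 0) hkeep1 _ h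
  constructor
  · have hinv : ∀ {n : ℕ} {f : ℕ → (ℕ → ℕ) → ℕ → ℕ}, (∀ i < n, ∀ μ : ℕ → ℕ,
        (∀ X, μ X ≠ 0 → ∃ u, X = pull N Δ num A u) →
        ∀ X, f i μ X ≠ 0 → ∃ u, X = pull N Δ num A u) → ∀ μ : ℕ → ℕ,
        (∀ X, μ X ≠ 0 → ∃ u, X = pull N Δ num A u) →
        ∀ X, iter n f μ X ≠ 0 → ∃ u, X = pull N Δ num A u := by
      intro n f hf μ hμ
      induction n with
      | zero => exact hμ
      | succ n ih => exact hf n (by omega) _ (ih fun i hi => hf i (by omega))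
    refine hinv (fun _ _ => hinv fun X _ => hinv fun ℓ hℓ μ ih Y hY => ?_) μ (fun X hX => ?_) X
    · rcases markStep_ne_zero.1 hY with h | ⟨h1, h2, rfl⟩
      · exact ih Y h
      · obtain ⟨a, rfl⟩ := (hv ℓ hℓ).1 h1
        obtain ⟨u, rfl⟩ := ih X h2
        exact ⟨a :: u, rfl⟩
    · exact ⟨[], (hμ X).1 hX⟩
  · have hround : ∀ n, ∀ u : List Γ, u.length ≤ n →
        iter n (fun _ => iter (2 ^ N) fun X => iter G fun ℓ => markStep N Δ valid X ℓ) μ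
          (pull N Δ num A u) ≠ 0 := by
      intro n
      induction n with
      | zero =>
        intro u hu
        obtain rfl : u = [] := List.length_eq_zero_iff.1 (by omega)
        exact (hμ _).2 rfl
      | succ n ih =>
        intro u hu
        cases u with
        | nil => exact hkeep2 _ (ih [] (by simp))
        | cons a u =>
          have h1 := ih u (by simpa using hu)
          rw [iter]
          set μ' := iter n (fun _ => iter (2 ^ N) fun X => iter G fun ℓ =>
            markStep N Δ valid X ℓ) μ
          refine iter_of_index (P := fun μ : ℕ → ℕ => μ (pull N Δ num A u) ≠ 0)
            (Q := fun μ : ℕ → ℕ => μ (pull N Δ num A (a :: u)) ≠ 0) hkeep1 hkeep1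
            (pull_lt (Δ := Δ) (num := num) hA u) h1 ?_
          intro μ1 h2
          refine iter_of_index (P := fun μ : ℕ → ℕ => μ (pull N Δ num A u) ≠ 0)
            (Q := fun μ : ℕ → ℕ => μ (pull N Δ num A (a :: u)) ≠ 0) (hkeep _) (hkeep _) (hG a) h2 ?_
          intro μ2 h3
          exact markStep_ne_zero.2 (.inr ⟨(hv _ (hG a)).2 ⟨a, rfl⟩, h3, rfl⟩)
    rintro ⟨u, rfl⟩
    obtain ⟨v, hv, he⟩ := exists_short_pull (Δ := Δ) (num := num) hA u
    rw [← he]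
    exact hround _ v hv.le

end Power

end SecondOrder


namespace SecondOrder

/-! ## Reading the code of an automaton -/

section Read

theorem getD_append_of_length {β : Type*} {l l' : List β} {d : β} {m k : ℕ} (h : l.length = m) :
    (l ++ l').getD (m + k) d = l'.getD k d := by
  rw [List.getD_append_right _ _ _ _ (by omega), h, Nat.add_sub_cancel_left]

theorem length_flatMap_const {β γ : Type*} {f : β → List γ} {k : ℕ} :
    ∀ (l : List β), (∀ x ∈ l, (f x).length = k) → (l.flatMap f).length = l.length * k
  | [], _ => by simp
  | x :: l, h => by
    rw [List.flatMap_cons, List.length_append, h x (by simp),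
      length_flatMap_const l fun y hy => h y (by simp [hy]), List.length_cons]
    ring

theorem getD_flatMap {β γ : Type*} {f : β → List γ} {k : ℕ} {d : γ} :
    ∀ (l : List β), (∀ x ∈ l, (f x).length = k) → ∀ (i j : ℕ) (hi : i < l.length), j < k →
      (l.flatMap f).getD (i * k + j) d = (f l[i]).getD j d
  | x :: l, h, 0, j, hi, hj => by
    rw [List.flatMap_cons, Nat.zero_mul, Nat.zero_add,
      List.getD_append _ _ _ _ (by rwa [h x (by simp)])]
    rfl
  | x :: l, h, i + 1, j, hi, hj => by
    rw [List.flatMap_cons, show (i + 1) * k + j = k + (i * k + j) by ring,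
      getD_append_of_length (h x (by simp)),
      getD_flatMap l (fun y hy => h y (by simp [hy])) i j (by simpa using hi) hj]
    rfl

@[simp] theorem length_bits {β : Type*} (xs : List β) (P : β → Prop) :
    (bits xs P).length = xs.length := by simp [bits]

theorem bits_getD {β : Type*} {xs : List β} {P : β → Prop} {i : ℕ} (hi : i < xs.length) :
    (bits xs P).getD i 0 ≠ 0 ↔ P xs[i] := by
  rw [List.getD_eq_getElem _ _ (by simpa using hi)]
  simp [bits]

variable {α : Type u} [LinearOrder α] [Fintype α] {w : ℕ}

theorem length_symbols : ((Finset.univ : Finset α).sort (· ≤ ·)).length = Fintype.card α := by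
  simp

theorem getElem_symbols {i : ℕ} (hi : i < ((Finset.univ : Finset α).sort (· ≤ ·)).length)
    (a : α) (ha : idx a = i) : ((Finset.univ : Finset α).sort (· ≤ ·))[i] = a := by
  subst ha
  simp only [sort_univ_eq, List.getElem_map, List.getElem_finRange]
  exact (sym α).apply_symm_apply a

theorem length_transCode (l : Layer α) :
    ((List.range w).flatMap fun p => ((Finset.univ : Finset α).sort (· ≤ ·)).flatMap fun a =>
      bits (List.range w) fun q => (p, a, q) ∈ l.trans).length = w * Fintype.card α * w := by
  rw [length_flatMap_const (k := Fintype.card α * w), List.length_range]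
  · ring
  · intro p _
    rw [length_flatMap_const (k := w), length_symbols]
    simp

theorem length_layerCode (l : Layer α) :
    (layerCode w l).length = 2 + w + w + w + w + w * Fintype.card α * w := by
  rw [layerCode, List.length_append, length_transCode]
  simp only [List.length_append, length_bits, List.length_range, List.length_cons, List.length_nil]

theorem layerCode_inCodes {X : ℕ → ℕ} {c : ℕ} {l : Layer α}
    (h : ∀ j < 2 + w + w + w + w + w * Fintype.card α * w, X (c + j) = (layerCode w l).getD j 0) :
    InCodes w X c l := by
  refine ⟨?_, ?_, fun p hp => ?_, fun p hp => ?_, fun p hp a q hq => ?_⟩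
  · rw [← Nat.add_zero c, h 0 (by omega)]
    simp [layerCode]
  · rw [h 1 (by omega)]
    simp [layerCode]
  · rw [show c + 2 + w + w + p = c + (2 + w + w + p) by ring, h _ (by omega), layerCode,
      List.getD_append _ _ _ _ (by simp; omega), List.getD_append _ _ _ _ (by simp; omega),
      getD_append_of_length (by simp; omega), bits_getD (by simpa using hp)]
    simp
  · rw [show c + 2 + w + w + w + p = c + (2 + w + w + w + p) by ring, h _ (by omega), layerCode,
      List.getD_append _ _ _ _ (by simp; omega),
      getD_append_of_length (by simp; omega), bits_getD (by simpa using hp)]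
    simp
  · have ht := tpos_lt hp (idx_lt a) hq
    rw [show c + 2 + w + w + w + w + tpos (Fintype.card α) w p (idx a) q =
      c + (2 + w + w + w + w + tpos (Fintype.card α) w p (idx a) q) by ring, h _ (by omega),
      layerCode, getD_append_of_length (by simp; omega),
      show tpos (Fintype.card α) w p (idx a) q = p * (Fintype.card α * w) + (idx a * w + q) by
        rw [tpos]; ring, getD_flatMap (k := Fintype.card α * w) _ _ _ _ (by simpa using hp),
      getD_flatMap (k := w) _ _ _ _ (by rw [length_symbols]; exact idx_lt a) hq,
      bits_getD (by simpa using hq), getElem_symbols _ a rfl]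
    · simp
    · simp
    · calc idx a * w + q < idx a * w + w := by omega
        _ = (idx a + 1) * w := by ring
        _ ≤ _ := Nat.mul_le_mul (idx_lt a) le_rfl
    · intro p _
      rw [length_flatMap_const (k := w), length_symbols]
      simp

/-- The place of the `i`-th transition in the code of an automaton with `n` states. -/
def blockPos (n L i : ℕ) : ℕ := 4 + n + n + i * L

/-- The entries of the code of an automaton, as a function; `L` is the length of the code of a
transition. -/
structure FA.InCode (F : FA (LayerAlphabet α w)) (X : ℕ → ℕ) (T L : ℕ) : Prop where
  card : X 0 = Fintype.card α
  width : X 1 = w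
  size : X 2 = F.n
  start : ∀ p : Fin F.n, X (3 + p) ≠ 0 ↔ p ∈ F.nfa.start
  accept : ∀ p : Fin F.n, X (3 + F.n + p) ≠ 0 ↔ p ∈ F.nfa.accept
  count : X (3 + F.n + F.n) = T
  trans : ∀ i < T, ∃ p l q, q ∈ F.nfa.step p l ∧ X (blockPos F.n L i) = (p : Fin F.n) ∧
    X (blockPos F.n L i + 1) = (q : Fin F.n) ∧ InCodes w X (blockPos F.n L i + 2) l.1
  exists_trans : ∀ p l q, q ∈ F.nfa.step p l → ∃ i < T, X (blockPos F.n L i) = (p : Fin F.n) ∧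
    X (blockPos F.n L i + 1) = (q : Fin F.n) ∧ InCodes w X (blockPos F.n L i + 2) l.1

theorem length_trans_le {F : FA (LayerAlphabet α w)}
    {ts : List (Fin F.n × LayerAlphabet α w × Fin F.n)} (h : ts.Nodup) :
    ts.length ≤ F.n * (2 ^ (w * Fintype.card α * w + w + w + w + w + 2) * F.n) := by
  let f : Fin F.n × LayerAlphabet α w × Fin F.n →
      Fin F.n × Fin (2 ^ (w * Fintype.card α * w + w + w + w + w + 2)) × Fin F.n :=
    fun t => (t.1, ⟨t.2.1.1.number w, t.2.1.2.number_lt⟩, t.2.2)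
  have hf : Function.Injective f := by
    rintro ⟨p, l, q⟩ ⟨p', l', q'⟩ he
    simp only [f, Prod.mk.injEq, Fin.mk.injEq] at he
    obtain ⟨rfl, h1, rfl⟩ := he
    obtain rfl : l = l' := (number_strictMono w).injective h1
    rfl
  have := (h.map hf).length_le_card
  simpa using this

/-- The order of the list of transitions is forgotten: only which blocks occur matters. That no
block is repeated bounds their number. -/
theorem FA.IsCode.inCode {F : FA (LayerAlphabet α w)} {x : List ℕ} (h : F.IsCode x) :
    ∃ T ≤ F.n * (2 ^ (w * Fintype.card α * w + w + w + w + w + 2) * F.n),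
      F.InCode (fun i => x.getD i 0) T (w * Fintype.card α * w + w + w + w + w + 4) ∧
      x.length = 4 + F.n + F.n + T * (w * Fintype.card α * w + w + w + w + w + 4) := by
  obtain ⟨ts, hnd, hts, hx⟩ := h
  refine ⟨ts.length, length_trans_le hnd, ?_⟩
  set L := w * Fintype.card α * w + w + w + w + w + 4 with hL
  have hlen : ∀ t ∈ ts, ((t.1 : ℕ) :: (t.2.2 : ℕ) :: layerCode w t.2.1.1).length = L := by
    intro t _
    simp only [List.length_cons, length_layerCode]
    omega
  have hpre : ∀ j, x.getD (4 + F.n + F.n + j) 0 = (ts.flatMap fun t : Fin F.n × LayerAlphabet α w × Fin F.n =>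
      (t.1 : ℕ) :: (t.2.2 : ℕ) :: layerCode w t.2.1.1).getD j 0 := by
    intro j
    rw [hx, getD_append_of_length (by simp; omega)]
  have hblock : ∀ (i : ℕ) (hi : i < ts.length), ∀ j < L, x.getD (blockPos F.n L i + j) 0 =
      ((ts[i].1 : ℕ) :: (ts[i].2.2 : ℕ) :: layerCode w ts[i].2.1.1).getD j 0 := by
    intro i hi j hj
    rw [blockPos, add_assoc _ (i * L), hpre, getD_flatMap ts hlen i j hi hj]
  have hget : ∀ (i : ℕ) (hi : i < ts.length), x.getD (blockPos F.n L i) 0 = ts[i].1 ∧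
      x.getD (blockPos F.n L i + 1) 0 = ts[i].2.2 ∧
      InCodes w (fun i => x.getD i 0) (blockPos F.n L i + 2) ts[i].2.1.1 := by
    intro i hi
    refine ⟨?_, ?_, layerCode_inCodes fun j hj => ?_⟩
    · have := hblock i hi 0 (by omega)
      simpa using this
    · have := hblock i hi 1 (by omega)
      simpa using this
    · have := hblock i hi (2 + j) (by omega)
      rw [← add_assoc] at this
      simp only [this]
      rw [show 2 + j = j + 1 + 1 by ring, List.getD_cons_succ, List.getD_cons_succ]
  have h3 : ∀ j, x.getD (3 + j) 0 = (bits (List.finRange F.n) (· ∈ F.nfa.start) ++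
      (bits (List.finRange F.n) (· ∈ F.nfa.accept) ++ ([ts.length] ++
      ts.flatMap fun t : Fin F.n × LayerAlphabet α w × Fin F.n =>
        (t.1 : ℕ) :: (t.2.2 : ℕ) :: layerCode w t.2.1.1))).getD j 0 := by
    intro j
    rw [hx]
    simp only [List.append_assoc]
    rw [getD_append_of_length (by simp)]
  refine ⟨⟨?_, ?_, ?_, fun p => ?_, fun p => ?_, ?_, fun i hi => ?_, fun p l q hq => ?_⟩, ?_⟩
  · rw [hx]; simp
  · rw [hx]; simp
  · rw [hx]; simp
  · rw [h3, List.getD_append _ _ _ _ (by simp), bits_getD (by simp)]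
    simp
  · rw [add_assoc, h3, getD_append_of_length (by simp), List.getD_append _ _ _ _ (by simp),
      bits_getD (by simp)]
    simp
  · rw [add_assoc, h3, getD_append_of_length (by simp)]
    exact (getD_append_of_length (m := F.n) (k := 0) (by simp)).trans (by simp)
  · obtain ⟨h1, h2, h3⟩ := hget i hi
    exact ⟨_, _, _, (hts _ _ _).1 (List.getElem_mem hi), h1, h2, h3⟩
  · obtain ⟨i, hi, he⟩ := List.getElem_of_mem ((hts p l q).2 hq)
    have := hget i hi
    rw [he] at this
    exact ⟨i, hi, this⟩
  · rw [hx]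
    simp only [List.length_append, length_bits, List.length_finRange, List.length_cons,
      List.length_nil, length_flatMap_const ts hlen]
    omega

end Read

/-! ## The nondeterministic automaton of the canonical forms, on numbers -/

section NumNFA

/-- The transition relation, where `u` and `v` are pairs of a state and of the code of a partial
function. -/
def Delta (σ w n H T L : ℕ) (X : ℕ → ℕ) (u ℓ v : ℕ) : Prop :=
  ∃ i < T, X (blockPos n L i) = u / H ∧ X (blockPos n L i + 1) = v / H ∧
    CompatNum σ w X (blockPos n L i + 2) ℓ (dig w (u % H)) (dig w (v % H))

variable {α : Type u} [LinearOrder α] [Fintype α] {w : ℕ} {F : FA (LayerAlphabet α w)}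
  {X : ℕ → ℕ} {T L H : ℕ}

theorem delta_iff (hF : F.InCode X T L) (E : LayerAlphabet α w) {u v : ℕ} :
    Delta (Fintype.card α) w F.n H T L X u (E.1.number w) v ↔
      ∃ (p q : Fin F.n) (B : LayerAlphabet α w), (p : ℕ) = u / H ∧ (q : ℕ) = v / H ∧
        q ∈ F.nfa.step p B ∧ Compat w B.1 E.1 (dig w (u % H)) (dig w (v % H)) := by
  constructor
  · rintro ⟨i, hi, h1, h2, h3⟩
    obtain ⟨p, B, q, hq, e1, e2, e3⟩ := hF.trans i hi
    exact ⟨p, q, B, e1.symm.trans h1, e2.symm.trans h2, hq,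
      (compatNum_iff e3 E.2 E.2.codes _ _).1 h3⟩
  · rintro ⟨p, q, B, h1, h2, hq, h3⟩
    obtain ⟨i, hi, e1, e2, e3⟩ := hF.exists_trans p B q hq
    exact ⟨i, hi, e1.trans h1, e2.trans h2, (compatNum_iff e3 E.2 E.2.codes _ _).2 h3⟩

theorem mem_acceptsFrom_iff {Γ σ : Type*} {M : NFA Γ σ} {S : Set σ} {x : List Γ} :
    x ∈ M.acceptsFrom S ↔ ∃ s ∈ S, x ∈ M.acceptsFrom {s} := by
  simp only [NFA.mem_acceptsFrom]
  constructor
  · rintro ⟨t, ht, h⟩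
    obtain ⟨s, hs, h⟩ := NFA.mem_evalFrom_iff_exists.1 h
    exact ⟨s, hs, t, ht, h⟩
  · rintro ⟨s, hs, t, ht, h⟩
    exact ⟨t, ht, NFA.mem_evalFrom_iff_exists.2 ⟨s, hs, h⟩⟩

/-- The subset construction, unfolded: from the pair with number `u`, the automaton reads `E` while
guessing a string `D` accepted by `F` from the first component and a homomorphism from `D` to `E`
starting with the map coded by the second component. -/
theorem meets_run_iff (hH : H = (w + 1) ^ w) (hF : F.InCode X T L) (E : List (LayerAlphabet α w))
    (s : ℕ) :
    Meets (F.n * H) (runFrom (fun s e => post (F.n * H)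
      (Delta (Fintype.card α) w F.n H T L X) s (e.1.number w)) s E)
      (pset (F.n * H) fun u => X (3 + F.n + u / H) ≠ 0) ↔
    ∃ u < F.n * H, s.testBit u = true ∧ ∃ (p : Fin F.n) (D : List (LayerAlphabet α w)),
      (p : ℕ) = u / H ∧ D ∈ F.nfa.acceptsFrom {p} ∧
      HomRun w (D.map Subtype.val) (E.map Subtype.val) (dig w (u % H)) := by
  have hH0 : 0 < H := by rw [hH]; positivity
  induction E generalizing s with
  | nil =>
    refine exists_congr fun u => and_congr_right fun hu => and_congr_right fun _ => ?_
    have hp : u / H < F.n := Nat.div_lt_of_lt_mul (mul_comm F.n H ▸ hu)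
    rw [testBit_pset]
    constructor
    · rintro ⟨-, h⟩
      refine ⟨⟨u / H, hp⟩, [], rfl, ?_, trivial⟩
      rw [NFA.nil_mem_acceptsFrom]
      exact ⟨_, rfl, (hF.accept ⟨u / H, hp⟩).1 h⟩
    · rintro ⟨p, D, hpu, hD, hr⟩
      refine ⟨hu, ?_⟩
      match D, hr with
      | [], _ =>
        rw [NFA.nil_mem_acceptsFrom] at hD
        obtain ⟨p', hp', h⟩ := hD
        have := (hF.accept p').2 h
        rwa [Set.mem_singleton_iff.1 hp', hpu] at this
  | cons e E ih =>
    rw [runFrom, List.foldl_cons]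
    refine (ih _).trans ?_
    constructor
    · rintro ⟨v, hv, hb, q, D, hq, hD, hr⟩
      obtain ⟨-, u, hu, hs, hd⟩ := testBit_pset.1 hb
      obtain ⟨p, q', B, h1, h2, h3, h4⟩ := (delta_iff hF e).1 hd
      obtain rfl : q = q' := Fin.ext (hq.trans h2.symm)
      refine ⟨u, hu, hs, p, B :: D, h1, ?_, _, h4, hr⟩
      rw [NFA.cons_mem_acceptsFrom, NFA.stepSet_singleton]
      exact mem_acceptsFrom_iff.2 ⟨q, h3, hD⟩
    · rintro ⟨u, hu, hs, p, D, hp, hD, hr⟩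
      match D, hD, hr with
      | B :: D, hD, hr =>
        rw [NFA.cons_mem_acceptsFrom, NFA.stepSet_singleton, mem_acceptsFrom_iff] at hD
        obtain ⟨q, hq, hD⟩ := hD
        obtain ⟨x, hx, hc, hr⟩ := homRun_cons.1 hr
        rw [← hH] at hx
        have hdiv : ((q : ℕ) * H + x) / H = q := by
          rw [mul_comm, Nat.mul_add_div hH0, Nat.div_eq_of_lt hx, add_zero]
        have hmod : ((q : ℕ) * H + x) % H = x := by
          rw [mul_comm, Nat.mul_add_mod, Nat.mod_eq_of_lt hx]
        have hlt : (q : ℕ) * H + x < F.n * H := by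
          calc (q : ℕ) * H + x < q * H + H := by omega
            _ = (q + 1) * H := by ring
            _ ≤ F.n * H := Nat.mul_le_mul q.2 le_rfl
        refine ⟨q * H + x, hlt, testBit_pset.2 ⟨hlt, u, hu, hs, (delta_iff hF e).2
          ⟨p, q, B, hp, hdiv.symm, hq, ?_⟩⟩, q, D, hdiv.symm, hD, ?_⟩
        · rwa [hmod]
        · rwa [hmod]

theorem meets_start_iff (hH : H = (w + 1) ^ w) (hF : F.InCode X T L)
    (E : List (LayerAlphabet α w)) :
    Meets (F.n * H) (runFrom (fun s e => post (F.n * H)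
      (Delta (Fintype.card α) w F.n H T L X) s (e.1.number w))
      (pset (F.n * H) fun u => X (3 + u / H) ≠ 0) E)
      (pset (F.n * H) fun u => X (3 + F.n + u / H) ≠ 0) ↔
    ∃ D ∈ F.firstLang, ∃ h, HomRun w D (E.map Subtype.val) h := by
  have hH0 : 0 < H := by rw [hH]; positivity
  rw [meets_run_iff hH hF]
  constructor
  · rintro ⟨u, hu, hb, p, D, hp, hD, hr⟩
    refine ⟨D.map Subtype.val, ⟨D, ?_, rfl⟩, _, hr⟩
    have := (testBit_pset.1 hb).2
    rw [← hp, hF.start] at this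
    change D ∈ F.nfa.accepts
    rw [NFA.accepts_eq_acceptsFrom_start]
    exact mem_acceptsFrom_iff.2 ⟨p, this, hD⟩
  · rintro ⟨_, ⟨D, hD, rfl⟩, hr⟩
    change D ∈ F.nfa.accepts at hD
    rw [NFA.accepts_eq_acceptsFrom_start, mem_acceptsFrom_iff] at hD
    obtain ⟨p, hp, hD⟩ := hD
    obtain ⟨x, hx, hr⟩ := exists_homRun_dig.1 hr
    rw [← hH] at hx
    have hdiv : ((p : ℕ) * H + x) / H = p := by
      rw [mul_comm, Nat.mul_add_div hH0, Nat.div_eq_of_lt hx, add_zero]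
    have hmod : ((p : ℕ) * H + x) % H = x := by
      rw [mul_comm, Nat.mul_add_mod, Nat.mod_eq_of_lt hx]
    have hlt : (p : ℕ) * H + x < F.n * H := by
      calc (p : ℕ) * H + x < p * H + H := by omega
        _ = (p + 1) * H := by ring
        _ ≤ F.n * H := Nat.mul_le_mul p.2 le_rfl
    refine ⟨p * H + x, hlt, testBit_pset.2 ⟨hlt, ?_⟩, p, D, hdiv.symm, hD, ?_⟩
    · rw [hdiv]
      exact (hF.start p).2 hp
    · rwa [hmod]

end NumNFA

end SecondOrder


namespace SecondOrder

/-! ## The conditions as expressions -/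

namespace Ex

/-- The relations between the parameters: `1` is the size of the alphabet, `2` the width, `3` the
number of states, `4` the number of transitions, `13` a bound for the operands of divisions. -/
structure Pars (π : Fin 16 → ℕ) : Prop where
  card : 0 < π 1
  width : 0 < π 2
  base : π 5 = π 2 + 1
  funs : π 6 = (π 2 + 1) ^ π 2
  states : π 7 = π 3 * π 6
  sets : π 8 = 2 ^ π 7
  block : π 9 = π 2 * π 1 * π 2 + π 2 + π 2 + π 2 + π 2 + 4
  layers : π 10 = 2 ^ (π 2 * π 1 * π 2 + π 2 + π 2 + π 2 + π 2 + 2)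
  two : π 11 = 2
  triples : π 14 = π 2 * π 1 * π 2
  states_le : π 7 ≤ π 13
  sets_le : π 8 ≤ π 13
  layers_le : π 10 ≤ π 13

def bitT (l p a q : Ex) : Ex := bit l (add (mulP (add (mulP p 1) a) 2) q)
def bitF (l q : Ex) : Ex := bit l (add (par 14) q)
def bitI (l q : Ex) : Ex := bit l (add (add (par 14) (par 2)) q)
def bitR (l q : Ex) : Ex := bit l (add (add (add (par 14) (par 2)) (par 2)) q)
def bitL (l q : Ex) : Ex := bit l (add (add (add (add (par 14) (par 2)) (par 2)) (par 2)) q)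
def flagF (l : Ex) : Ex :=
  bit l (add (add (add (add (par 14) (par 2)) (par 2)) (par 2)) (par 2))
def flagI (l : Ex) : Ex :=
  bit l (add (add (add (add (add (par 14) (par 2)) (par 2)) (par 2)) (par 2)) (num 1))

/-- A transcription of `ValidNum`. The innermost bound index is `var 0`, and `weak k` carries `l`
past `k` binders; the expressions below follow the same convention. -/
def validE (l : Ex) : Ex :=
  and (all 2 (all 1 (all 2 (imp (bitT (weak 3 l) (var 2) (var 1) (var 0))
    (and (bitL (weak 3 l) (var 2)) (bitR (weak 3 l) (var 0)))))))
  (and (all 2 (imp (bitF (weak 1 l) (var 0)) (and (bitR (weak 1 l) (var 0)) (flagF (weak 1 l)))))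
    (all 2 (imp (bitI (weak 1 l) (var 0)) (and (bitL (weak 1 l) (var 0)) (flagI (weak 1 l))))))

def goodE (l : Ex) : Ex :=
  and (imp (flagI l) (all 2 (imp (bitL (weak 1 l) (var 0)) (bitI (weak 1 l) (var 0)))))
  (and (imp (flagI l) (ex 2 (and (bitL (weak 1 l) (var 0))
    (all 2 (imp (bitL (weak 2 l) (var 0)) (eq (var 0) (var 1)))))))
  (and (all 2 (all 1 (all 2 (all 2 (imp (bitT (weak 4 l) (var 3) (var 2) (var 1))
    (imp (bitT (weak 4 l) (var 3) (var 2) (var 0)) (eq (var 1) (var 0))))))))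
  (and (all 2 (imp (bitL (weak 1 l) (var 0))
    (all 1 (ex 2 (bitT (weak 3 l) (var 2) (var 1) (var 0))))))
  (and (all 2 (imp (bitR (weak 1 l) (var 0))
    (ex 2 (ex 1 (bitT (weak 3 l) (var 1) (var 0) (var 2))))))
  (and (all 2 (all 2 (imp (lt (var 1) (var 0)) (imp (bitR (weak 2 l) (var 1))
    (imp (bitR (weak 2 l) (var 0)) (ex 2 (ex 1 (and (bitT (weak 4 l) (var 1) (var 0) (var 3))
      (all 2 (all 1 (imp (bitT (weak 6 l) (var 1) (var 0) (var 4))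
        (or (lt (var 3) (var 1)) (and (eq (var 3) (var 1)) (lt (var 2) (var 0)))))))))))))))
  (and (all 2 (imp (bitL (weak 1 l) (var 0)) (all 2 (imp (lt (var 0) (var 1))
    (bitL (weak 2 l) (var 0))))))
  (and (ex 2 (bitL (weak 1 l) (var 0)))
  (and (all 2 (imp (bitR (weak 1 l) (var 0)) (all 2 (imp (lt (var 0) (var 1))
    (bitR (weak 2 l) (var 0))))))
  (and (ex 2 (bitR (weak 1 l) (var 0)))
  (and (all 2 (all 2 (imp (bitL (weak 2 l) (var 1)) (imp (bitL (weak 2 l) (var 0))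
    (imp (all 1 (all 2 (imp (bitT (weak 4 l) (var 3) (var 1) (var 0))
      (bitT (weak 4 l) (var 2) (var 1) (var 0))))) (eq (var 1) (var 0)))))))
  (imp (flagF l) (all 2 (all 2 (imp (bitR (weak 2 l) (var 1)) (imp (bitR (weak 2 l) (var 0))
    (imp (iff (bitF (weak 2 l) (var 1)) (bitF (weak 2 l) (var 0))) (eq (var 1) (var 0)))))))
  )))))))))))

def digE (x p : Ex) : Ex := digit 5 x p

def compatE (c l x y : Ex) : Ex :=
  and (iff (rd 0 c) (flagI l))
  (and (iff (rd 0 (add c (num 1))) (flagF l))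
  (and (goodE l)
  (and (all 2 (iff (bitL (weak 1 l) (var 0)) (ex 2 (eq (digE (weak 2 x) (var 0)) (var 1)))))
  (and (all 2 (iff (bitR (weak 1 l) (var 0)) (ex 2 (eq (digE (weak 2 y) (var 0)) (var 1)))))
  (and (all 2 (all 1 (all 2 (imp (rd 0 (add (add (add (add (add (add (weak 3 c) (num 2)) (par 2))
    (par 2)) (par 2)) (par 2)) (add (mulP (add (mulP (var 2) 1) (var 1)) 2) (var 0))))
    (imp (lt (digE (weak 3 x) (var 2)) (par 2))
      (and (lt (digE (weak 3 y) (var 0)) (par 2))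
        (bitT (weak 3 l) (digE (weak 3 x) (var 2)) (var 1) (digE (weak 3 y) (var 0)))))))))
  (and (imp (rd 0 c) (all 2 (imp
    (rd 0 (add (add (add (add (weak 1 c) (num 2)) (par 2)) (par 2)) (var 0)))
    (lt (digE (weak 1 x) (var 0)) (par 2)))))
  (imp (rd 0 (add c (num 1))) (all 2 (imp (lt (digE (weak 1 y) (var 0)) (par 2))
    (iff (rd 0 (add (add (add (add (add (weak 1 c) (num 2)) (par 2)) (par 2)) (par 2)) (var 0)))
      (bitF (weak 1 l) (digE (weak 1 y) (var 0)))))))))))))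

def blockE (i : Ex) : Ex := add (add (add (num 4) (par 3)) (par 3)) (mulP i 9)

def deltaE (u l v : Ex) : Ex :=
  ex 4 (and (eq (rd 0 (blockE (var 0))) (divP (weak 1 u) 6))
    (and (eq (rd 0 (add (blockE (var 0)) (num 1))) (divP (weak 1 v) 6))
      (compatE (add (blockE (var 0)) (num 2)) (weak 1 l) (modP (weak 1 u) 6)
        (modP (weak 1 v) 6))))

def postE (s l : Ex) : Ex :=
  mkset (ex 7 (and (bit (weak 2 s) (var 0)) (deltaE (var 0) (weak 2 l) (var 1))))

def preE (s l : Ex) : Ex :=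
  mkset (ex 7 (and (bit (weak 2 s) (var 0)) (deltaE (var 1) (weak 2 l) (var 0))))

def meetsE (s t : Ex) : Ex := ex 7 (and (bit (weak 1 s) (var 0)) (bit (weak 1 t) (var 0)))

def startE : Ex := mkset (rd 0 (add (num 3) (divP (var 0) 6)))

def acceptE : Ex := mkset (rd 0 (add (add (num 3) (par 3)) (divP (var 0) 6)))

/-- Equivalence of sets, tested on the sets marked in bank `2`. -/
def eqvE (s t : Ex) : Ex :=
  all 8 (imp (rd 2 (var 0)) (iff (meetsE (weak 1 s) (var 0)) (meetsE (weak 1 t) (var 0))))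

section

variable {π : Fin 16 → ℕ} {bk : ℕ → ℕ → ℕ} {l s t u v c x y p a q : Ex} {ρ : List ℕ}

theorem tr_bitT (hπ : Pars π) (hl : eval π bk l ρ ≤ π 13) : tr π bk (bitT l p a q) ρ ↔
    (eval π bk l ρ).testBit (tpos (π 1) (π 2) (eval π bk p ρ) (eval π bk a ρ) (eval π bk q ρ)) =
      true := by
  rw [bitT, tr_bit hπ.two hl]
  simp only [eval_add, eval_mulP, tpos]

theorem tr_bitF (hπ : Pars π) (hl : eval π bk l ρ ≤ π 13) : tr π bk (bitF l q) ρ ↔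
    (eval π bk l ρ).testBit (π 2 * π 1 * π 2 + eval π bk q ρ) = true := by
  rw [bitF, tr_bit hπ.two hl, ← hπ.triples]
  rfl

theorem tr_bitI (hπ : Pars π) (hl : eval π bk l ρ ≤ π 13) : tr π bk (bitI l q) ρ ↔
    (eval π bk l ρ).testBit (π 2 * π 1 * π 2 + π 2 + eval π bk q ρ) = true := by
  rw [bitI, tr_bit hπ.two hl, ← hπ.triples]
  rfl

theorem tr_bitR (hπ : Pars π) (hl : eval π bk l ρ ≤ π 13) : tr π bk (bitR l q) ρ ↔
    (eval π bk l ρ).testBit (π 2 * π 1 * π 2 + π 2 + π 2 + eval π bk q ρ) = true := by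
  rw [bitR, tr_bit hπ.two hl, ← hπ.triples]
  rfl

theorem tr_bitL (hπ : Pars π) (hl : eval π bk l ρ ≤ π 13) : tr π bk (bitL l q) ρ ↔
    (eval π bk l ρ).testBit (π 2 * π 1 * π 2 + π 2 + π 2 + π 2 + eval π bk q ρ) = true := by
  rw [bitL, tr_bit hπ.two hl, ← hπ.triples]
  rfl

theorem tr_flagF (hπ : Pars π) (hl : eval π bk l ρ ≤ π 13) : tr π bk (flagF l) ρ ↔
    (eval π bk l ρ).testBit (π 2 * π 1 * π 2 + π 2 + π 2 + π 2 + π 2) = true := by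
  rw [flagF, tr_bit hπ.two hl, ← hπ.triples]
  rfl

theorem tr_flagI (hπ : Pars π) (hl : eval π bk l ρ ≤ π 13) : tr π bk (flagI l) ρ ↔
    (eval π bk l ρ).testBit (π 2 * π 1 * π 2 + π 2 + π 2 + π 2 + π 2 + 1) = true := by
  rw [flagI, tr_bit hπ.two hl, ← hπ.triples]
  rfl

theorem eval_digE (hπ : Pars π) (hx : eval π bk x ρ ≤ π 13) :
    eval π bk (digE x p) ρ = dig (π 2) (eval π bk x ρ) (eval π bk p ρ) := by
  have := hπ.width
  rw [digE, eval_digit (by rw [hπ.base]; omega) hx, hπ.base, dig]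

theorem tr_validE (hπ : Pars π) (hl : eval π bk l ρ ≤ π 13) :
    tr π bk (validE l) ρ ↔ ValidNum (π 1) (π 2) (eval π bk l ρ) := by
  simp only [validE, tr_and, tr_all, tr_imp, tr_bitT hπ, tr_bitF hπ, tr_bitI hπ, tr_bitR hπ,
    tr_bitL hπ, tr_flagF hπ, tr_flagI hπ, eval_weak, eval_var, List.drop_succ_cons, List.drop_zero,
    List.getD_cons_succ, List.getD_cons_zero, hl]
  exact ⟨fun ⟨h1, h2, h3⟩ => ⟨h1, h2, h3⟩, fun ⟨h1, h2, h3⟩ => ⟨h1, h2, h3⟩⟩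

theorem tr_goodE (hπ : Pars π) (hl : eval π bk l ρ ≤ π 13) :
    tr π bk (goodE l) ρ ↔ GoodNum (π 1) (π 2) (eval π bk l ρ) := by
  simp only [goodE, tr_and, tr_or, tr_all, tr_ex, tr_imp, tr_iff, tr_lt, tr_eq, tr_bitT hπ,
    tr_bitF hπ, tr_bitI hπ, tr_bitR hπ, tr_bitL hπ, tr_flagF hπ, tr_flagI hπ, eval_weak, eval_var,
    List.drop_succ_cons, List.drop_zero, List.getD_cons_succ, List.getD_cons_zero, hl]
  exact ⟨fun ⟨h1, h2, h3, h4, h5, h6, h7, h8, h9, h10, h11, h12⟩ =>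
    ⟨h1, h2, h3, h4, h5, h6, h7, h8, h9, h10, h11, h12⟩,
    fun ⟨h1, h2, h3, h4, h5, h6, h7, h8, h9, h10, h11, h12⟩ =>
    ⟨h1, h2, h3, h4, h5, h6, h7, h8, h9, h10, h11, h12⟩⟩

theorem tpos_def {n w p a q : ℕ} : (p * n + a) * w + q = tpos n w p a q := rfl

theorem tr_compatE (hπ : Pars π) (hl : eval π bk l ρ ≤ π 13) (hx : eval π bk x ρ ≤ π 13)
    (hy : eval π bk y ρ ≤ π 13) : tr π bk (compatE c l x y) ρ ↔
      CompatNum (π 1) (π 2) (bk 0) (eval π bk c ρ) (eval π bk l ρ)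
        (dig (π 2) (eval π bk x ρ)) (dig (π 2) (eval π bk y ρ)) := by
  simp only [compatE, tr_and, tr_all, tr_ex, tr_imp, tr_iff, tr_lt, tr_eq, tr_rd, tr_goodE hπ,
    tr_bitT hπ, tr_bitF hπ, tr_bitR hπ, tr_bitL hπ, tr_flagF hπ, tr_flagI hπ, eval_weak,
    eval_var, eval_par, eval_num, eval_add, eval_mulP, eval_digE hπ, tpos_def,
    List.drop_succ_cons, List.drop_zero, List.getD_cons_succ, List.getD_cons_zero, hl, hx, hy]
  exact ⟨fun ⟨h1, h2, h3, h4, h5, h6, h7, h8⟩ => ⟨h1, h2, h3, h4, h5, h6, h7, h8⟩,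
    fun ⟨h1, h2, h3, h4, h5, h6, h7, h8⟩ => ⟨h1, h2, h3, h4, h5, h6, h7, h8⟩⟩

/-- The transition relation given by the parameters and the input. -/
def DeltaP (π : Fin 16 → ℕ) (bk : ℕ → ℕ → ℕ) : ℕ → ℕ → ℕ → Prop :=
  Delta (π 1) (π 2) (π 3) (π 6) (π 4) (π 9) (bk 0)

theorem Pars.funs_pos (hπ : Pars π) : 0 < π 6 := by
  rw [hπ.funs]
  positivity

theorem eval_blockE {i : Ex} :
    eval π bk (blockE i) ρ = blockPos (π 3) (π 9) (eval π bk i ρ) := by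
  rw [blockE, eval_add, eval_mulP]
  rfl

theorem tr_deltaE (hπ : Pars π) (hl : eval π bk l ρ ≤ π 13) (hu : eval π bk u ρ ≤ π 13)
    (hv : eval π bk v ρ ≤ π 13) : tr π bk (deltaE u l v) ρ ↔
      DeltaP π bk (eval π bk u ρ) (eval π bk l ρ) (eval π bk v ρ) := by
  have h6 := hπ.funs_pos
  simp only [deltaE, tr_ex, tr_and, tr_eq]
  refine exists_congr fun i => and_congr_right fun hi => ?_
  have hu' : eval π bk (weak 1 u) (i :: ρ) ≤ π 13 := hu
  have hv' : eval π bk (weak 1 v) (i :: ρ) ≤ π 13 := hv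
  rw [tr_compatE hπ, eval_divP h6 hu', eval_divP h6 hv', eval_modP h6 hu', eval_modP h6 hv',
    eval_rd, eval_rd, eval_add, eval_add, eval_blockE]
  · rfl
  · exact hl
  · rw [eval_modP h6 hu']
    exact (Nat.mod_le _ _).trans hu'
  · rw [eval_modP h6 hv']
    exact (Nat.mod_le _ _).trans hv'

theorem eval_postE (hπ : Pars π) (hs : eval π bk s ρ ≤ π 13) (hl : eval π bk l ρ ≤ π 13) :
    eval π bk (postE s l) ρ = post (π 7) (DeltaP π bk) (eval π bk s ρ) (eval π bk l ρ) := by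
  rw [postE, post, pset]
  refine eval_mkset fun v hv => ?_
  rw [tr_ex]
  refine exists_congr fun u => and_congr_right fun hu => ?_
  have := hπ.states_le
  rw [tr_and, tr_bit hπ.two, tr_deltaE hπ]
  · rfl
  · exact hl
  · exact hu.le.trans this
  · exact hv.le.trans this
  · exact hs

theorem eval_preE (hπ : Pars π) (hs : eval π bk s ρ ≤ π 13) (hl : eval π bk l ρ ≤ π 13) :
    eval π bk (preE s l) ρ = preim (π 7) (DeltaP π bk) (eval π bk s ρ) (eval π bk l ρ) := by
  rw [preE, preim, pset]
  refine eval_mkset fun v hv => ?_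
  rw [tr_ex]
  refine exists_congr fun u => and_congr_right fun hu => ?_
  have := hπ.states_le
  rw [tr_and, tr_bit hπ.two, tr_deltaE hπ]
  · rfl
  · exact hl
  · exact hv.le.trans this
  · exact hu.le.trans this
  · exact hs

theorem tr_meetsE (hπ : Pars π) (hs : eval π bk s ρ ≤ π 13) (ht : eval π bk t ρ ≤ π 13) :
    tr π bk (meetsE s t) ρ ↔ Meets (π 7) (eval π bk s ρ) (eval π bk t ρ) := by
  rw [meetsE, tr_ex]
  refine exists_congr fun u => and_congr_right fun hu => ?_
  rw [tr_and, tr_bit hπ.two (show eval π bk (weak 1 s) (u :: ρ) ≤ π 13 from hs),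
    tr_bit hπ.two (show eval π bk (weak 1 t) (u :: ρ) ≤ π 13 from ht)]
  rfl

theorem eval_startE (hπ : Pars π) : eval π bk startE ρ =
    pset (π 7) fun u => bk 0 (3 + u / π 6) ≠ 0 := by
  refine eval_mkset fun v hv => ?_
  rw [tr_rd, eval_add, eval_divP (a := var 0) (ρ := v :: ρ) hπ.funs_pos (hv.le.trans hπ.states_le)]
  rfl

theorem eval_acceptE (hπ : Pars π) : eval π bk acceptE ρ =
    pset (π 7) fun u => bk 0 (3 + π 3 + u / π 6) ≠ 0 := by
  refine eval_mkset fun v hv => ?_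
  rw [tr_rd, eval_add, eval_divP (a := var 0) (ρ := v :: ρ) hπ.funs_pos (hv.le.trans hπ.states_le)]
  rfl

theorem tr_eqvE (hπ : Pars π) (hs : eval π bk s ρ ≤ π 13) (ht : eval π bk t ρ ≤ π 13) :
    tr π bk (eqvE s t) ρ ↔ ∀ X < π 8, bk 2 X ≠ 0 →
      (Meets (π 7) (eval π bk s ρ) X ↔ Meets (π 7) (eval π bk t ρ) X) := by
  rw [eqvE, tr_all]
  refine forall_congr' fun X => imp_congr_right fun hX => ?_
  have := hπ.sets_le
  rw [tr_imp, tr_iff, tr_meetsE hπ, tr_meetsE hπ]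
  · rfl
  · exact ht
  · exact hX.le.trans this
  · exact hs
  · exact hX.le.trans this

end

end Ex

end SecondOrder


namespace SecondOrder

/-! ## The search for the states of the canonical automaton -/

theorem iter_inv {β : Type*} {P : ℕ → β → Prop} {n : ℕ} {f : ℕ → β → β} {x : β} (h0 : P 0 x)
    (hs : ∀ i < n, ∀ y, P i y → P (i + 1) (f i y)) : P n (iter n f x) := by
  induction n with
  | zero => exact h0
  | succ n ih => exact hs n (by omega) _ (ih fun i hi => hs i (by omega))

/-- Used to replace a loop over memories by a loop over the data that it changes, with `g` placing
these data in memory. -/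
theorem iter_map {β γ : Type*} {n : ℕ} {f : ℕ → β → β} {f' : ℕ → γ → γ} {g : γ → β}
    (h : ∀ i < n, ∀ y, f i (g y) = g (f' i y)) (y : γ) : iter n f (g y) = g (iter n f' y) := by
  induction n with
  | zero => rfl
  | succ n ih => rw [iter, ih fun i hi => h i (by omega), h n (by omega), iter]

theorem Cmd.run_ite {π : Fin 16 → ℕ} {e : Ex} {c d : Cmd} {ρ : List ℕ} {bk : ℕ → ℕ → ℕ}
    {P : Prop} [Decidable P] (h : Ex.tr π bk e ρ ↔ P) :
    (Cmd.ite e c d).run π ρ bk = if P then c.run π ρ bk else d.run π ρ bk := by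
  by_cases hP : P
  · rw [if_pos hP]
    exact if_pos (h.2 hP)
  · rw [if_neg hP]
    exact if_neg (h.not.2 hP)

open Ex Cmd

/-- Marks in bank `2` all sets of states from which a fixed string is accepted. -/
def markCmd : Cmd :=
  .seq (.store 2 acceptE (num 1))
    (.rep 8 (.rep 8 (.rep 10 (.ite (and (validE (var 0)) (rd 2 (var 1)))
      (.store 2 (preE (var 1) (var 0)) (num 1)) .skip))))

/-- Breadth-first search; bank `3` is the queue and cell `0` of bank `4` its length. -/
def bfsCmd : Cmd :=
  .seq (.store 3 (num 0) startE) (.seq (.store 4 (num 0) (num 1))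
    (.rep 8 (.rep 10 (.ite (and (lt (var 1) (rd 4 (num 0))) (and (validE (var 0))
        (not (ex 8 (and (lt (var 0) (rd 4 (num 0)))
          (eqvE (rd 3 (var 0)) (weak 1 (postE (rd 3 (var 1)) (var 0)))))))))
      (.seq (.store 3 (rd 4 (num 0)) (postE (rd 3 (var 1)) (var 0)))
        (.store 4 (num 0) (add (rd 4 (num 0)) (num 1)))) .skip))))

/-- The states on which the automaton accepts. -/
noncomputable def acceptP (π : Fin 16 → ℕ) (X : ℕ → ℕ) : ℕ :=
  pset (π 7) fun u => X (3 + π 3 + u / π 6) ≠ 0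

noncomputable def startP (π : Fin 16 → ℕ) (X : ℕ → ℕ) : ℕ :=
  pset (π 7) fun u => X (3 + u / π 6) ≠ 0

section

variable {α : Type u} [LinearOrder α] [Fintype α] {w : ℕ} {π : Fin 16 → ℕ} {bk : ℕ → ℕ → ℕ}

theorem validNum_iff_of_pars (hπ : Pars π) (h1 : π 1 = Fintype.card α) (h2 : π 2 = w) {ℓ : ℕ}
    (hℓ : ℓ < π 10) : ValidNum (π 1) (π 2) ℓ ↔ ∃ l : LayerAlphabet α w, l.1.number w = ℓ := by
  rw [h1, h2]
  refine validNum_iff ?_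
  rwa [hπ.layers, h1, h2] at hℓ

theorem number_lt_of_pars (hπ : Pars π) (h1 : π 1 = Fintype.card α) (h2 : π 2 = w)
    (l : LayerAlphabet α w) : l.1.number w < π 10 := by
  rw [hπ.layers, h1, h2]
  exact l.2.number_lt

/-- Only bank `2` is written, so the three nested loops are the image, under replacing that bank, of
the abstract saturation of `mark_spec`. -/
theorem markCmd_run (hπ : Pars π) (h1 : π 1 = Fintype.card α) (h2 : π 2 = w)
    (h0 : ∀ X, bk 2 X = 0) : ∃ μ, markCmd.run π [] bk = Function.update bk 2 μ ∧
      ∀ X, μ X ≠ 0 ↔ ∃ u, X = pull (π 7) (DeltaP π bk) (fun l : LayerAlphabet α w => l.1.number w)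
        (acceptP π (bk 0)) u := by
  classical
  have hA : eval π bk acceptE [] = acceptP π (bk 0) := eval_acceptE hπ
  refine ⟨iter (2 ^ π 7) (fun _ => iter (2 ^ π 7) fun X => iter (π 10) fun ℓ => markStep (π 7)
    (DeltaP π bk) (ValidNum (π 1) (π 2)) X ℓ) (Function.update (bk 2) (acceptP π (bk 0)) 1), ?_,
    mark_spec (A := acceptP π (bk 0)) (pset_lt _ _) (fun ℓ hℓ => validNum_iff_of_pars hπ h1 h2 hℓ)
      (number_lt_of_pars hπ h1 h2) fun X => ?_⟩
  · rw [markCmd, run, run, hA, eval_num, setCell, run, ← hπ.sets]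
    refine iter_map (g := fun μ => Function.update bk 2 μ) (fun _ _ μ => ?_) _
    rw [run]
    refine iter_map (g := fun μ => Function.update bk 2 μ) (fun X hX μ => ?_) _
    rw [run]
    refine iter_map (g := fun μ => Function.update bk 2 μ) (fun ℓ hℓ μ => ?_) _
    have hX' := hX.le.trans hπ.sets_le
    have hℓ' := hℓ.le.trans hπ.layers_le
    rw [run_ite (P := ValidNum (π 1) (π 2) ℓ ∧ μ X ≠ 0), markStep]
    · split_ifs with h
      · rw [run, eval_preE hπ, setCell]
        · simp only [eval_var, eval_num, List.getD_cons_zero, List.getD_cons_succ,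
            Function.update_idem, Function.update_self]
          rfl
        · exact hX'
        · exact hℓ'
      · rfl
    · rw [tr_and, tr_validE hπ, tr_rd, Function.update_self]
      · rfl
      · exact hℓ'
  · by_cases hX : X = acceptP π (bk 0)
    · simp [hX]
    · simp [hX, h0]

/-- `Q` lists the states of the canonical automaton, in order. -/
structure Found (w : ℕ) (α : Type u) [LinearOrder α] [Fintype α] (π : Fin 16 → ℕ) (X : ℕ → ℕ)
    (Δ : ℕ → ℕ → ℕ → Prop) (Q : ℕ → ℕ) (m : ℕ) : Prop where
  numbering : ∃ W, IsNumbering (fun s (l : LayerAlphabet α w) => post (π 7) Δ s (l.1.number w))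
      (fun s => Meets (π 7) s (acceptP π X)) (startP π X) Q m W ∧
    IsClosed (fun s (l : LayerAlphabet α w) => post (π 7) Δ s (l.1.number w))
      (fun s => Meets (π 7) s (acceptP π X)) Q m W fun _ _ => True
  lt : ∀ j < m, Q j < π 8
  le : m ≤ π 8

/-- The marks in bank `2` decide the equivalence of states. -/
def Marked (w : ℕ) (α : Type u) [LinearOrder α] [Fintype α] (π : Fin 16 → ℕ) (X : ℕ → ℕ)
    (Δ : ℕ → ℕ → ℕ → Prop) (μ : ℕ → ℕ) : Prop :=
  ∀ s t, (∀ X < π 8, μ X ≠ 0 → (Meets (π 7) s X ↔ Meets (π 7) t X)) ↔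
    Ner (fun s (l : LayerAlphabet α w) => post (π 7) Δ s (l.1.number w))
      (fun s => Meets (π 7) s (acceptP π X)) s t

theorem marked_of_pull (hπ : Pars π) {X μ : ℕ → ℕ} {Δ : ℕ → ℕ → ℕ → Prop} (hμ : ∀ Y, μ Y ≠ 0 ↔
      ∃ u, Y = pull (π 7) Δ (fun l : LayerAlphabet α w => l.1.number w) (acceptP π X) u) :
    Marked w α π X Δ μ := by
  intro s t
  rw [ner_iff (num := fun l : LayerAlphabet α w => l.1.number w), hπ.sets]
  constructor
  · intro h u
    exact h _ (pull_lt (pset_lt _ _) u) ((hμ _).2 ⟨u, rfl⟩)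
  · intro h Y _ hY
    obtain ⟨u, rfl⟩ := (hμ Y).1 hY
    exact h u

/-- The map `g` places an abstract search state, a queue and its length, into banks `3` and `4`.
Each round of the command is `bfsStep` seen through `g`, so the invariant of the abstract search
carries over. -/
theorem bfsCmd_run (hπ : Pars π) (h1 : π 1 = Fintype.card α) (h2 : π 2 = w)
    (hm : Marked w α π (bk 0) (DeltaP π bk) (bk 2)) : ∃ Q m,
      bfsCmd.run π [] bk = Function.update (Function.update bk 3 Q) 4
        (Function.update (bk 4) 0 m) ∧ Found w α π (bk 0) (DeltaP π bk) Q m := by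
  classical
  set g : (ℕ → ℕ) × ℕ → ℕ → ℕ → ℕ := fun σ => Function.update (Function.update bk 3 σ.1) 4
    (Function.update (bk 4) 0 σ.2) with hg
  have g0 : ∀ σ, g σ 0 = bk 0 := fun σ => by simp [hg]
  have g2 : ∀ σ, g σ 2 = bk 2 := fun σ => by simp [hg]
  have g3 : ∀ σ, g σ 3 = σ.1 := fun σ => by simp [hg]
  have g4 : ∀ σ, g σ 4 0 = σ.2 := fun σ => by simp [hg]
  have gΔ : ∀ σ, DeltaP π (g σ) = DeltaP π bk := fun σ => by simp only [DeltaP, g0]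
  set N := π 7 with hN
  set δ := post N (DeltaP π bk) with hδ
  have hδlt : ∀ s ℓ, δ s ℓ < π 8 := fun s ℓ => by rw [hπ.sets]; exact pset_lt _ _
  set eqv : ℕ → ℕ → Prop := fun s t => ∀ X < π 8, bk 2 X ≠ 0 → (Meets N s X ↔ Meets N t X)
    with heqv
  have hs0 : startP π (bk 0) < π 8 := by rw [hπ.sets]; exact pset_lt _ _
  suffices H : ∃ σ, bfsCmd.run π [] bk = g σ ∧ BfsInv δ (fun l : LayerAlphabet α w => l.1.number w)
      (fun s => Meets N s (acceptP π (bk 0))) (startP π (bk 0)) (π 8) (π 8) 0 σ by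
    obtain ⟨σ, hσ, hinv⟩ := H
    obtain ⟨W, hnum, hcl, hlt, hle⟩ := hinv.finish
    exact ⟨σ.1, σ.2, hσ, ⟨⟨W, hnum, hcl⟩, hlt, hle⟩⟩
  have hstart : bfsCmd.run π [] bk = iter (π 8) (fun i bk => run π (.rep 10 (.ite
      (and (lt (var 1) (rd 4 (num 0))) (and (validE (var 0))
        (not (ex 8 (and (lt (var 0) (rd 4 (num 0)))
          (eqvE (rd 3 (var 0)) (weak 1 (postE (rd 3 (var 1)) (var 0)))))))))
      (.seq (.store 3 (rd 4 (num 0)) (postE (rd 3 (var 1)) (var 0)))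
        (.store 4 (num 0) (add (rd 4 (num 0)) (num 1)))) .skip)) [i] bk)
      (g (Function.update (bk 3) 0 (startP π (bk 0)), 1)) := by
    rw [bfsCmd, run, run, run, run, run, eval_startE hπ]
    simp [hg, setCell, startP]
  rw [hstart]
  refine iter_inv (P := fun i bk' => ∃ σ, bk' = g σ ∧ BfsInv δ
    (fun l : LayerAlphabet α w => l.1.number w) (fun s => Meets N s (acceptP π (bk 0)))
    (startP π (bk 0)) (π 8) i 0 σ) ⟨_, rfl, BfsInv.init δ _ _ hs0 _ (by simp)⟩ ?_
  rintro i hi _ ⟨σ, rfl, hinv⟩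
  rw [run]
  suffices H : ∃ σ', iter (π 10) (fun ℓ bk => run π (.ite
      (and (lt (var 1) (rd 4 (num 0))) (and (validE (var 0))
        (not (ex 8 (and (lt (var 0) (rd 4 (num 0)))
          (eqvE (rd 3 (var 0)) (weak 1 (postE (rd 3 (var 1)) (var 0)))))))))
      (.seq (.store 3 (rd 4 (num 0)) (postE (rd 3 (var 1)) (var 0)))
        (.store 4 (num 0) (add (rd 4 (num 0)) (num 1)))) .skip) [ℓ, i] bk) (g σ) = g σ' ∧
      BfsInv δ (fun l : LayerAlphabet α w => l.1.number w)
      (fun s => Meets N s (acceptP π (bk 0))) (startP π (bk 0)) (π 8) i (π 10) σ' by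
    obtain ⟨σ', h, hinv'⟩ := H
    exact ⟨σ', h, hinv'.next (number_lt_of_pars hπ h1 h2)⟩
  refine iter_inv (P := fun ℓ bk' => ∃ σ, bk' = g σ ∧ BfsInv δ
    (fun l : LayerAlphabet α w => l.1.number w) (fun s => Meets N s (acceptP π (bk 0)))
    (startP π (bk 0)) (π 8) i ℓ σ) ⟨σ, rfl, hinv⟩ ?_
  rintro ℓ hℓ _ ⟨σ, rfl, hinv⟩
  refine ⟨bfsStep δ (ValidNum (π 1) (π 2)) eqv i ℓ σ, ?_, hinv.step (number_strictMono w)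
    (validNum_iff_of_pars hπ h1 h2 hℓ) (fun s _ => hδlt s ℓ) fun s _ t _ => hm s t⟩
  have hlen := hinv.len_le
  obtain ⟨-, -, -, hlt, -⟩ := hinv
  have hℓ' := hℓ.le.trans hπ.layers_le
  have hpost : i < σ.2 → ∀ ρ, eval π (g σ) (postE (rd 3 (var 1)) (var 0)) (ℓ :: i :: ρ) =
      δ (σ.1 i) ℓ := by
    intro hi ρ
    rw [eval_postE hπ, gΔ, eval_rd, g3]
    · rfl
    · rw [eval_rd, g3]
      exact (hlt i hi).le.trans hπ.sets_le
    · exact hℓ'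
  rw [run_ite (P := i < σ.2 ∧ ValidNum (π 1) (π 2) ℓ ∧ ∀ j < σ.2, ¬ eqv (σ.1 j) (δ (σ.1 i) ℓ)),
    bfsStep]
  · split_ifs with h
    · have e : eval π (setCell (g σ) 3 (σ.2) (δ (σ.1 i) ℓ)) (rd 4 (num 0)) [ℓ, i] = σ.2 := by
        simp [setCell, g4]
      rw [run, run, run, hpost h.1, eval_rd, eval_num, g4, eval_num, eval_add, e, eval_num]
      simp only [setCell, hg]
      ext b k
      by_cases hb4 : b = 4
      · subst hb4; simp
      · by_cases hb3 : b = 3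
        · subst hb3; simp
        · simp [hb3, hb4]
    · rfl
  · rw [tr_and, tr_lt, eval_rd, eval_num, g4]
    refine and_congr_right fun hi' => ?_
    have hi : i < σ.2 := hi'
    rw [tr_and, tr_validE (ρ := [ℓ, i]) (l := var 0) hπ hℓ', tr_not, tr_ex]
    refine and_congr_right fun _ => ?_
    have key : ∀ j, tr π (g σ) (and (lt (var 0) (rd 4 (num 0))) (eqvE (rd 3 (var 0))
        (weak 1 (postE (rd 3 (var 1)) (var 0))))) [j, ℓ, i] ↔ j < σ.2 ∧
        eqv (σ.1 j) (δ (σ.1 i) ℓ) := by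
      intro j
      rw [tr_and, tr_lt, eval_rd, eval_num, g4]
      refine and_congr_right fun hj' => ?_
      have hj : j < σ.2 := hj'
      have e1 : eval π (g σ) (rd 3 (var 0)) [j, ℓ, i] = σ.1 j := by rw [eval_rd, g3]; rfl
      have e2 : eval π (g σ) (weak 1 (postE (rd 3 (var 1)) (var 0))) [j, ℓ, i] = δ (σ.1 i) ℓ :=
        hpost hi []
      rw [tr_eqvE hπ, e1, e2, g2]
      · rw [e1]
        exact (hlt j hj).le.trans hπ.sets_le
      · rw [e2]
        exact (hδlt _ _).le.trans hπ.sets_le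
    simp only [key]
    constructor
    -- The search through the queue runs over all indices below `π 8`; this covers the queue because
    -- its length is at most `π 8`.
    · exact fun h j hj he => h ⟨j, hj.trans_le hlen, hj, he⟩
    · rintro h ⟨j, -, hj, he⟩
      exact h j hj he

end

end SecondOrder


namespace SecondOrder

/-! ## The tables of the canonical automaton -/

open Ex Cmd

/-- Bank `5` receives the transitions and bank `6` the accepting states. -/
def tableCmd : Cmd :=
  .seq (.rep 15 (.rep 10 (.store 5 (add (mulP (var 1) 10) (var 0))
      (find 15 (eqvE (rd 3 (var 0)) (weak 1 (postE (rd 3 (var 1)) (var 0))))))))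
    (.rep 15 (.store 6 (var 0) (meetsE (rd 3 (var 0)) acceptE)))

theorem mul_add_inj {G i i' ℓ ℓ' : ℕ} (hℓ : ℓ < G) (hℓ' : ℓ' < G) (h : i * G + ℓ = i' * G + ℓ') :
    i = i' ∧ ℓ = ℓ' := by
  have h1 := congrArg (· / G) h
  have h2 := congrArg (· % G) h
  have hG : 0 < G := by omega
  simp only [mul_comm _ G, Nat.mul_add_div hG, Nat.div_eq_of_lt hℓ, Nat.div_eq_of_lt hℓ',
    Nat.mul_add_mod, Nat.mod_eq_of_lt hℓ, Nat.mod_eq_of_lt hℓ', add_zero] at h1 h2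
  exact ⟨h1, h2⟩

section

variable {α : Type u} [LinearOrder α] [Fintype α] {w : ℕ} {π : Fin 16 → ℕ} {bk : ℕ → ℕ → ℕ}

/-- Closedness provides an entry equivalent to the successor and inequivalence of the entries makes
it unique, so the last index found is the right one. Cells for numbers that code no layer are filled
as well, but nothing is claimed about them. Distinct pairs use distinct cells by `mul_add_inj`. -/
theorem tableCmd_run (hπ : Pars π) (h1 : π 1 = Fintype.card α) (h2 : π 2 = w) {Q : ℕ → ℕ}
    (hm : Marked w α π (bk 0) (DeltaP π bk) (bk 2)) (hQ : bk 3 = Q)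
    (hf : Found w α π (bk 0) (DeltaP π bk) Q (π 15)) :
    (∀ b, b ≠ 5 → b ≠ 6 → tableCmd.run π [] bk b = bk b) ∧
    (∀ i < π 15, ∀ l : LayerAlphabet α w,
      tableCmd.run π [] bk 5 (i * π 10 + l.1.number w) < π 15 ∧
      Ner (fun s (l : LayerAlphabet α w) => post (π 7) (DeltaP π bk) s (l.1.number w))
        (fun s => Meets (π 7) s (acceptP π (bk 0)))
        (Q (tableCmd.run π [] bk 5 (i * π 10 + l.1.number w)))
        (post (π 7) (DeltaP π bk) (Q i) (l.1.number w))) ∧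
    ∀ i < π 15, (tableCmd.run π [] bk 6 i ≠ 0 ↔ Meets (π 7) (Q i) (acceptP π (bk 0))) := by
  obtain ⟨⟨W, hnum, hcl⟩, hlt, hle⟩ := hf
  set δ := post (π 7) (DeltaP π bk) with hδ
  have hδlt : ∀ s ℓ, δ s ℓ < π 8 := fun s ℓ => by rw [hπ.sets]; exact pset_lt _ _
  have hfind : ∀ bk' : ℕ → ℕ → ℕ, (∀ b, b ≠ 5 → bk' b = bk b) → ∀ i < π 15,
      ∀ l : LayerAlphabet α w, ∀ k < π 15,
      Ner (fun s (l : LayerAlphabet α w) => δ s (l.1.number w))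
        (fun s => Meets (π 7) s (acceptP π (bk 0))) (Q k) (δ (Q i) (l.1.number w)) →
      eval π bk' (find 15 (eqvE (rd 3 (var 0)) (weak 1 (postE (rd 3 (var 1)) (var 0)))))
        [l.1.number w, i] = k := by
    intro bk' hbk i hi l k hk hner
    have hΔ : DeltaP π bk' = DeltaP π bk := by simp only [DeltaP, hbk 0 (by decide)]
    refine eval_find (P := fun k => Ner (fun s (l : LayerAlphabet α w) => δ s (l.1.number w))
        (fun s => Meets (π 7) s (acceptP π (bk 0))) (Q k) (δ (Q i) (l.1.number w))) ?_ hk hner ?_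
    · intro j hj
      have e1 : eval π bk' (rd 3 (var 0)) [j, l.1.number w, i] = Q j := by
        rw [eval_rd, hbk 3 (by decide), hQ]
        rfl
      have e3 : eval π bk' (rd 3 (var 1)) [l.1.number w, i] = Q i := by
        rw [eval_rd, hbk 3 (by decide), hQ]
        rfl
      have e2 : eval π bk' (weak 1 (postE (rd 3 (var 1)) (var 0))) [j, l.1.number w, i] =
          δ (Q i) (l.1.number w) := by
        rw [eval_weak, List.drop_succ_cons, List.drop_zero, eval_postE hπ, e3, hΔ]
        · rfl
        · rw [e3]
          exact (hlt i hi).le.trans hπ.sets_le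
        · exact (number_lt_of_pars hπ h1 h2 l).le.trans hπ.layers_le
      rw [tr_eqvE hπ, e1, e2, hbk 2 (by decide)]
      · exact hm _ _
      · rw [e1]
        exact (hlt j hj).le.trans hπ.sets_le
      · rw [e2]
        exact (hδlt _ _).le.trans hπ.sets_le
    · intro j hj hj'
      exact hnum.inj hj hk (hj'.trans hner.symm)
  set bk1 := run π (.rep 15 (.rep 10 (.store 5 (add (mulP (var 1) 10) (var 0))
      (find 15 (eqvE (rd 3 (var 0)) (weak 1 (postE (rd 3 (var 1)) (var 0)))))))) [] bk with hbk1
  have H1 : (∀ b, b ≠ 5 → bk1 b = bk b) ∧ ∀ i < π 15, ∀ l : LayerAlphabet α w, ∀ k < π 15,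
      Ner (fun s (l : LayerAlphabet α w) => δ s (l.1.number w))
        (fun s => Meets (π 7) s (acceptP π (bk 0))) (Q k) (δ (Q i) (l.1.number w)) →
      bk1 5 (i * π 10 + l.1.number w) = k := by
    rw [hbk1, run]
    refine iter_inv (P := fun (n : ℕ) (bk1 : ℕ → ℕ → ℕ) => (∀ b, b ≠ 5 → bk1 b = bk b) ∧ ∀ i < n, i < π 15 →
      ∀ l : LayerAlphabet α w, ∀ k < π 15,
      Ner (fun s (l : LayerAlphabet α w) => δ s (l.1.number w))
        (fun s => Meets (π 7) s (acceptP π (bk 0))) (Q k) (δ (Q i) (l.1.number w)) →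
      bk1 5 (i * π 10 + l.1.number w) = k) ⟨fun _ _ => rfl, by omega⟩ ?_ |>.imp_right ?_
    · rintro n hn bk2 ⟨hb, ht⟩
      rw [run]
      refine iter_inv (P := fun (ℓ : ℕ) (bk1 : ℕ → ℕ → ℕ) => (∀ b, b ≠ 5 → bk1 b = bk b) ∧ ∀ i < n + 1, i < π 15 →
        ∀ l : LayerAlphabet α w, (i < n ∨ l.1.number w < ℓ) → ∀ k < π 15,
        Ner (fun s (l : LayerAlphabet α w) => δ s (l.1.number w))
          (fun s => Meets (π 7) s (acceptP π (bk 0))) (Q k) (δ (Q i) (l.1.number w)) →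
        bk1 5 (i * π 10 + l.1.number w) = k) ⟨hb, fun i hi hi' l hl => ?_⟩ ?_ |>.imp_right ?_
      · rcases hl with hl | hl
        · exact ht i hl hi' l
        · omega
      · rintro ℓ hℓ bk3 ⟨hb, ht⟩
        refine ⟨fun b hb5 => ?_, fun i hi hi' l hl k hk hner => ?_⟩
        · rw [run, setCell, Function.update_of_ne hb5, hb b hb5]
        · rw [run, setCell, Function.update_self, eval_add, eval_mulP]
          by_cases he : i = n ∧ l.1.number w = ℓ
          · obtain ⟨rfl, rfl⟩ := he
            rw [hfind bk3 hb i hi' l k hk hner]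
            simp
          · have hne : i * π 10 + l.1.number w ≠ n * π 10 + ℓ := fun h =>
              he (mul_add_inj (number_lt_of_pars hπ h1 h2 l) hℓ h)
            simp only [eval_var, List.getD_cons_succ, List.getD_cons_zero]
            rw [Function.update_of_ne hne]
            refine ht i hi hi' l ?_ k hk hner
            by_cases hin : i = n
            · have : l.1.number w ≠ ℓ := fun h => he ⟨hin, h⟩
              omega
            · omega
      · intro h i hi hi' l
        exact h i hi hi' l (.inr (number_lt_of_pars hπ h1 h2 l))
    · intro h i hi
      exact h i hi hi
  have H2 : tableCmd.run π [] bk = run π (.rep 15 (.store 6 (var 0)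
      (meetsE (rd 3 (var 0)) acceptE))) [] bk1 := rfl
  have H3 : (∀ b, b ≠ 6 → tableCmd.run π [] bk b = bk1 b) ∧ ∀ i < π 15,
      (tableCmd.run π [] bk 6 i ≠ 0 ↔ Meets (π 7) (Q i) (acceptP π (bk 0))) := by
    rw [H2, run]
    refine iter_inv (P := fun (n : ℕ) (bk' : ℕ → ℕ → ℕ) => (∀ b, b ≠ 6 → bk' b = bk1 b) ∧ ∀ i < n,
      (bk' 6 i ≠ 0 ↔ Meets (π 7) (Q i) (acceptP π (bk 0)))) ⟨fun _ _ => rfl, by omega⟩ ?_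
    rintro n hn bk2 ⟨hb, ht⟩
    refine ⟨fun b hb6 => ?_, fun i hi => ?_⟩
    · rw [run, setCell, Function.update_of_ne hb6, hb b hb6]
    · rw [run, setCell, Function.update_self]
      simp only [eval_var, List.getD_cons_zero]
      by_cases hin : i = n
      · subst hin
        have e0 : bk2 0 = bk 0 := by rw [hb 0 (by decide), H1.1 0 (by decide)]
        have e1 : eval π bk2 (rd 3 (var 0)) [i] = Q i := by
          rw [eval_rd, hb 3 (by decide), H1.1 3 (by decide), hQ]
          rfl
        have e2 : eval π bk2 acceptE [i] = acceptP π (bk 0) := by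
          rw [eval_acceptE hπ, e0]
          rfl
        rw [Function.update_self, ← tr, tr_meetsE hπ, e1, e2]
        · rw [e1]
          exact (hlt i hn).le.trans hπ.sets_le
        · rw [e2]
          refine le_trans ?_ hπ.sets_le
          rw [hπ.sets]
          exact (pset_lt _ _).le
      · rw [Function.update_of_ne hin]
        exact ht i (by omega)
  refine ⟨fun b h5 h6 => (H3.1 b h6).trans (H1.1 b h5), fun i hi l => ?_, H3.2⟩
  obtain ⟨k, hk, hner, -⟩ := hcl i hi l trivial
  rw [H3.1 5 (by decide), H1.2 i hi l k hk hner]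
  exact ⟨hk, hner⟩

end

end SecondOrder


namespace SecondOrder

/-! ## Writing the code of the canonical automaton -/

open Ex Cmd

/-- Appends a value to the output in bank `0`, whose length is in cell `0` of bank `8`. -/
def emit (e : Ex) : Cmd :=
  .seq (.store 0 (rd 8 (num 0)) e) (.store 8 (num 0) (add (rd 8 (num 0)) (num 1)))

/-- A condition as a bit. -/
def flag (c : Ex) : Ex := ite c (num 1) (num 0)

/-- The numbers `ys` have been written; banks `5` and `6` contain the tables `b5` and `b6`. -/
structure Written (b5 b6 : ℕ → ℕ) (ys : List ℕ) (bk : ℕ → ℕ → ℕ) : Prop where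
  five : bk 5 = b5
  six : bk 6 = b6
  length : bk 8 0 = ys.length
  get : ∀ (i : ℕ) (h : i < ys.length), bk 0 i = ys[i]

/-- The command `c` writes `ys`. -/
def Emits (π : Fin 16 → ℕ) (b5 b6 : ℕ → ℕ) (ρ : List ℕ) (c : Cmd) (ys : List ℕ) : Prop :=
  ∀ zs bk, Written b5 b6 zs bk → Written b5 b6 (zs ++ ys) (c.run π ρ bk)

section

variable {π : Fin 16 → ℕ} {b5 b6 : ℕ → ℕ} {ρ : List ℕ}

/-- The value may depend on memory only through the two tables: bank `0`, where the input stood, is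
being overwritten. -/
theorem Emits.emit {e : Ex} {v : ℕ} (h : ∀ bk, bk 5 = b5 → bk 6 = b6 → eval π bk e ρ = v) :
    Emits π b5 b6 ρ (emit e) [v] := by
  intro zs bk hw
  have he := h bk hw.five hw.six
  have hrun : (SecondOrder.emit e).run π ρ bk = setCell (setCell bk 0 zs.length v) 8 0
      (zs.length + 1) := by
    have h8 : setCell bk 0 zs.length v 8 0 = zs.length := by simp [setCell, hw.length]
    rw [SecondOrder.emit, run, run, run, eval_rd, eval_num, hw.length, he, eval_add, eval_rd,
      eval_num, h8, eval_num]
  rw [hrun]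
  refine ⟨?_, ?_, ?_, fun i hi => ?_⟩
  · simp [setCell, hw.five]
  · simp [setCell, hw.six]
  · simp [setCell]
  · have h0 : setCell (setCell bk 0 zs.length v) 8 0 (zs.length + 1) 0 i =
        if i = zs.length then v else bk 0 i := by simp [setCell, Function.update_apply]
    rw [h0]
    split_ifs with hin
    · subst hin; simp
    · have : i < zs.length := by
        simp at hi
        omega
      rw [List.getElem_append_left this, hw.get i this]

theorem Emits.skip : Emits π b5 b6 ρ .skip [] := by
  intro zs bk hw
  rwa [List.append_nil]

theorem Emits.seq {c d : Cmd} {ys zs : List ℕ} (hc : Emits π b5 b6 ρ c ys)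
    (hd : Emits π b5 b6 ρ d zs) : Emits π b5 b6 ρ (.seq c d) (ys ++ zs) := by
  intro xs bk hw
  rw [← List.append_assoc]
  exact hd _ _ (hc _ _ hw)

theorem Emits.ite {e : Ex} {c d : Cmd} {ys : List ℕ} {P : Prop}
    (h : ∀ bk, tr π bk e ρ ↔ P) (hc : P → Emits π b5 b6 ρ c ys)
    (hd : ¬ P → Emits π b5 b6 ρ d ys) : Emits π b5 b6 ρ (.ite e c d) ys := by
  classical
  intro zs bk hw
  rw [run_ite (h bk)]
  split_ifs with hP
  · exact hc hP _ _ hw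
  · exact hd hP _ _ hw

theorem Emits.rep {j : Fin 16} {c : Cmd} {f : ℕ → List ℕ}
    (h : ∀ i < π j, Emits π b5 b6 (i :: ρ) c (f i)) :
    Emits π b5 b6 ρ (.rep j c) ((List.range (π j)).flatMap f) := by
  intro zs bk hw
  rw [run]
  refine iter_inv (P := fun (n : ℕ) (bk : ℕ → ℕ → ℕ) =>
    Written b5 b6 (zs ++ (List.range n).flatMap f) bk) (by simpa using hw) ?_
  intro i hi bk hw
  rw [List.range_succ, List.flatMap_append, List.flatMap_singleton, ← List.append_assoc]
  exact h i hi _ _ hw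

theorem range_flatMap {γ : Type*} {n : ℕ} (f : Fin n → List γ) (g : ℕ → List γ)
    (h : ∀ i : Fin n, g i = f i) : (List.range n).flatMap g = (List.finRange n).flatMap f := by
  rw [← List.map_coe_finRange_eq_range, List.flatMap_map]
  simp only [h]

theorem Emits.rep_fin {j : Fin 16} {c : Cmd} {n : ℕ} (hn : π j = n) {f : Fin n → List ℕ}
    (h : ∀ i : Fin n, Emits π b5 b6 (i :: ρ) c (f i)) :
    Emits π b5 b6 ρ (.rep j c) ((List.finRange n).flatMap f) := by
  subst hn
  rw [← range_flatMap f (fun i => if hi : i < π j then f ⟨i, hi⟩ else []) fun i => by simp]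
  refine Emits.rep fun i hi => ?_
  rw [dif_pos hi]
  exact h ⟨i, hi⟩

theorem Emits.bits_fin {j : Fin 16} {e : Ex} {n : ℕ} (hn : π j = n) {P : Fin n → Prop}
    (h : ∀ (i : Fin n) (bk), bk 5 = b5 → bk 6 = b6 → (tr π bk e (i :: ρ) ↔ P i)) :
    Emits π b5 b6 ρ (.rep j (SecondOrder.emit (flag e))) (bits (List.finRange n) P) := by
  classical
  rw [bits, List.map_eq_flatMap]
  refine Emits.rep_fin hn fun i => Emits.emit fun bk h5 h6 => ?_
  by_cases hP : P i
  · rw [if_pos hP, flag, eval_of_tr ((h i bk h5 h6).2 hP), eval_num]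
  · rw [if_neg hP, flag, eval_of_not_tr ((h i bk h5 h6).not.2 hP), eval_num]

theorem Emits.bits {j : Fin 16} {e : Ex} {P : ℕ → Prop}
    (h : ∀ i < π j, ∀ bk, tr π bk e (i :: ρ) ↔ P i) :
    Emits π b5 b6 ρ (.rep j (SecondOrder.emit (flag e))) (bits (List.range (π j)) P) := by
  have hb : SecondOrder.bits (List.range (π j)) P =
      SecondOrder.bits (List.finRange (π j)) fun i => P i := by
    rw [SecondOrder.bits, SecondOrder.bits, ← List.map_coe_finRange_eq_range, List.map_map]
    rfl
  rw [hb]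
  exact Emits.bits_fin rfl fun i bk _ _ => h i i.2 bk

/-- Writes the code of the layer with number `var 0`. -/
def layerCmd : Cmd :=
  .seq (emit (flag (flagI (var 0)))) (.seq (emit (flag (flagF (var 0))))
  (.seq (.rep 2 (emit (flag (bitL (var 1) (var 0)))))
  (.seq (.rep 2 (emit (flag (bitR (var 1) (var 0)))))
  (.seq (.rep 2 (emit (flag (bitI (var 1) (var 0)))))
  (.seq (.rep 2 (emit (flag (bitF (var 1) (var 0)))))
  (.rep 2 (.rep 1 (.rep 2 (emit (flag (bitT (var 3) (var 2) (var 1) (var 0))))))))))))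

variable {α : Type u} [LinearOrder α] [Fintype α] {w : ℕ}

theorem emits_layerCmd (hπ : Pars π) (h1 : π 1 = Fintype.card α) (h2 : π 2 = w)
    (l : LayerAlphabet α w) :
    Emits π b5 b6 (l.1.number w :: ρ) layerCmd (layerCode w l.1) := by
  have hlt : l.1.number w ≤ π 13 := (number_lt_of_pars hπ h1 h2 l).le.trans hπ.layers_le
  have hc := l.2.codes
  have hflag : ∀ (e : Ex) (b : Bool), (∀ bk, tr π bk e (l.1.number w :: ρ) ↔ b = true) →
      Emits π b5 b6 (l.1.number w :: ρ) (emit (flag e)) [b.toNat] := by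
    intro e b hb
    refine Emits.emit fun bk _ _ => ?_
    cases b with
    | true => rw [flag, eval_of_tr ((hb bk).2 rfl)]; rfl
    | false => rw [flag, eval_of_not_tr ((hb bk).not.2 (by simp))]; rfl
  have hcode : layerCode w l.1 = [l.1.initFlag.toNat] ++ ([l.1.finalFlag.toNat] ++
      (bits (List.range (π 2)) (· ∈ l.1.left) ++ (bits (List.range (π 2)) (· ∈ l.1.right) ++
      (bits (List.range (π 2)) (· ∈ l.1.init) ++ (bits (List.range (π 2)) (· ∈ l.1.final) ++
      (List.range (π 2)).flatMap fun p => (List.finRange (Fintype.card α)).flatMap fun a =>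
        bits (List.range (π 2)) fun q => (p, sym α a, q) ∈ l.1.trans))))) := by
    rw [h2, layerCode, sort_univ_eq]
    simp only [List.append_assoc, List.cons_append, List.nil_append, List.flatMap_map]
  rw [hcode]
  refine (hflag _ _ fun bk => ?_).seq ((hflag _ _ fun bk => ?_).seq
    ((Emits.bits fun q hq bk => ?_).seq ((Emits.bits fun q hq bk => ?_).seq
    ((Emits.bits fun q hq bk => ?_).seq ((Emits.bits fun q hq bk => ?_).seq
    (Emits.rep fun p hp => Emits.rep_fin h1 fun a => Emits.bits fun q hq bk => ?_))))))
  · rw [tr_flagI hπ (show eval π bk (var 0) (l.1.number w :: ρ) ≤ _ from hlt), h1, h2,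
      ← hc.initFlag]
    rfl
  · rw [tr_flagF hπ (show eval π bk (var 0) (l.1.number w :: ρ) ≤ _ from hlt), h1, h2,
      ← hc.finalFlag]
    rfl
  · rw [tr_bitL hπ (show eval π bk (var 1) (q :: l.1.number w :: ρ) ≤ _ from hlt), h1, h2,
      ← hc.left q (h2 ▸ hq)]
    rfl
  · rw [tr_bitR hπ (show eval π bk (var 1) (q :: l.1.number w :: ρ) ≤ _ from hlt), h1, h2,
      ← hc.right q (h2 ▸ hq)]
    rfl
  · rw [tr_bitI hπ (show eval π bk (var 1) (q :: l.1.number w :: ρ) ≤ _ from hlt), h1, h2,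
      ← hc.init q (h2 ▸ hq)]
    rfl
  · rw [tr_bitF hπ (show eval π bk (var 1) (q :: l.1.number w :: ρ) ≤ _ from hlt), h1, h2,
      ← hc.final q (h2 ▸ hq)]
    rfl
  · rw [tr_bitT hπ (show eval π bk (var 3) (q :: (a : ℕ) :: p :: l.1.number w :: ρ) ≤ _ from hlt),
      h1, h2,
      ← hc.trans p (h2 ▸ hp) _ q (h2 ▸ hq), idx_sym]
    rfl

/-- Writes the code of the automaton given by the tables. -/
def writeCmd : Cmd :=
  .seq (emit (par 1)) (.seq (emit (par 2)) (.seq (emit (par 15))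
  (.seq (.rep 15 (emit (flag (eq (var 0) (num 0)))))
  (.seq (.rep 15 (emit (flag (rd 6 (var 0)))))
  (.seq (emit (mulP (count 10 (validE (var 0))) 15))
  (.rep 15 (.rep 10 (.ite (validE (var 0))
    (.seq (emit (var 1)) (.seq (emit (rd 5 (add (mulP (var 1) 10) (var 0)))) layerCmd))
    .skip))))))))

/-- The layer with a given number. -/
noncomputable def decode (α : Type u) [LinearOrder α] [Fintype α] (w ℓ : ℕ) :
    Option (LayerAlphabet α w) :=
  open Classical in
  if h : ∃ l : LayerAlphabet α w, l.1.number w = ℓ then some h.choose else none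

theorem decode_eq_some {ℓ : ℕ} {l : LayerAlphabet α w} :
    decode α w ℓ = some l ↔ l.1.number w = ℓ := by
  unfold decode
  split_ifs with h
  · rw [Option.some.injEq]
    constructor
    · rintro rfl
      exact h.choose_spec
    · intro hl
      exact (number_strictMono w).injective (h.choose_spec.trans hl.symm)
  · simp only [false_iff]
    exact fun hl => h ⟨l, hl⟩

/-- All layers, ordered by their numbers. -/
noncomputable def letters (α : Type u) [LinearOrder α] [Fintype α] (w G : ℕ) :
    List (LayerAlphabet α w) := (List.range G).filterMap (decode α w)

theorem letters_nodup (G : ℕ) : (letters α w G).Nodup := by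
  refine List.Nodup.filterMap (fun ℓ ℓ' l h h' => ?_) List.nodup_range
  exact (decode_eq_some.1 h).symm.trans (decode_eq_some.1 h')

theorem mem_letters {G : ℕ} {l : LayerAlphabet α w} (h : l.1.number w < G) : l ∈ letters α w G :=
  List.mem_filterMap.2 ⟨_, List.mem_range.2 h, decode_eq_some.2 rfl⟩

theorem length_letters (G : ℕ) [DecidablePred fun ℓ => ∃ l : LayerAlphabet α w, l.1.number w = ℓ] :
    (letters α w G).length =
      ((List.range G).filter fun ℓ => ∃ l : LayerAlphabet α w, l.1.number w = ℓ).length := by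
  rw [letters, List.length_filterMap_eq_countP, List.countP_eq_length_filter]
  congr 2
  ext ℓ
  rw [Bool.eq_iff_iff, Option.isSome_iff_exists]
  simp only [decode_eq_some, decide_eq_true_eq]

theorem letters_flatMap {γ : Type*} (G : ℕ) (f : LayerAlphabet α w → List γ) :
    (letters α w G).flatMap f = (List.range G).flatMap fun ℓ => (decode α w ℓ).elim [] f := by
  unfold letters
  induction List.range G with
  | nil => rfl
  | cons ℓ L ih =>
    rw [List.flatMap_cons, ← ih, List.filterMap_cons]
    cases decode α w ℓ with
    | none => rfl
    | some l => rfl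

/-- By determinism and completeness there is one transition for each state and letter. Their number
can therefore be written in advance as the number of valid layer numbers times the number of states.
-/
theorem emits_writeCmd (hπ : Pars π) (h1 : π 1 = Fintype.card α) (h2 : π 2 = w)
    (A : FA (LayerAlphabet α w)) (hn : π 15 = A.n)
    (hstart : ∀ i, i ∈ A.nfa.start ↔ (i : ℕ) = 0) (haccept : ∀ i, i ∈ A.nfa.accept ↔ b6 i ≠ 0)
    (hstep : ∀ i l j, j ∈ A.nfa.step i l ↔ b5 (i * π 10 + l.1.number w) = (j : ℕ))
    (hb5 : ∀ (i : Fin A.n) (l : LayerAlphabet α w), b5 (i * π 10 + l.1.number w) < A.n) :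
    ∃ ys, A.IsCode ys ∧ Emits π b5 b6 [] writeCmd ys := by
  classical
  let tgt : Fin A.n → LayerAlphabet α w → Fin A.n := fun i l => ⟨_, hb5 i l⟩
  have hvalid : ∀ ℓ < π 10, ∀ (ρ : List ℕ) (bk : ℕ → ℕ → ℕ), tr π bk (validE (var 0)) (ℓ :: ρ) ↔
      ∃ l : LayerAlphabet α w, l.1.number w = ℓ := by
    intro ℓ hℓ ρ bk
    rw [tr_validE hπ (show eval π bk (var 0) (ℓ :: ρ) ≤ _ from hℓ.le.trans hπ.layers_le)]
    exact validNum_iff_of_pars hπ h1 h2 hℓ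
  set ts : List (Fin A.n × LayerAlphabet α w × Fin A.n) := (List.finRange A.n).flatMap fun i =>
    (letters α w (π 10)).map fun l => (i, l, tgt i l) with hts
  refine ⟨_, ⟨ts, ?_, fun p l q => ?_, rfl⟩, ?_⟩
  · rw [hts, List.nodup_flatMap]
    refine ⟨fun i _ => (letters_nodup _).map fun l l' h => ?_, ?_⟩
    · simp only [Prod.mk.injEq] at h
      exact h.2.1
    · refine (List.nodup_finRange A.n).imp fun {i j} hij => ?_
      intro t ht ht'
      obtain ⟨l, -, rfl⟩ := List.mem_map.1 ht
      obtain ⟨l', -, h⟩ := List.mem_map.1 ht'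
      simp only [Prod.mk.injEq] at h
      exact hij h.1.symm
  · rw [hstep, hts, List.mem_flatMap]
    constructor
    · rintro ⟨i, -, hi⟩
      obtain ⟨l', -, h⟩ := List.mem_map.1 hi
      simp only [Prod.mk.injEq] at h
      obtain ⟨rfl, rfl, rfl⟩ := h
      rfl
    · intro h
      refine ⟨p, List.mem_finRange p, List.mem_map.2
        ⟨l, mem_letters (number_lt_of_pars hπ h1 h2 l), ?_⟩⟩
      rw [show tgt p l = q from Fin.ext h]
  · have hlen : ts.length = (letters α w (π 10)).length * π 15 := by
      rw [hts, length_flatMap_const (k := (letters α w (π 10)).length) _ (by simp),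
        List.length_finRange, hn, mul_comm]
    have hflat : (ts.flatMap fun t => (t.1 : ℕ) :: (t.2.2 : ℕ) :: layerCode w t.2.1.1) =
        (List.finRange A.n).flatMap fun i : Fin A.n => (List.range (π 10)).flatMap fun ℓ =>
          (decode α w ℓ).elim [] fun l =>
            [(i : ℕ)] ++ ([b5 (i * π 10 + l.1.number w)] ++ layerCode w l.1) := by
      rw [hts, List.flatMap_assoc]
      simp only [List.flatMap_map, ← letters_flatMap]
      rfl
    have hcode : [Fintype.card α, w, A.n] ++ bits (List.finRange A.n) (· ∈ A.nfa.start) ++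
        bits (List.finRange A.n) (· ∈ A.nfa.accept) ++ [ts.length] ++
        (ts.flatMap fun t => (t.1 : ℕ) :: (t.2.2 : ℕ) :: layerCode w t.2.1.1) =
        [π 1] ++ ([π 2] ++ ([π 15] ++ (bits (List.finRange A.n) (· ∈ A.nfa.start) ++
        (bits (List.finRange A.n) (· ∈ A.nfa.accept) ++
        ([(letters α w (π 10)).length * π 15] ++
        (List.finRange A.n).flatMap fun i : Fin A.n => (List.range (π 10)).flatMap fun ℓ =>
          (decode α w ℓ).elim [] fun l =>
            [(i : ℕ)] ++ ([b5 (i * π 10 + l.1.number w)] ++ layerCode w l.1)))))) := by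
      rw [hflat, hlen, h1, h2, hn]
      simp only [List.append_assoc, List.cons_append, List.nil_append]
    rw [hcode]
    refine (Emits.emit fun _ _ _ => rfl).seq ((Emits.emit fun _ _ _ => rfl).seq
      ((Emits.emit fun _ _ _ => rfl).seq ((Emits.bits_fin hn fun i bk _ _ => ?_).seq
      ((Emits.bits_fin hn fun i bk _ h6 => ?_).seq ((Emits.emit fun bk _ _ => ?_).seq
      (Emits.rep_fin hn fun i => Emits.rep fun ℓ hℓ => Emits.ite (hvalid ℓ hℓ _) ?_ ?_))))))
    · rw [tr_eq, hstart]
      rfl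
    · rw [tr_rd, h6, haccept]
      rfl
    · rw [eval_mulP, eval_count fun ℓ hℓ => hvalid ℓ hℓ _ bk, length_letters]
    · rintro ⟨l, rfl⟩
      rw [decode_eq_some.2 rfl]
      refine (Emits.emit fun _ _ _ => rfl).seq ((Emits.emit fun bk h5 _ => ?_).seq
        (emits_layerCmd hπ h1 h2 l))
      rw [eval_rd, h5, eval_add, eval_mulP]
      rfl
    · intro hne
      have : decode α w ℓ = none := by
        rw [Option.eq_none_iff_forall_ne_some]
        exact fun l hl => hne ⟨l, decode_eq_some.1 hl⟩
      rw [this]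
      exact Emits.skip

end

end SecondOrder


namespace SecondOrder

/-! ## The program -/

open Ex Cmd

namespace Stage

/-- From a state with parameters at most `M`, the stages run with bounded parameters and lead to a
state satisfying `Q`. -/
def Leads (M : ℕ) (S : List Stage) (σ : State) (Q : State → Prop) : Prop :=
  (∀ j, σ.1 j ≤ M) → Bounded M S σ ∧ Q (runAll S σ)

theorem Leads.par {M : ℕ} {j : Fin 16} {e : Ex} {S : List Stage} {σ : State} {Q : State → Prop}
    {v : ℕ} (he : e.eval σ.1 σ.2 [] = v) (hv : v ≤ M)
    (h : Leads M S (Function.update σ.1 j v, σ.2) Q) : Leads M (.par j e :: S) σ Q := by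
  subst he
  intro hσ
  have := h fun i => by
    by_cases hij : i = j
    · subst hij; simpa using hv
    · simpa [hij] using hσ i
  exact ⟨⟨hσ, this.1⟩, this.2⟩

/-- No bound on the assigned value is needed, since parameters are bounded only at the beginning of
a stage. The length of the output is assigned in this way. -/
theorem Leads.last {M : ℕ} {j : Fin 16} {e : Ex} {σ : State} {Q : State → Prop}
    (h : Q (Function.update σ.1 j (e.eval σ.1 σ.2 []), σ.2)) : Leads M [.par j e] σ Q :=
  fun hσ => ⟨⟨hσ, trivial⟩, h⟩

theorem Leads.cmd {M : ℕ} {c : Cmd} {S : List Stage} {σ : State} {Q : State → Prop}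
    (h : Leads M S (σ.1, c.run σ.1 [] σ.2) Q) : Leads M (.cmd c :: S) σ Q :=
  fun hσ => ⟨⟨hσ, (h hσ).1⟩, (h hσ).2⟩

theorem Leads.mono {M : ℕ} {S : List Stage} {σ : State} {Q Q' : State → Prop}
    (h : Leads M S σ Q) (hQ : ∀ σ, Q σ → Q' σ) : Leads M S σ Q' :=
  fun hσ => ⟨(h hσ).1, hQ _ (h hσ).2⟩

end Stage

/-- Computes the parameters from the input, then the canonical automaton, and writes its code. -/
def stages : List Stage :=
  [.par 1 (rd 0 (num 0)), .par 2 (rd 0 (num 1)), .par 3 (rd 0 (num 2)),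
    .par 4 (rd 0 (add (add (num 3) (par 3)) (par 3))), .par 5 (add (par 2) (num 1)),
    .par 6 (powP 5 2), .par 7 (mulP (par 3) 6), .par 11 (num 2), .par 8 (powP 11 7),
    .par 14 (mulP (mulP (par 2) 1) 2),
    .par 12 (add (add (add (add (add (par 14) (par 2)) (par 2)) (par 2)) (par 2)) (num 2)),
    .par 9 (add (par 12) (num 2)), .par 10 (powP 11 12), .par 13 (add (add (par 7) (par 8)) (par 10)),
    .cmd markCmd, .cmd bfsCmd, .par 15 (rd 4 (num 0)), .cmd tableCmd, .cmd writeCmd,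
    .par 0 (rd 8 (num 0))]

/-- The values of the parameters before the search. -/
structure Ready (π : Fin 16 → ℕ) (σ w n T : ℕ) : Prop extends Pars π where
  one_eq : π 1 = σ
  two_eq : π 2 = w
  three_eq : π 3 = n
  four_eq : π 4 = T

theorem Ready.update {π : Fin 16 → ℕ} {σ w n T : ℕ} (h : Ready π σ w n T) (m : ℕ) :
    Ready (Function.update π 15 m) σ w n T := by
  have e : ∀ j : Fin 16, j ≠ 15 → Function.update π 15 m j = π j := fun j hj =>
    Function.update_of_ne hj _ _
  obtain ⟨⟨h1, h2, h3, h4, h5, h6, h7, h8, h9, h10, h11, h12, h13⟩, g1, g2, g3, g4⟩ := h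
  refine ⟨⟨?_, ?_, ?_, ?_, ?_, ?_, ?_, ?_, ?_, ?_, ?_, ?_, ?_⟩, ?_, ?_, ?_, ?_⟩ <;>
    (repeat rw [e _ (by decide)]) <;> assumption

theorem leads_setup {M : ℕ} {σ w n T len : ℕ} {bk : ℕ → ℕ → ℕ} {S : List Stage}
    {Q : Stage.State → Prop} (hσ0 : 0 < σ) (hw0 : 0 < w) (h0 : bk 0 0 = σ) (h1 : bk 0 1 = w)
    (h2 : bk 0 2 = n) (h3 : bk 0 (3 + n + n) = T)
    (hσ : σ ≤ M) (hn : n ≤ M) (hT : T ≤ M) (hH : (w + 1) ^ w ≤ M)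
    (hL : w * σ * w + w + w + w + w + 4 ≤ M)
    (hsum : n * (w + 1) ^ w + 2 ^ (n * (w + 1) ^ w) +
      2 ^ (w * σ * w + w + w + w + w + 2) ≤ M)
    (hS : ∀ π, Ready π σ w n T → Stage.Leads M S (π, bk) Q) :
    Stage.Leads M ([.par 1 (rd 0 (num 0)), .par 2 (rd 0 (num 1)), .par 3 (rd 0 (num 2)),
    .par 4 (rd 0 (add (add (num 3) (par 3)) (par 3))), .par 5 (add (par 2) (num 1)),
    .par 6 (powP 5 2), .par 7 (mulP (par 3) 6), .par 11 (num 2), .par 8 (powP 11 7),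
    .par 14 (mulP (mulP (par 2) 1) 2),
    .par 12 (add (add (add (add (add (par 14) (par 2)) (par 2)) (par 2)) (par 2)) (num 2)),
    .par 9 (add (par 12) (num 2)), .par 10 (powP 11 12),
    .par 13 (add (add (par 7) (par 8)) (par 10))] ++ S)
      (fun j => if j = 0 then len else 0, bk) Q := by
  have hN := (Nat.le_add_right _ _).trans ((Nat.le_add_right _ _).trans hsum)
  have hS' := (Nat.le_add_left _ _).trans ((Nat.le_add_right _ _).trans hsum)
  have hG := (Nat.le_add_left _ _).trans hsum
  simp only [List.cons_append, List.nil_append]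
  refine .par (v := σ) h0 hσ (.par (v := w) h1 (by omega) (.par (v := n) h2 hn
    (.par (v := T) ?_ hT (.par (v := w + 1) ?_ (by omega) (.par (v := (w + 1) ^ w) ?_ hH
    (.par (v := n * (w + 1) ^ w) ?_ hN (.par (v := 2) rfl (by omega)
    (.par (v := 2 ^ (n * (w + 1) ^ w)) ?_ hS' (.par (v := w * σ * w) ?_ (by omega)
    (.par (v := w * σ * w + w + w + w + w + 2) ?_ (by omega)
    (.par (v := w * σ * w + w + w + w + w + 4) ?_ hL
    (.par (v := 2 ^ (w * σ * w + w + w + w + w + 2)) ?_ hG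
    (.par (v := n * (w + 1) ^ w + 2 ^ (n * (w + 1) ^ w) +
      2 ^ (w * σ * w + w + w + w + w + 2)) ?_ hsum (hS _ ?_))))))))))))))
  · rw [← h3]; simp
  · simp
  · rw [eval_powP]; simp
  · simp
  · rw [eval_powP]; simp
  · simp
  · simp
  · simp
  · rw [eval_powP]; simp
  · simp
  · constructor
    · constructor <;> simp <;> first
        | omega
        | exact (Nat.le_add_right _ _).trans (Nat.le_add_right _ _)
        | exact (Nat.le_add_left _ _).trans (Nat.le_add_right _ _)
    all_goals simp

section

variable {α : Type u} [LinearOrder α] [Fintype α] {w : ℕ}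

theorem leads_search {M : ℕ} {π : Fin 16 → ℕ} {bk : ℕ → ℕ → ℕ} {n T : ℕ}
    (hπ : Ready π (Fintype.card α) w n T) (hM : 2 ^ π 7 ≤ M) (hbk : ∀ b X, b ≠ 0 → bk b X = 0) :
    ∃ (Q : ℕ → ℕ) (m : ℕ) (W : ℕ → List (LayerAlphabet α w)) (ys : List ℕ),
      IsNumbering (fun s (l : LayerAlphabet α w) => post (π 7) (DeltaP π bk) s (l.1.number w))
        (fun s => Meets (π 7) s (acceptP π (bk 0))) (startP π (bk 0)) Q m W ∧
      IsClosed (fun s (l : LayerAlphabet α w) => post (π 7) (DeltaP π bk) s (l.1.number w))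
        (fun s => Meets (π 7) s (acceptP π (bk 0))) Q m W (fun _ _ => True) ∧
      (FA.ofNumbering (fun s (l : LayerAlphabet α w) =>
          post (π 7) (DeltaP π bk) s (l.1.number w))
        (fun s => Meets (π 7) s (acceptP π (bk 0))) Q m).IsCode ys ∧
      Stage.Leads M [.cmd markCmd, .cmd bfsCmd, .par 15 (rd 4 (num 0)), .cmd tableCmd,
        .cmd writeCmd, .par 0 (rd 8 (num 0))] (π, bk) fun σ =>
          σ.1 0 = ys.length ∧ ∀ (i : ℕ) (h : i < ys.length), σ.2 0 i = ys[i] := by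
  have hp := hπ.toPars
  obtain ⟨μ, hμ, hμ'⟩ := markCmd_run hp hπ.one_eq hπ.two_eq fun X => hbk 2 X (by decide)
  set bk1 := markCmd.run π [] bk with hbk1
  have e10 : bk1 0 = bk 0 := by rw [hμ]; simp
  have e12 : bk1 2 = μ := by rw [hμ]; simp
  have hΔ1 : DeltaP π bk1 = DeltaP π bk := by simp only [DeltaP, e10]
  have hmk : Marked w α π (bk 0) (DeltaP π bk) μ := marked_of_pull hp hμ'
  obtain ⟨Q, m, hQ, hf⟩ := bfsCmd_run (α := α) (w := w) (bk := bk1) hp hπ.one_eq hπ.two_eq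
    (by rw [e10, e12, hΔ1]; exact hmk)
  rw [e10, hΔ1] at hf
  set bk2 := bfsCmd.run π [] bk1 with hbk2
  have e20 : bk2 0 = bk 0 := by rw [hQ, ← e10]; simp
  have e22 : bk2 2 = μ := by rw [hQ, ← e12]; simp
  have e23 : bk2 3 = Q := by rw [hQ]; simp
  have e24 : bk2 4 0 = m := by rw [hQ]; simp
  have e28 : bk2 8 0 = 0 := by rw [hQ, hμ]; simp [hbk]
  set π' := Function.update π 15 m with hπ'
  have e : ∀ j : Fin 16, j ≠ 15 → π' j = π j := fun j hj => Function.update_of_ne hj _ _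
  have em : π' 15 = m := by simp [hπ']
  have hr := hπ.update m
  rw [← hπ'] at hr
  have hp' := hr.toPars
  have hΔ2 : DeltaP π' bk2 = DeltaP π bk := by
    simp only [DeltaP, e20]
    repeat rw [e _ (by decide)]
  have hA : ∀ X, acceptP π' X = acceptP π X := fun X => by
    simp only [acceptP]
    repeat rw [e _ (by decide)]
  have hS : ∀ X, startP π' X = startP π X := fun X => by
    simp only [startP]
    repeat rw [e _ (by decide)]
  obtain ⟨ht0, ht5, ht6⟩ := tableCmd_run (α := α) (w := w) (bk := bk2) hp' hr.one_eq hr.two_eq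
    (by
      rw [e20, e22, hΔ2]
      unfold Marked at hmk ⊢
      rw [hA, e 7 (by decide), e 8 (by decide)]
      exact hmk) e23 (by
      rw [e20, hΔ2, em]
      obtain ⟨h1, h2, h3⟩ := hf
      refine ⟨?_, ?_, ?_⟩
      · rw [hA, hS, e 7 (by decide)]
        exact h1
      · rw [e 8 (by decide)]
        exact h2
      · rw [e 8 (by decide)]
        exact h3)
  rw [em, e20, hA, hΔ2, e 7 (by decide), e 10 (by decide)] at ht5
  rw [em, e20, hA, e 7 (by decide)] at ht6
  obtain ⟨⟨W, hnum, hcl⟩, hlt, hle⟩ := hf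
  set bk3 := tableCmd.run π' [] bk2 with hbk3
  obtain ⟨ys, hys, hemit⟩ := emits_writeCmd (b5 := bk3 5) (b6 := bk3 6) hp' hr.one_eq hr.two_eq
    (FA.ofNumbering (fun s (l : LayerAlphabet α w) =>
          post (π 7) (DeltaP π bk) s (l.1.number w))
        (fun s => Meets (π 7) s (acceptP π (bk 0))) Q m) em (fun i => Iff.rfl)
    (fun i => (ht6 i i.2).symm) (fun i l j => by
      obtain ⟨h1, h2⟩ := ht5 i i.2 l
      rw [e 10 (by decide)]
      constructor
      · intro h
        exact hnum.inj h1 j.2 (h2.trans (Ner.symm h))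
      · intro h
        rw [h] at h2
        exact h2) (fun i l => by
      rw [e 10 (by decide)]
      exact (ht5 i i.2 l).1)
  refine ⟨Q, m, W, ys, hnum, hcl, hys, .cmd (.cmd (.par (v := m) e24 ?_ (.cmd (.cmd (.last ?_)))))⟩
  · rw [hp.sets] at hle
    exact hle.trans hM
  · obtain ⟨-, -, h8, h0⟩ := hemit [] bk3 ⟨rfl, rfl, by rw [ht0 8 (by decide) (by decide), e28]; rfl,
      by simp⟩
    exact ⟨by simpa using h8, by simpa using h0⟩

end

end SecondOrder


namespace SecondOrder

/-! ## The running time and the correctness of the program -/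

/-- With `E = max 1 n * Y ^ 6` and `Z = 2 ^ E`, one has `L + 2 ≤ Y ^ 6 ≤ E` and `n * (w + 1) ^ w ≤
E`. So there are at most `Z` subsets and `Z` layer numbers, at most `Z ^ 3` transitions, and the
input has length at most `Z ^ 5`; `M = Z ^ 8` leaves room for all of this. -/
theorem param_bounds {σ w n T len Y L M : ℕ} (hσ : 0 < σ) (hw : 0 < w)
    (hL : L = w * σ * w + w + w + w + w + 2) (hT : T ≤ n * (2 ^ L * n))
    (hlen : len = 4 + n + n + T * (L + 2)) (hY : Y = (w + 1) ^ (σ * w))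
    (hM : M = 2 ^ (8 * (max 1 n * Y ^ 6))) :
    σ ≤ M ∧ n ≤ M ∧ T ≤ M ∧ (w + 1) ^ w ≤ M ∧ L + 2 ≤ M ∧ len ≤ M ∧
      n * (w + 1) ^ w + 2 ^ (n * (w + 1) ^ w) + 2 ^ L ≤ M ∧ 2 ^ (n * (w + 1) ^ w) ≤ M := by
  have hσw : σ * w ≠ 0 := by positivity
  have hwY : w + 1 ≤ Y := by rw [hY]; exact Nat.le_self_pow hσw _
  have hY2 : 2 ≤ Y := by omega
  have hσY : σ ≤ Y := by
    have h1 : σ < 2 ^ σ := Nat.lt_two_pow_self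
    have h2 : 2 ^ σ ≤ (w + 1) ^ σ := Nat.pow_le_pow_left (by omega) _
    have h3 : (w + 1) ^ σ ≤ Y := by
      rw [hY]
      exact Nat.pow_le_pow_right (by omega) (Nat.le_mul_of_pos_right _ hw)
    omega
  have hHY : (w + 1) ^ w ≤ Y := by
    rw [hY]
    exact Nat.pow_le_pow_right (by omega) (Nat.le_mul_of_pos_left _ hσ)
  have hY6 : L + 2 ≤ Y ^ 6 := by
    have h1 : w * σ * w ≤ Y * Y * Y := by gcongr <;> omega
    have h4 : 2 * 2 ≤ Y * Y := Nat.mul_le_mul hY2 hY2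
    have h5 : 4 * Y ≤ Y * Y * Y := Nat.mul_le_mul h4 le_rfl
    have h6 : 8 * (Y * Y * Y) ≤ Y * Y * Y * (Y * Y * Y) := Nat.mul_le_mul (by omega) le_rfl
    have h7 : Y * Y * Y * (Y * Y * Y) = Y ^ 6 := by ring
    omega
  set ν := max 1 n with hν
  have hν1 : 1 ≤ ν := le_max_left _ _
  have hνn : n ≤ ν := le_max_right _ _
  set E := ν * Y ^ 6 with hE
  have hYE : Y ^ 6 ≤ E := Nat.le_mul_of_pos_left _ hν1
  have hY1 : Y ≤ Y ^ 6 := Nat.le_self_pow (by norm_num) _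
  have hνE : ν ≤ E := Nat.le_mul_of_pos_right _ (by omega)
  set Z := 2 ^ E with hZ
  have hEZ : E ≤ Z := Nat.lt_two_pow_self.le
  have hMZ : M = Z ^ 8 := by rw [hM, hZ, ← pow_mul, mul_comm]
  have hNE : n * (w + 1) ^ w ≤ E := Nat.mul_le_mul hνn (hHY.trans hY1)
  have hS : 2 ^ (n * (w + 1) ^ w) ≤ Z := Nat.pow_le_pow_right (by omega) hNE
  have hG : 2 ^ L ≤ Z := Nat.pow_le_pow_right (by omega) (by omega)
  have hZ4 : 4 ≤ Z := by
    have : 2 ^ 2 ≤ 2 ^ E := Nat.pow_le_pow_right (by omega) (by omega)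
    omega
  have hT3 : T ≤ Z ^ 3 := by
    refine hT.trans ?_
    calc n * (2 ^ L * n) ≤ Z * (Z * Z) := by gcongr <;> omega
      _ = Z ^ 3 := by ring
  have hpow : ∀ {i j}, i ≤ j → Z ^ i ≤ Z ^ j := fun h => Nat.pow_le_pow_right (by omega) h
  have hZ1 : Z ^ 1 ≤ Z ^ 8 := hpow (by norm_num)
  have hZ2 : 4 * Z ≤ Z ^ 2 := by rw [pow_two]; exact Nat.mul_le_mul hZ4 le_rfl
  have hZ28 : Z ^ 2 ≤ Z ^ 8 := hpow (by norm_num)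
  have hZ38 : Z ^ 3 ≤ Z ^ 8 := hpow (by norm_num)
  have hlen' : len ≤ Z ^ 8 := by
    have h1 : T * (L + 2) ≤ Z ^ 3 * Z := Nat.mul_le_mul hT3 (by omega)
    have h2 : Z ^ 3 * Z = Z ^ 4 := by ring
    have h3 : Z ^ 2 ≤ Z ^ 4 := hpow (by norm_num)
    have h4 : 4 * Z ^ 4 ≤ Z ^ 5 := by
      rw [pow_succ Z 4, mul_comm]
      exact Nat.mul_le_mul le_rfl hZ4
    have h5 : Z ^ 5 ≤ Z ^ 8 := hpow (by norm_num)
    omega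
  rw [hMZ]
  refine ⟨?_, ?_, ?_, ?_, ?_, hlen', ?_, ?_⟩ <;> omega

/-- From `M + 1 ≤ 2 ^ (9 * E)` and `C ≤ 2 ^ C`, a polynomial in `M` is at most `2 ^ (C + 9 * E *
d)`; the term `C` is absorbed because `E ≥ 1`. -/
theorem time_bound {C d c E M t : ℕ} (hE : 1 ≤ E) (hM : M = 2 ^ (8 * E)) (hc : c = C + 9 * d)
    (ht : t ≤ C * (M + 1) ^ d) : t ≤ 2 ^ (E * c) := by
  have hM1 : M + 1 ≤ 2 ^ (9 * E) := by
    have h1 : M * 2 ≤ 2 ^ (9 * E) := by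
      rw [hM, ← pow_succ]
      exact Nat.pow_le_pow_right (by omega) (by omega)
    have h2 : 1 ≤ M := by rw [hM]; exact Nat.one_le_two_pow
    omega
  calc t ≤ C * (M + 1) ^ d := ht
    _ ≤ 2 ^ C * (2 ^ (9 * E)) ^ d :=
        Nat.mul_le_mul Nat.lt_two_pow_self.le (Nat.pow_le_pow_left hM1 d)
    _ = 2 ^ (C + 9 * E * d) := by rw [← pow_mul, ← pow_add]
    _ ≤ 2 ^ (E * c) := by
        refine Nat.pow_le_pow_right (by omega) ?_
        rw [hc]
        nlinarith [Nat.zero_le C]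

theorem FA.exists_isCode {α : Type u} [LinearOrder α] [Fintype α] {w : ℕ}
    (F : FA (LayerAlphabet α w)) : ∃ x, F.IsCode x := by
  classical
  set G := 2 ^ (w * Fintype.card α * w + w + w + w + w + 2) with hG
  refine ⟨_, ((List.finRange F.n ×ˢ (letters α w G ×ˢ List.finRange F.n)).filter
    fun t => t.2.2 ∈ F.nfa.step t.1 t.2.1), ?_, fun p l q => ?_, rfl⟩
  · exact ((List.nodup_finRange _).product ((letters_nodup _).product
      (List.nodup_finRange _))).filter _
  · have : l ∈ letters α w G := mem_letters l.2.number_lt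
    simp [List.mem_filter, this]

/-- The program computes the second canonical form over the alphabet of `(α, w)`-layers. -/
theorem exists_canonical_automaton : ∃ c : ℕ, ∀ (α : Type u) [Fintype α] [LinearOrder α]
    [Nonempty α] (w : ℕ), 0 < w → ∀ F : FA (LayerAlphabet α w),
    (∀ D ∈ F.firstLang, IsCDODD w D) → ∀ x, F.IsCode x → ∃ A : FA (LayerAlphabet α w), A.Nice ∧
      (∀ u, u ∈ A.nfa.accepts ↔ ∃ D ∈ F.firstLang, IsCanonicalODD D (u.map Subtype.val)) ∧
      ∃ ys, A.IsCode ys ∧ Runs (Stage.compAll stages) (Mem.start x)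
        (2 ^ (max 1 F.n * ((w + 1) ^ (Fintype.card α * w)) ^ c)) fun s => s.Outputs ys := by
  obtain ⟨C, d, hcost⟩ := Stage.exists_cost_le stages
  -- The `6` is the exponent of `Y` in `E`. The factor `C + 9 * d` from `time_bound` moves into the
  -- exponent of `Y`, as `k ≤ 2 ^ k ≤ Y ^ k`.
  refine ⟨6 + (C + 9 * d), ?_⟩
  intro α _ _ _ w hw F hF x hx
  obtain ⟨T, hT, hin, hlen⟩ := hx.inCode
  set Y := (w + 1) ^ (Fintype.card α * w) with hY
  set E := max 1 F.n * Y ^ 6 with hE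
  set M := 2 ^ (8 * E) with hM
  obtain ⟨b1, b2, b3, b4, b5, b6, b7, b8⟩ := param_bounds (Fintype.card_pos) hw rfl hT hlen hY hM
  set bk : ℕ → ℕ → ℕ := (Mem.start x).bank with hbk
  have hbk0 : bk 0 = fun i => x.getD i 0 := by funext i; simp [hbk, Mem.start]
  have hbkb : ∀ b X, b ≠ 0 → bk b X = 0 := fun b X hb => by simp [hbk, Mem.start, hb]
  let R : Stage.State → Prop := fun σ => ∃ A : FA (LayerAlphabet α w), A.Nice ∧
      (∀ u, u ∈ A.nfa.accepts ↔ ∃ D ∈ F.firstLang, IsCanonicalODD D (u.map Subtype.val)) ∧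
      ∃ ys, A.IsCode ys ∧ σ.1 0 = ys.length ∧ ∀ (i : ℕ) (h : i < ys.length), σ.2 0 i = ys[i]
  have hleads : Stage.Leads M stages (fun j => if j = 0 then x.length else 0, bk) R := by
    refine leads_setup (σ := Fintype.card α) (w := w) (n := F.n) (T := T) Fintype.card_pos hw
      ?_ ?_ ?_ ?_ b1 b2 b3 b4 b5 b7 fun π hπ => ?_
    · rw [hbk0]; exact hin.card
    · rw [hbk0]; exact hin.width
    · rw [hbk0]; exact hin.size
    · rw [hbk0]; exact hin.count
    have h6 : π 6 = (w + 1) ^ w := by rw [hπ.funs, hπ.two_eq]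
    have h7 : π 7 = F.n * (w + 1) ^ w := by rw [hπ.states, hπ.three_eq, h6]
    obtain ⟨Q, m, W, ys, hnum, hcl, hcode, hl⟩ := leads_search (M := M) (bk := bk) hπ
      (by rw [h7]; exact b8) hbkb
    refine hl.mono fun σ hσ => ⟨_, hnum.nice hcl, fun u => ?_, ys, hcode, hσ⟩
    rw [hnum.accepts hcl]
    have hΔ : Ex.DeltaP π bk = Delta (Fintype.card α) w F.n ((w + 1) ^ w) T
        (w * Fintype.card α * w + w + w + w + w + 4) fun i => x.getD i 0 := by
      rw [Ex.DeltaP, hπ.one_eq, hπ.two_eq, hπ.three_eq, hπ.four_eq, h6, hπ.block, hπ.one_eq, hπ.two_eq,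
        hbk0]
    have hstart := meets_start_iff rfl hin u
    simp only [acceptP, startP, h6, h7, hΔ, hπ.three_eq, hbk0]
    refine hstart.trans (exists_congr fun D => and_congr_right fun hD => ?_)
    exact (isCanonicalODD_iff hw (hF D hD)).symm
  have hpars : (Mem.start x).pars = fun j => if j = 0 then x.length else 0 := by
    funext j
    change (if (j : ℕ) = 0 then x.length else 0) = _
    by_cases hj : j = 0
    · rw [hj]; rfl
    · rw [if_neg hj]
      exact if_neg fun h => hj (Fin.ext h)
  -- At the start the only nonzero parameter is number `0`, the length of the input; its bound is
  -- the one for `len` in `param_bounds`.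
  have hbound := hleads fun j => by
    dsimp only
    split_ifs <;> omega
  obtain ⟨A, hA, hAL, ys, hys, h0, h1⟩ := hbound.2
  refine ⟨A, hA, hAL, ys, hys, ?_⟩
  rw [← hpars, hbk] at hbound h0 h1
  refine (Stage.compAll_spec M stages (Mem.start x) hbound.1).mono ?_ fun s hs => ?_
  · have hE1 : 1 ≤ E := by
      have : 0 < E := by positivity
      omega
    refine (time_bound hE1 hM rfl (hcost M)).trans (Nat.pow_le_pow_right (by omega) ?_)
    rw [hE, mul_assoc, pow_add]
    refine Nat.mul_le_mul le_rfl (Nat.mul_le_mul le_rfl ?_)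
    have hY2 : 2 ≤ Y := by
      have hne : Fintype.card α * w ≠ 0 := mul_ne_zero Fintype.card_ne_zero hw.ne'
      have := Nat.le_self_pow hne (w + 1)
      omega
    exact Nat.lt_two_pow_self.le.trans (Nat.pow_le_pow_left hY2 _)
  · rw [← hs] at h0 h1
    exact ⟨h0, h1⟩

end SecondOrder


/-! ### The main theorem. -/

theorem mainTheorem11 :
    ∃ (P : SecondOrder.Prog) (c : ℝ),
      ∀ (α : Type*) [Fintype α] [LinearOrder α] [Nonempty α] (w : ℕ), 0 < w →
      ∀ F : SecondOrder.FA (SecondOrder.LayerAlphabet α w),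
        F.IsSOFA → (∀ D ∈ F.firstLang, SecondOrder.IsCDODD w D) →
        ∃ C : SecondOrder.FA (SecondOrder.LayerAlphabet α (2 ^ w)),
          -- `C` is the second canonical form of `F` in the general sense
          (F.IsSecondCanonicalForm C ∧ ∀ C' : SecondOrder.FA (SecondOrder.LayerAlphabet α (2 ^ w)),
            F.IsSecondCanonicalForm C' → C' = C) ∧
          -- as an automaton over the alphabet of `(α, w)`-layers it is an `(α, w)`-SOFA,
          -- and it is the second canonical form of `F` over that alphabet
          (C.restrict Nat.lt_two_pow_self.le).IsSOFA ∧
          (C.restrict Nat.lt_two_pow_self.le).firstLang = C.firstLang ∧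
          F.IsSecondCanonicalForm (C.restrict Nat.lt_two_pow_self.le) ∧
          (C.restrict Nat.lt_two_pow_self.le).secondLang = F.secondLang ∧
          -- it is computed by `P` within the time bound
          ∀ x : List ℕ, F.IsCode x →
            ∃ (t : ℕ) (s : SecondOrder.Mem) (y : List ℕ),
              SecondOrder.Exec P (SecondOrder.Mem.start x) t s ∧ s.Outputs y ∧
              (C.restrict Nat.lt_two_pow_self.le).IsCode y ∧
              (t : ℝ) ≤ (2 : ℝ) ^ (((max 1 F.n : ℕ) : ℝ) *
                (2 : ℝ) ^ (c * (Fintype.card α * w * Real.logb 2 (w + 1)))) := by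
  obtain ⟨c, hc⟩ := SecondOrder.exists_canonical_automaton
  refine ⟨SecondOrder.Stage.compAll SecondOrder.stages, c, fun α _ _ _ w hw F _ hF => ?_⟩
  have hwv : w ≤ 2 ^ w := Nat.lt_two_pow_self.le
  -- The automaton comes from a run of the program, so some code of `F` is needed before `C` can be
  -- named.
  obtain ⟨x₀, hx₀⟩ := F.exists_isCode
  obtain ⟨A, hA, hL, -⟩ := hc α w hw F hF x₀ hx₀
  obtain ⟨C, ⟨hC, hu⟩, h1, h2, h3, h4, -⟩ :=
    SecondOrder.FA.exists_secondCanonicalForm hw hwv hF hA hL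
  refine ⟨C, ⟨hC, hu⟩, h1, h2, h3, h4, fun x hx => ?_⟩
  obtain ⟨B, hB, hBL, y, hy, t, s, he, ht, ho⟩ := hc α w hw F hF x hx
  obtain ⟨C', ⟨hC', -⟩, -, -, -, -, hr⟩ :=
    SecondOrder.FA.exists_secondCanonicalForm hw hwv hF hB hBL
  -- Another code of `F` could a priori lead the program to another automaton `B`; uniqueness of the
  -- second canonical form identifies the two.
  obtain rfl := hu C' hC'
  refine ⟨t, s, y, he, ho, hr.symm ▸ hy, ?_⟩
  -- Since `2 ^ logb 2 (w + 1) = w + 1`, the bound in the exponent is the natural number `Y ^ c`.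
  have hpow : (2 : ℝ) ^ ((c : ℝ) * (Fintype.card α * w * Real.logb 2 (w + 1))) =
      (((w + 1) ^ (Fintype.card α * w)) ^ c : ℕ) := by
    have h2 : (2 : ℝ) ^ Real.logb 2 ((w : ℝ) + 1) = w + 1 :=
      Real.rpow_logb (by norm_num) (by norm_num) (by positivity)
    rw [show (c : ℝ) * (Fintype.card α * w * Real.logb 2 (w + 1)) =
      Real.logb 2 (w + 1) * ((Fintype.card α * w * c : ℕ) : ℝ) by push_cast; ring,
      Real.rpow_mul (by norm_num), h2, Real.rpow_natCast, pow_mul]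
    push_cast
    rfl
  rw [hpow, ← Nat.cast_mul, Real.rpow_natCast]
  exact_mod_cast ht
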